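/- Let $k\ge 1$ and $r\ge 3$ be integers. The clique-path $P_{k,r}$ is the graph with vertices $p_1,\dots,p_{k+1}$ and $c_{i,j}$ ($1\le i\le k$, $1\le j\le r-2$), whose edges are $p_ip_{i+1}$, $p_ic_{i,j}$, $p_{i+1}c_{i,j}$ for $1\le i\le k$, $1\le j\le r-2$, and $c_{i,a}c_{i,b}$ for $1\le i\le k$, $1\le a<b\le r-2$; that is, a path with $k$ edges in which each edge is extended to an $r$-clique by new vertices. A graph is $P_{k,r}$-free if it contains no (not necessarily induced) subgraph isomorphic to $P_{k,r}$. Let $f=\lfloor (k-1)/2\rfloor$. For $n$ large, let $T_{n-f,r-1}$ be the complete $(r-1)$-partite graph on $n-f$ vertices whose part sizes differ by at most one, and let $K_f\vee T_{n-f,r-1}$ be its join with a clique on $f$ vertices. If $k$ is odd, a $G_{n,k,r}$ is the graph $K_f\vee T_{n-f,r-1}$; if $k$ is even, a $G_{n,k,r}$ is any graph obtained from $K_f\vee T_{n-f,r-1}$ by adding one edge between two distinct non-adjacent vertices (so for even $k$ there may be two non-isomorphic graphs $G_{n,k,r}$). All graphs $G_{n,k,r}$ have the same number of edges, denoted $g_{n,k,r}$.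 Theorem. Let $n>16k^8r^{11}$. Every $P_{k,r}$-free graph $G$ on $n$ vertices satisfies $|E(G)|\le g_{n,k,r}$, and equality holds if and only if $G$ is isomorphic to a $G_{n,k,r}$. Moreover, every $G_{n,k,r}$ is itself $P_{k,r}$-free. -/

import Mathlib

/-- The clique-path `P_{k,r}`: a path `p_0, …, p_k` with `k` edges, where the `i`-th edge
`p_i p_{i+1}` (for `i < k`) is extended to an `r`-clique by `r - 2` new vertices `c_{i,j}`.
The vertex `p_i` is `Sum.inl i` and the vertex `c_{i,j}` is `Sum.inr (i, j)`. -/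
def cliquePath (k r : ℕ) : SimpleGraph (Fin (k + 1) ⊕ Fin k × Fin (r - 2)) where
  Adj
    | Sum.inl i, Sum.inl j => (SimpleGraph.pathGraph (k + 1)).Adj i j
    | Sum.inl i, Sum.inr c => i = c.1.castSucc ∨ i = c.1.succ
    | Sum.inr c, Sum.inl i => i = c.1.castSucc ∨ i = c.1.succ
    | Sum.inr c, Sum.inr d => c.1 = d.1 ∧ c.2 ≠ d.2
  symm := ⟨by
    rintro (i | c) (j | d) h
    · exact h.symm
    · exact h
    · exact h
    · exact ⟨h.1.symm, h.2.symm⟩⟩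
  loopless := ⟨by
    rintro (i | c) h
    · exact (SimpleGraph.pathGraph (k + 1)).loopless.irrefl i h
    · exact h.2 rfl⟩

/-- The join `G ∨ H`: the disjoint union of `G` and `H` together with all edges between them. -/
def graphJoin {V W : Type*} (G : SimpleGraph V) (H : SimpleGraph W) : SimpleGraph (V ⊕ W) :=
  G.sum H ⊔ completeBipartiteGraph V W

/-- The number `f = ⌊(k - 1) / 2⌋` of universal vertices (used for `k ≥ 1`). -/
def numUniversal (k : ℕ) : ℕ := (k - 1) / 2

/-- The graph `K_f ∨ T_{n-f,r-1}` with `f = ⌊(k - 1) / 2⌋`. -/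
def joinTuran (n k r : ℕ) : SimpleGraph (Fin (numUniversal k) ⊕ Fin (n - numUniversal k)) :=
  graphJoin (⊤ : SimpleGraph (Fin (numUniversal k)))
    (SimpleGraph.turanGraph (n - numUniversal k) (r - 1))

/-- `H` is a `G_{n,k,r}`: for odd `k` it is `K_f ∨ T_{n-f,r-1}`, and for even `k` it is
`K_f ∨ T_{n-f,r-1}` with one additional edge, placed on any two distinct non-adjacent vertices. -/
def IsGraphG (n k r : ℕ) (H : SimpleGraph (Fin (numUniversal k) ⊕ Fin (n - numUniversal k))) :
    Prop :=
  (Odd k ∧ H = joinTuran n k r) ∨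
    (Even k ∧ ∃ a b, a ≠ b ∧ ¬ (joinTuran n k r).Adj a b ∧
      H = joinTuran n k r ⊔ SimpleGraph.edge a b)

/-- The graph `G` is isomorphic to a `G_{n,k,r}`. -/
def IsoToGraphG {V : Type*} (n k r : ℕ) (G : SimpleGraph V) : Prop :=
  ∃ H, IsGraphG n k r H ∧ Nonempty (G ≃g H)

/-- The number of edges `g_{n,k,r}` of a `G_{n,k,r}`: that of `K_f ∨ T_{n-f,r-1}`, plus one if
`k` is even. -/
noncomputable def edgeCountG (n k r : ℕ) : ℕ :=
  (joinTuran n k r).edgeSet.ncard + if Even k then 1 else 0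

/-- All graphs `G_{n,k,r}` have `edgeCountG n k r` edges, so that this number is well defined. -/
theorem IsGraphG.ncard_edgeSet {n k r : ℕ}
    {H : SimpleGraph (Fin (numUniversal k) ⊕ Fin (n - numUniversal k))}
    (h : IsGraphG n k r H) : H.edgeSet.ncard = edgeCountG n k r := by
  rcases h with ⟨hk, rfl⟩ | ⟨hk, a, b, hab, hn, rfl⟩
  · simp [edgeCountG, Nat.not_even_iff_odd.2 hk]
  · rw [edgeCountG, if_pos hk, SimpleGraph.edgeSet_sup, SimpleGraph.edgeSet_edge_of_ne hab,
      Set.union_singleton, Set.ncard_insert_of_notMem]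
    simpa using hn

-- Put `q = r - 1`, so that the cliques have `q + 1` vertices, and `f = ⌊(k - 1) / 2⌋`. Assume at
-- first that every vertex has at most `m = ⌈n / q⌉` non-neighbours (`NearTuran`). Call a vertex
-- large if it has at most `m - E` non-neighbours, with a margin `E` of order `k * q`. Any `q`
-- vertices, one of them large, have many common neighbours, so every edge at a large vertex extends
-- to a `(q + 1)`-clique avoiding a prescribed small set (`NearTuran.exists_extend`). Hence large
-- vertices behave like universal ones: a chain of them yields two consecutive cliques for each, and
-- `f + 1` of them would give a clique-path with `2 * f + 2 ≥ k` cliques.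
--
-- Conversely, many edges force `f` large vertices. For `q ≥ 3` a small set `U` meets all `(q +
-- 1)`-cliques, since many disjoint cliques could be threaded into a long clique-path
-- (`NearTuran.exists_hitting`). For `q = 2` this threading breaks down. There, every triangle has a
-- thick edge, one whose ends have about `n / 6` common neighbours, and a small `U` meets all pairs
-- of thick edges with a common end, so that outside `U` the thick edges form a matching. Comparing
-- Turán's bound outside `U` with the assumed number of edges (`NearTuran.card_mul_add_sum_le`)
-- gives a set `W` of exactly `f` large vertices, each with at most `n / 6` non-neighbours.
--
-- A clique disjoint from `W`, or two cliques sharing one vertex and disjoint from `W`, can be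
-- attached to the chain through `W`, giving `2 * f + 1` or `2 * f + 2` cliques. So for odd `k` the
-- graph `G - W` is `K_{q+1}`-free and Turán's theorem applies. For even `k` it has no two cliques
-- with exactly one common vertex. If it has more edges than the Turán graph, a colouring from the
-- Andrásfai–Erdős–Sós theorem then has a single monochromatic edge, and removing it leaves a
-- `K_{q+1}`-free graph (`NearTuran.exists_deleteEdges_cliqueFree`).
--
-- The degree assumption is removed by deleting vertices of low degree: each deletion raises the
-- surplus of `|E(G)|` over the extremal number by at least one. On `N = 9 * k ^ 4 * r ^ 5` vertices
-- the surplus cannot exceed `N.choose 2`, which is too little for the given `n`.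
--
-- The extremal graphs are `P_{k,r}`-free because each of the `f` universal vertices lies in at most
-- two cliques of the path. One clique (`k` odd) or two cliques (`k` even) would have to lie in the
-- Turán part, where the only available cliques of size `r` contain both ends of the added edge, and
-- two cliques of the path share at most one vertex.

universe u

section
open Finset
open scoped Classical

namespace SimpleGraph

/-! ### Clique-paths built clique by clique -/

section

variable {V W : Type*} {G : SimpleGraph V} {q l k m : ℕ} {A K Z Q : Finset V} {p v w x y : V}

/-- The vertices that are not adjacent to `v`, among them `v` itself. -/
noncomputable def nonNbr [Fintype V] (G : SimpleGraph V) (v : V) : Finset V := {x | ¬ G.Adj v x}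

@[simp] theorem mem_nonNbr [Fintype V] : x ∈ G.nonNbr v ↔ ¬ G.Adj v x := by simp [nonNbr]

/-- `G` contains a clique-path that consists of `l` cliques of size `q + 1`, has the vertex set `A`
and ends in `p`. -/
def HasCliquePath (G : SimpleGraph V) (q : ℕ) : ℕ → Finset V → V → Prop
  | 0, A, p => A = {p}
  | l + 1, A, p => ∃ A' p' Q, HasCliquePath G q l A' p' ∧ Disjoint A' Q ∧ #Q = q ∧ p ∈ Q ∧
      G.IsClique (insert p' Q : Finset V) ∧ A = A' ∪ Q

theorem hasCliquePath_zero : G.HasCliquePath q 0 {p} p := rfl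

theorem HasCliquePath.mem (h : G.HasCliquePath q l A p) : p ∈ A := by
  cases l with
  | zero => rw [HasCliquePath] at h; simp [h]
  | succ l => obtain ⟨A', p', Q, -, -, -, hp, -, rfl⟩ := h; simp [hp]

theorem HasCliquePath.card (h : G.HasCliquePath q l A p) : #A = l * q + 1 := by
  induction l generalizing A p with
  | zero => rw [HasCliquePath] at h; simp [h]
  | succ l ih =>
    obtain ⟨A', p', Q, h', hd, hQ, hp, -, rfl⟩ := h
    rw [card_union_of_disjoint hd, ih h', hQ]; ring

theorem HasCliquePath.step (h : G.HasCliquePath q l A p) (hd : Disjoint A Q) (hQ : #Q = q)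
    (hx : x ∈ Q) (hc : G.IsClique (insert p Q : Finset V)) : G.HasCliquePath q (l + 1) (A ∪ Q) x :=
  ⟨A, p, Q, h, hd, hQ, hx, hc, rfl⟩

theorem HasCliquePath.exists_of_le (h : G.HasCliquePath q l A p) (hk : k ≤ l) :
    ∃ A p, G.HasCliquePath q k A p := by
  induction l generalizing A p with
  | zero => obtain rfl : k = 0 := by lia
            exact ⟨A, p, h⟩
  | succ l ih =>
    rcases hk.eq_or_lt with rfl | hk
    · exact ⟨A, p, h⟩
    · obtain ⟨A', p', Q, h', -⟩ := h
      exact ih h' (by lia)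

theorem HasCliquePath.map {H : SimpleGraph W} (f : G →g H) (hf : Function.Injective f)
    (h : G.HasCliquePath q l A p) : H.HasCliquePath q l (A.image f) (f p) := by
  induction l generalizing A p with
  | zero => rw [HasCliquePath] at h; subst h; simp [HasCliquePath]
  | succ l ih =>
    obtain ⟨A', p', Q, h', hd, hQ, hp, hc, rfl⟩ := h
    refine ⟨A'.image f, f p', Q.image f, ih h', (disjoint_image hf).2 hd,
      by rw [card_image_of_injective _ hf, hQ], mem_image_of_mem _ hp, ?_, image_union _ _⟩
    rw [← image_insert, coe_image]
    rintro _ ⟨a, ha, rfl⟩ _ ⟨b, hb, rfl⟩ hab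
    exact f.map_adj (hc ha hb fun h => hab (h ▸ rfl))

/-- Explicit coordinates for the inductive description: `P` lists the path vertices and `c i` the
other vertices of the `i`-th clique. Indexing by `ℕ` keeps the induction free of casts; values
beyond `l` are junk. -/
theorem HasCliquePath.exists_fun (h : G.HasCliquePath q l A p) :
    ∃ (P : ℕ → V) (c : ℕ → Fin (q - 1) → V), P l = p ∧ (∀ i ≤ l, P i ∈ A) ∧
      (∀ i < l, ∀ j, c i j ∈ A) ∧ (∀ i ≤ l, ∀ i' ≤ l, P i = P i' → i = i') ∧
      (∀ i < l, ∀ i' < l, ∀ j j', c i j = c i' j' → i = i' ∧ j = j') ∧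
      (∀ i ≤ l, ∀ i' < l, ∀ j, P i ≠ c i' j) ∧ (∀ i < l, G.Adj (P i) (P (i + 1))) ∧
      (∀ i < l, ∀ j, G.Adj (P i) (c i j)) ∧ (∀ i < l, ∀ j, G.Adj (P (i + 1)) (c i j)) ∧
      (∀ i < l, ∀ j j', j ≠ j' → G.Adj (c i j) (c i j')) := by
  induction l generalizing A p with
  | zero =>
    rw [HasCliquePath] at h; subst h
    exact ⟨fun _ => p, fun _ _ => p, by simp⟩
  | succ l ih =>
    obtain ⟨A', p', Q, h', hd, hQ, hp, hc, rfl⟩ := h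
    obtain ⟨P, c, h1, h2, h3, h4, h5, h6, h7, h8, h9, h10⟩ := ih h'
    have hcard : #(Q.erase p) = q - 1 := by rw [card_erase_of_mem hp, hQ]
    let e : Fin (q - 1) ≃ Q.erase p := (finCongr hcard.symm).trans (Q.erase p).equivFin.symm
    have he : ∀ j, (e j : V) ∈ Q ∧ (e j : V) ≠ p := fun j => by
      have := (e j).2; rw [mem_erase] at this; exact ⟨this.2, this.1⟩
    have hne : ∀ a ∈ A', ∀ b ∈ Q, a ≠ b := fun a ha b hb hab =>
      Finset.disjoint_left.1 hd ha (hab ▸ hb)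
    have hei : ∀ j j', (e j : V) = e j' → j = j' := fun j j' hj => e.injective (Subtype.ext hj)
    have hp'Q : ∀ b ∈ Q, G.Adj p' b := fun b hb =>
      hc (by simp) (by simp [hb]) (hne _ h'.mem _ hb)
    have hQQ : ∀ a ∈ Q, ∀ b ∈ Q, a ≠ b → G.Adj a b := fun a ha b hb hab =>
      hc (by simp [ha]) (by simp [hb]) hab
    refine ⟨fun i => if i = l + 1 then p else P i, fun i => if i = l then fun j => e j else c i,
      by simp, ?_, ?_, ?_, ?_, ?_, ?_, ?_, ?_, ?_⟩
    · intro i hi; dsimp only; split_ifs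
      · simp [hp]
      · simp [h2 i (by lia)]
    · intro i hi j; dsimp only; split_ifs
      · simp [(he j).1]
      · simp [h3 i (by lia)]
    · intro i hi i' hi'; dsimp only; split_ifs with a b b
      · lia
      · intro h; exact absurd h.symm (hne _ (h2 i' (by lia)) _ hp)
      · intro h; exact absurd h (hne _ (h2 i (by lia)) _ hp)
      · exact h4 i (by lia) i' (by lia)
    · intro i hi i' hi' j j'; dsimp only; split_ifs with a b b
      · intro h; exact ⟨by lia, hei _ _ h⟩
      · intro h; exact absurd h.symm (hne _ (h3 i' (by lia) j') _ (he j).1)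
      · intro h; exact absurd h (hne _ (h3 i (by lia) j) _ (he j').1)
      · exact h5 i (by lia) i' (by lia) j j'
    · intro i hi i' hi' j; dsimp only; split_ifs with a b b
      · exact (he j).2.symm
      · exact (hne _ (h3 i' (by lia) j) _ hp).symm
      · exact hne _ (h2 i (by lia)) _ (he j).1
      · exact h6 i (by lia) i' (by lia) j
    · intro i hi; dsimp only; split_ifs with a b b
      · lia
      · lia
      · obtain rfl : i = l := by lia
        rw [h1]; exact hp'Q _ hp
      · exact h7 i (by lia)
    · intro i hi j; dsimp only; split_ifs with a b b
      · lia
      · lia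
      · subst b; rw [h1]; exact hp'Q _ (he j).1
      · exact h8 i (by lia) j
    · intro i hi j; dsimp only; split_ifs with a b b
      · exact hQQ _ hp _ (he j).1 (he j).2.symm
      · lia
      · lia
      · exact h9 i (by lia) j
    · intro i hi j j' hj; dsimp only; split_ifs with a
      · exact hQQ _ (he j).1 _ (he j').1 fun h => hj (hei _ _ h)
      · exact h10 i (by lia) j j' hj

theorem HasCliquePath.not_free (h : G.HasCliquePath q k A p) :
    ¬ (cliquePath k (q + 1)).Free G := by
  rw [SimpleGraph.not_free]
  obtain ⟨P, c, -, -, -, h4, h5, h6, h7, h8, h9, h10⟩ := h.exists_fun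
  refine ⟨⟨⟨Sum.elim (fun i => P i) (fun d => c d.1 d.2), ?_⟩, ?_⟩⟩
  · rintro (i | d) (j | e) hadj
    · simp only [cliquePath, pathGraph_adj] at hadj
      simp only [Sum.elim_inl]
      rcases hadj with h | h
      · rw [← h]; exact h7 i (by lia)
      · rw [← h]; exact (h7 j (by lia)).symm
    · simp only [cliquePath] at hadj
      rcases hadj with rfl | rfl
      · exact h8 _ e.1.2 _
      · exact h9 _ e.1.2 _
    · simp only [cliquePath] at hadj
      rcases hadj with rfl | rfl
      · exact (h8 _ d.1.2 _).symm
      · exact (h9 _ d.1.2 _).symm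
    · simp only [cliquePath] at hadj
      obtain ⟨d1, d2⟩ := d; obtain ⟨e1, e2⟩ := e
      obtain ⟨rfl, hne⟩ := hadj
      exact h10 _ d1.2 _ _ hne
  · rintro (i | d) (j | e) hij
    · exact congrArg Sum.inl (Fin.ext (h4 i (by lia) j (by lia) hij))
    · exact absurd hij (h6 i (by lia) e.1 e.1.2 e.2)
    · exact absurd hij.symm (h6 j (by lia) d.1 d.1.2 d.2)
    · obtain ⟨a, b⟩ := h5 d.1 d.1.2 e.1 e.1.2 d.2 e.2 hij
      exact congrArg Sum.inr (Prod.ext (Fin.ext a) b)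

end

/-! ### Growing clique-paths greedily through vertices of large degree -/

section

variable {V : Type*} [Fintype V] {G : SimpleGraph V} {q l k m E : ℕ} {A K Z Q T T₁ T₂ : Finset V}
  {p v w x y y₁ y₂ : V}

/-- Every vertex has at most `m` non-neighbours (including itself), where `m = ⌈n / q⌉` is the
largest part size of a Turán graph with `q` parts. -/
structure NearTuran (G : SimpleGraph V) (q m : ℕ) : Prop where
  two_le : 2 ≤ q
  card_nonNbr_le : ∀ v, #(G.nonNbr v) ≤ m
  card_le : Fintype.card V ≤ q * m
  mul_le : q * m + 1 ≤ Fintype.card V + q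

theorem NearTuran.two_mul_le (h : G.NearTuran q m) : 2 * m ≤ Fintype.card V + 1 := by
  have h1 := h.mul_le
  have h2 := h.two_le
  obtain ⟨d, rfl⟩ := Nat.exists_eq_add_of_le h2
  rcases Nat.eq_zero_or_pos m with rfl | hm
  · lia
  · nlinarith [Nat.mul_le_mul_left d hm]

theorem exists_forall_adj_of_sum_lt (h : ∑ v ∈ K, #(G.nonNbr v) + #Z < Fintype.card V) :
    ∃ x ∉ Z, ∀ v ∈ K, G.Adj v x := by
  have h1 : #(K.biUnion G.nonNbr ∪ Z) < #(univ : Finset V) :=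
    ((card_union_le _ _).trans (Nat.add_le_add_right card_biUnion_le _)).trans_lt h
  obtain ⟨x, -, hx⟩ := exists_mem_notMem_of_card_lt_card h1
  simp only [mem_union, mem_biUnion, not_or, not_exists, not_and, mem_nonNbr, not_not] at hx
  exact ⟨x, hx.2, hx.1⟩

/-- Greedy choice: at most `q` vertices are present before each addition, `w` among them, so they
exclude at most `q * m - E ≤ n + q - 1 - E` vertices. The margin `E` pays for `Z` and for the
rounding term `q`. -/
theorem NearTuran.exists_extend (h : G.NearTuran q m) (hw : #(G.nonNbr w) + E ≤ m)
    (hadj : G.Adj w y) (hZ : #Z + q ≤ E) :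
    ∃ Q : Finset V, #Q + 1 = q ∧ Disjoint Q Z ∧ w ∉ Q ∧ y ∉ Q ∧
      G.IsClique (insert w (insert y Q) : Finset V) := by
  have hq := h.two_le
  suffices ∀ j, j + 1 ≤ q → ∃ Q : Finset V, #Q = j ∧ Disjoint Q Z ∧ w ∉ Q ∧ y ∉ Q ∧
      G.IsClique (insert w (insert y Q) : Finset V) by
    obtain ⟨Q, h1, h2⟩ := this (q - 1) (by lia)
    exact ⟨Q, by lia, h2⟩
  intro j hj
  induction j with
  | zero =>
    refine ⟨∅, by simp, by simp, by simp, by simp, ?_⟩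
    simp [hadj]
  | succ j ih =>
    obtain ⟨Q, h1, h2, h3, h4, h5⟩ := ih (by lia)
    have hsum : ∑ v ∈ insert w (insert y Q), #(G.nonNbr v) + #Z < Fintype.card V := by
      rw [sum_insert (by simp [h3, hadj.ne])]
      have h6 : ∑ v ∈ insert y Q, #(G.nonNbr v) ≤ (j + 1) * m := by
        refine (sum_le_card_nsmul _ _ m fun v _ => h.card_nonNbr_le v).trans ?_
        rw [card_insert_of_notMem h4, h1]; simp
      have h7 : (j + 2) * m ≤ q * m := Nat.mul_le_mul_right _ (by lia)
      have := h.mul_le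
      nlinarith
    obtain ⟨x, hxZ, hx⟩ := exists_forall_adj_of_sum_lt hsum
    have hx' : ∀ v ∈ insert w (insert y Q), v ≠ x := fun v hv => (hx v hv).ne
    refine ⟨insert x Q, ?_, ?_, ?_, ?_, ?_⟩
    · rw [card_insert_of_notMem fun hxQ => hx' x (by simp [hxQ]) rfl, h1]
    · rw [disjoint_insert_left]; exact ⟨hxZ, h2⟩
    · rw [mem_insert, not_or]; exact ⟨hx' w (by simp), h3⟩
    · rw [mem_insert, not_or]; exact ⟨hx' y (by simp), h4⟩
    · have : insert w (insert y (insert x Q)) = insert x (insert w (insert y Q)) := by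
        ext z; simp only [mem_insert]; tauto
      rw [this, coe_insert, isClique_insert]
      exact ⟨h5, fun b hb _ => (hx b hb).symm⟩

/-- It suffices that one end of the edge `p x` is large. Besides `x`, the new vertices avoid `Z`,
which serves to reserve vertices for later use. -/
theorem NearTuran.step (h : G.NearTuran q m) (hA : G.HasCliquePath q l A p) (hadj : G.Adj p x)
    (hxA : x ∉ A) (hr : #(G.nonNbr p) + E ≤ m ∨ #(G.nonNbr x) + E ≤ m) (hZ : #A + #Z + q ≤ E) :
    ∃ A', G.HasCliquePath q (l + 1) A' x ∧ ∀ z ∈ A', z ∈ A ∨ z = x ∨ z ∉ Z := by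
  obtain ⟨Q, h1, h2, h3, h4, h5⟩ : ∃ Q : Finset V, #Q + 1 = q ∧ Disjoint Q (A ∪ Z) ∧ p ∉ Q ∧
      x ∉ Q ∧ G.IsClique (insert p (insert x Q) : Finset V) := by
    have hZ' : #(A ∪ Z) + q ≤ E := (Nat.add_le_add_right (card_union_le _ _) _).trans hZ
    rcases hr with hr | hr
    · exact h.exists_extend hr hadj hZ'
    · obtain ⟨Q, h1, h2, h3, h4, h5⟩ := h.exists_extend hr hadj.symm hZ'
      exact ⟨Q, h1, h2, h4, h3, by rwa [insert_comm]⟩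
  rw [disjoint_union_right] at h2
  refine ⟨A ∪ insert x Q, hA.step ?_ ?_ (mem_insert_self _ _) h5, ?_⟩
  · rw [disjoint_insert_right]; exact ⟨hxA, h2.1.symm⟩
  · rw [card_insert_of_notMem h4, h1]
  · intro z hz
    rw [mem_union, mem_insert] at hz
    rcases hz with hz | hz | hz
    · exact Or.inl hz
    · exact Or.inr (Or.inl hz)
    · exact Or.inr (Or.inr (Finset.disjoint_left.1 h2.2 hz))

/-- Consecutive large vertices `w`, `v` have a common neighbour `y` outside the used and reserved
vertices, because `2 * m ≤ n + 1`; the edges `w y` and `y v` extend to one clique each. The set `Z`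
contains `L`, so no later vertex of the list is consumed early. -/
theorem NearTuran.chain (h : G.NearTuran q m) (L : List V) :
    ∀ {l A w}, G.HasCliquePath q l A w → #(G.nonNbr w) + E ≤ m →
      (∀ v ∈ L, #(G.nonNbr v) + E ≤ m) → L.Nodup → (∀ v ∈ L, v ∉ A ∧ v ∈ Z) →
      #A + #Z + 2 * L.length * q + q ≤ E →
      ∃ A', G.HasCliquePath q (l + 2 * L.length) A' ((w :: L).getLast (by simp)) ∧
        ∀ z ∈ A', z ∈ A ∨ z ∈ L ∨ z ∉ Z := by
  induction L with
  | nil => intro l A w hA _ _ _ _ _; exact ⟨A, by simpa using hA, fun z hz => Or.inl hz⟩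
  | cons v L ih =>
    intro l A w hA hw hL hnd hLA hE
    have hvr := hL v (by simp)
    obtain ⟨hvL, hnd⟩ := List.nodup_cons.1 hnd
    have hvA := hLA v (by simp)
    have hwv : w ≠ v := fun h => hvA.1 (h ▸ hA.mem)
    rw [List.length_cons] at hE
    have h2m := h.two_mul_le
    have hsum : ∑ u ∈ {w, v}, #(G.nonNbr u) + #(A ∪ Z) < Fintype.card V := by
      rw [sum_pair hwv]
      have := card_union_le A Z
      have : 0 < q := by have := h.two_le; lia
      nlinarith
    obtain ⟨y, hyZ, hy⟩ := exists_forall_adj_of_sum_lt hsum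
    rw [mem_union, not_or] at hyZ
    obtain ⟨A₁, hA₁, hz₁⟩ := h.step (Z := Z) hA (hy w (by simp)) hyZ.1 (Or.inl hw) (by lia)
    have hvA₁ : v ∉ A₁ := fun hv => by
      rcases hz₁ v hv with h | h | h
      · exact hvA.1 h
      · exact hyZ.2 (h ▸ hvA.2)
      · exact h hvA.2
    have hc₁ := hA₁.card
    have hc := hA.card
    obtain ⟨A₂, hA₂, hz₂⟩ := h.step (Z := Z) hA₁ (hy v (by simp)).symm hvA₁ (Or.inr hvr)
      (by rw [hc₁]; rw [hc] at hE; nlinarith)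
    have hc₂ := hA₂.card
    have key : ∀ z ∈ A₂, z ∈ A ∨ z = v ∨ z ∉ Z := by
      intro z hz
      rcases hz₂ z hz with h | h | h
      · rcases hz₁ z h with h | h | h
        · exact Or.inl h
        · exact Or.inr (Or.inr (h ▸ hyZ.2))
        · exact Or.inr (Or.inr h)
      · exact Or.inr (Or.inl h)
      · exact Or.inr (Or.inr h)
    obtain ⟨A', hA', hz'⟩ := ih hA₂ hvr (fun u hu => hL u (by simp [hu])) hnd
      (fun u hu => ⟨fun huA => by
        have huZ := hLA u (by simp [hu])
        rcases key u huA with h | h | h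
        · exact huZ.1 h
        · exact hvL (h ▸ hu)
        · exact h huZ.2, (hLA u (by simp [hu])).2⟩)
      (by rw [hc₂]; rw [hc] at hE; nlinarith)
    refine ⟨A', ?_, ?_⟩
    · rw [List.getLast_cons (List.cons_ne_nil _ _)]
      convert hA' using 1
      rw [List.length_cons]; ring
    · intro z hz
      rcases hz' z hz with h | h | h
      · rcases key z h with h | h | h
        · exact Or.inl h
        · exact Or.inr (Or.inl (by simp [h]))
        · exact Or.inr (Or.inr h)
      · exact Or.inr (Or.inl (by simp [h]))
      · exact Or.inr (Or.inr h)


theorem IsClique.hasCliquePath_one {V : Type*} {G : SimpleGraph V} {T : Finset V} {y : V}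
    (hT : G.IsClique (T : Set V)) (hc : #T = q + 1) (hy : y ∈ T)
    (hq : 1 ≤ q) : G.HasCliquePath q 1 T y := by
  obtain ⟨p, hp, hpy⟩ := exists_mem_ne (by lia : 1 < #T) y
  have := (hasCliquePath_zero (G := G) (q := q) (p := p)).step (Q := T.erase p) (by simp)
    (by rw [card_erase_of_mem hp, hc]; rfl) (mem_erase.2 ⟨hpy.symm, hy⟩)
    (by rwa [insert_erase hp])
  rwa [singleton_union, insert_erase hp] at this

/-- Two disjoint cliques can be connected through any nonempty list of vertices of large degree. -/
theorem NearTuran.bridge (h : G.NearTuran q m) {L : List V}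
    (hL : ∀ v ∈ w :: L, #(G.nonNbr v) + E ≤ m) (hnd : (w :: L).Nodup)
    (hE : (2 * L.length + 6) * (q + 1) ≤ E)
    (hT₁ : G.IsClique (T₁ : Set V)) (hc₁ : #T₁ = q + 1) (hT₂ : G.IsClique (T₂ : Set V))
    (hc₂ : #T₂ = q + 1) (hT : Disjoint T₁ T₂) (hLT : ∀ v ∈ w :: L, v ∉ T₁ ∧ v ∉ T₂)
    (hy₁ : y₁ ∈ T₁) (hy₂ : y₂ ∈ T₂) (ha₁ : G.Adj y₁ w)
    (ha₂ : G.Adj y₂ ((w :: L).getLast (by simp))) :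
    ∃ A p, G.HasCliquePath q (2 * L.length + 4) A p := by
  have hq := h.two_le
  have hZ : #(T₂ ∪ (w :: L).toFinset) ≤ q + 1 + (L.length + 1) := by
    refine (card_union_le _ _).trans ?_
    rw [hc₂]
    exact Nat.add_le_add_left (List.toFinset_card_le _) _
  have h1 := hT₁.hasCliquePath_one hc₁ hy₁ (by lia)
  obtain ⟨A₂, h2, hz₂⟩ := h.step (Z := T₂ ∪ (w :: L).toFinset) (E := E) h1 ha₁ (hLT w (by simp)).1
    (Or.inr (hL w (by simp))) (by rw [hc₁]; nlinarith)
  have hL2 : ∀ v ∈ L, v ∉ A₂ ∧ v ∈ T₂ ∪ (w :: L).toFinset := by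
    intro v hv
    have hvZ : v ∈ T₂ ∪ (w :: L).toFinset := by simp [hv]
    refine ⟨fun hvA => ?_, hvZ⟩
    rcases hz₂ v hvA with h | h | h
    · exact (hLT v (by simp [hv])).1 h
    · exact (List.nodup_cons.1 hnd).1 (h ▸ hv)
    · exact h hvZ
  obtain ⟨A₃, h3, hz₃⟩ := h.chain (Z := T₂ ∪ (w :: L).toFinset) (E := E) L h2 (hL w (by simp))
    (fun v hv => hL v (by simp [hv])) (List.nodup_cons.1 hnd).2 hL2
    (by rw [h2.card]; nlinarith)
  have hT₃ : ∀ z ∈ A₃, z ∉ T₂ := by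
    intro z hz hzT
    have hzZ : z ∈ T₂ ∪ (w :: L).toFinset := by simp [hzT]
    rcases hz₃ z hz with h | h | h
    · rcases hz₂ z h with h | h | h
      · exact Finset.disjoint_left.1 hT h hzT
      · exact (hLT w (by simp)).2 (h ▸ hzT)
      · exact h hzZ
    · exact (hLT z (by simp [h])).2 hzT
    · exact h hzZ
  obtain ⟨A₄, h4, hz₄⟩ := h.step (Z := T₂) (E := E) h3 ha₂.symm (fun h => hT₃ _ h hy₂)
    (Or.inl (hL _ (List.getLast_mem _))) (by rw [h3.card, hc₂]; nlinarith)
  obtain ⟨x, hx, hxy⟩ := exists_mem_ne (by lia : 1 < #T₂) y₂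
  have h5 := h4.step (Q := T₂.erase y₂) (x := x) ?_ ?_ ?_ ?_
  · exact ⟨_, x, by convert h5 using 1; lia⟩
  · rw [Finset.disjoint_left]
    intro z hz hzT
    rw [mem_erase] at hzT
    rcases hz₄ z hz with h | h | h
    · exact hT₃ _ h hzT.2
    · exact hzT.1 h
    · exact h hzT.2
  · rw [card_erase_of_mem hy₂, hc₂]; rfl
  · exact mem_erase.2 ⟨hxy, hx⟩
  · rwa [insert_erase hy₂]

/-- Vertices of large degree can be chained into a clique-path with two cliques for each. -/
theorem NearTuran.hasCliquePath_of_list (h : G.NearTuran q m) {L : List V}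
    (hL : ∀ v ∈ w :: L, #(G.nonNbr v) + E ≤ m) (hnd : (w :: L).Nodup)
    (hE : (2 * L.length + 6) * (q + 1) ≤ E) :
    ∃ A p, G.HasCliquePath q (2 * L.length + 2) A p := by
  have hq := h.two_le
  have h2m := h.two_mul_le
  have hZ : #(w :: L).toFinset ≤ L.length + 1 := List.toFinset_card_le _
  have hw := hL w (by simp)
  obtain ⟨y, hyZ, hy⟩ := exists_forall_adj_of_sum_lt (G := G) (K := {w})
    (Z := (w :: L).toFinset) (by rw [sum_singleton]; nlinarith)
  have hyw := (hy w (by simp)).symm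
  obtain ⟨A₁, h1, hz₁⟩ := h.step (Z := (w :: L).toFinset) (E := E)
    (hasCliquePath_zero (q := q) (p := y)) hyw (by simpa using hyw.ne')
    (Or.inr hw) (by rw [card_singleton]; nlinarith)
  have hL2 : ∀ v ∈ L, v ∉ A₁ ∧ v ∈ (w :: L).toFinset := by
    intro v hv
    have hvZ : v ∈ (w :: L).toFinset := by simp [hv]
    refine ⟨fun hvA => ?_, hvZ⟩
    rcases hz₁ v hvA with h | h | h
    · exact hyZ (by rw [mem_singleton] at h; exact h ▸ hvZ)
    · exact (List.nodup_cons.1 hnd).1 (h ▸ hv)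
    · exact h hvZ
  obtain ⟨A₃, h3, -⟩ := h.chain (Z := (w :: L).toFinset) (E := E) L h1 hw
    (fun v hv => hL v (by simp [hv])) (List.nodup_cons.1 hnd).2 hL2
    (by rw [h1.card]; nlinarith)
  set u := (w :: L).getLast (by simp) with hu
  have hur := hL u (List.getLast_mem _)
  obtain ⟨y', hyA, hy'⟩ := exists_forall_adj_of_sum_lt (G := G) (K := {u}) (Z := A₃)
    (by rw [sum_singleton, h3.card]; nlinarith)
  obtain ⟨A₄, h4, -⟩ := h.step (Z := ∅) (E := E) h3 (hy' u (by simp)) hyA (Or.inl hur)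
    (by rw [h3.card, card_empty]; nlinarith)
  exact ⟨A₄, y', by convert h4 using 1; lia⟩

end

/-! ### Long clique-paths from many disjoint gadgets -/

section

variable {V : Type*} {q l k m : ℕ} {p v w x y : V}

/-- Deleting a vertex of degree at most `j` lowers the degree sum by at most `2 * j`, so the average
degree stays above `2 * j` and the peeling stops at a nonempty set. -/
theorem exists_subset_forall_lt_card_adj (H : SimpleGraph V) (j : ℕ) (S : Finset V)
    (hS : 2 * j * #S < ∑ x ∈ S, #{y ∈ S | H.Adj x y}) :
    ∃ S' ⊆ S, S'.Nonempty ∧ ∀ v ∈ S', j < #{y ∈ S' | H.Adj v y} := by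
  induction hc : #S generalizing S with
  | zero =>
    rw [card_eq_zero] at hc; subst hc; simp at hS
  | succ c ih =>
    by_cases hall : ∀ v ∈ S, j < #{y ∈ S | H.Adj v y}
    · exact ⟨S, subset_rfl, card_pos.1 (by lia), hall⟩
    · push Not at hall
      obtain ⟨v, hv, hvj⟩ := hall
      have hc' : #(S.erase v) = c := by rw [card_erase_of_mem hv, hc]; rfl
      have h1 : ∑ x ∈ S, #{y ∈ S | H.Adj x y} ≤
          ∑ x ∈ S.erase v, #{y ∈ S.erase v | H.Adj x y} + 2 * #{y ∈ S | H.Adj v y} := by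
        rw [← add_sum_erase _ _ hv]
        have h2 : ∀ x ∈ S.erase v, #{y ∈ S | H.Adj x y} ≤
            #{y ∈ S.erase v | H.Adj x y} + if H.Adj v x then 1 else 0 := by
          intro x _
          split_ifs with hvx
          · rw [filter_erase, card_erase_of_mem (by simp [hv, hvx.symm])]; lia
          · rw [filter_erase, erase_eq_of_notMem (by simp [hvx, H.adj_comm])]; rfl
        have h3 := sum_le_sum h2
        rw [sum_add_distrib, ← card_filter] at h3
        have h4 : #{x ∈ S.erase v | H.Adj v x} ≤ #{y ∈ S | H.Adj v y} :=
          card_le_card (filter_subset_filter _ (erase_subset _ _))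
        lia
      obtain ⟨S', hS', h⟩ := ih (S.erase v) (by rw [hc'] at *; rw [hc] at hS; nlinarith) hc'
      exact ⟨S', hS'.trans (erase_subset _ _), h⟩

/-- Suppose that a family of disjoint sets `T i` comes with symmetric relations `R i`, such that
`R i x y` allows a clique-path ending in `x` to be continued by `c` cliques to `y`, using only
vertices of `T i`. If all `R i` are dense and the family is large, a long clique-path exists. -/
theorem exists_hasCliquePath_of_labels [Fintype V] {G : SimpleGraph V} {ι : Type*} {I : Finset ι}
    {T : ι → Finset V} {R : ι → V → V → Prop} {c j N : ℕ}
    (hT : ∀ i ∈ I, ∀ i' ∈ I, i ≠ i' → Disjoint (T i) (T i'))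
    (hsymm : ∀ i ∈ I, ∀ x y, R i x y → R i y x)
    (hne : ∀ i ∈ I, ∀ x y, R i x y → x ≠ y)
    (hR : ∀ i ∈ I, ∀ x y, R i x y → ∀ i' ∈ I, x ∉ T i')
    (hstep : ∀ i ∈ I, ∀ x y, R i x y → ∀ l A, G.HasCliquePath q l A x → Disjoint A (T i) →
      y ∉ A → ∃ A', G.HasCliquePath q (l + c) A' y ∧ A' ⊆ insert y (A ∪ T i))
    (hN : ∀ i ∈ I, N ≤ #{z : V × V | R i z.1 z.2}) (hj : 1 ≤ j)
    (hcard : (j - 1) * Fintype.card V ^ 2 + 2 * j * Fintype.card V * #I < #I * N) :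
    ∃ A p, G.HasCliquePath q (c * j) A p := by
  -- Auxiliary graph of the pairs carrying at least `j` labels. By double counting it has average
  -- degree above `2 * j`, so some part `S` has minimum degree above `j`.
  obtain ⟨H, hH⟩ : ∃ H : SimpleGraph V, ∀ x y, H.Adj x y ↔ x ≠ y ∧ j ≤ #{i ∈ I | R i x y} :=
    ⟨{ Adj := fun x y => x ≠ y ∧ j ≤ #{i ∈ I | R i x y}
       symm := ⟨fun x y h => ⟨h.1.symm, h.2.trans (card_le_card fun i hi => by
         rw [mem_filter] at hi ⊢
         exact ⟨hi.1, hsymm i hi.1 _ _ hi.2⟩)⟩⟩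
       loopless := ⟨fun x h => h.1 rfl⟩ }, fun _ _ => Iff.rfl⟩
  have hpairs : 2 * j * #(univ : Finset V) < ∑ x ∈ (univ : Finset V), #{y ∈ univ | H.Adj x y} := by
    by_contra! hle
    have h1 : #I * N ≤ ∑ i ∈ I, #{z : V × V | R i z.1 z.2} := by
      rw [← smul_eq_mul]; exact card_nsmul_le_sum _ _ _ hN
    have h2 : ∑ i ∈ I, #{z : V × V | R i z.1 z.2} = ∑ z : V × V, #{i ∈ I | R i z.1 z.2} := by
      simp only [card_filter]; exact sum_comm
    have h3 : ∀ z : V × V, #{i ∈ I | R i z.1 z.2} ≤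
        (j - 1) + #I * if H.Adj z.1 z.2 then 1 else 0 := by
      intro z
      split_ifs with hz
      · exact (card_filter_le _ _).trans (by lia)
      · by_cases h : z.1 = z.2
        · rw [filter_false_of_mem]
          · simp
          · intro i hi hr; exact hne i hi _ _ hr h
        · have : ¬ j ≤ #{i ∈ I | R i z.1 z.2} := fun h' => hz ((hH _ _).2 ⟨h, h'⟩)
          lia
    have h4 := sum_le_sum fun z (_ : z ∈ (univ : Finset (V × V))) => h3 z
    rw [sum_add_distrib, ← mul_sum, sum_const, card_univ, Fintype.card_prod,
      Fintype.sum_prod_type (fun z : V × V => if H.Adj z.1 z.2 then 1 else 0)] at h4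
    simp only [card_filter] at hle
    rw [card_univ] at hle
    have h5 := Nat.mul_le_mul_left #I hle
    rw [smul_eq_mul, ← h2] at h4
    nlinarith
  obtain ⟨S, -, ⟨s, hs⟩, hdeg⟩ := exists_subset_forall_lt_card_adj H j univ hpairs
  have hST : ∀ x ∈ S, ∀ i ∈ I, x ∉ T i := by
    intro x hx i hi
    obtain ⟨y, hy⟩ := card_pos.1 (Nat.zero_lt_of_lt (hdeg x hx))
    obtain ⟨i', hi'⟩ := card_pos.1 (hj.trans ((hH _ _).1 (mem_filter.1 hy).2).2)
    rw [mem_filter] at hi'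
    exact hR i' hi'.1 _ _ hi'.2 i hi
  -- Rainbow path in `S`: `X` collects the visited vertices and `J` the used labels. After `t < j`
  -- steps there are at most `j` visited vertices and fewer than `j` used labels, so a new neighbour
  -- and a fresh label exist.
  suffices ∀ t ≤ j, ∃ A p, ∃ X ⊆ S, ∃ J ⊆ I, G.HasCliquePath q (c * t) A p ∧ p ∈ S ∧
      A ⊆ X ∪ J.biUnion T ∧ #X ≤ t + 1 ∧ #J ≤ t by
    obtain ⟨A, p, -, -, -, -, h, -⟩ := this j le_rfl
    exact ⟨A, p, h⟩
  intro t ht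
  induction t with
  | zero => exact ⟨{s}, s, {s}, by simpa using hs, ∅, by simp, hasCliquePath_zero, hs, by simp⟩
  | succ t ih =>
    obtain ⟨A, p, X, hX, J, hJ, h, hp, hA, hcX, hcJ⟩ := ih (by lia)
    obtain ⟨y, hy, hyX⟩ := exists_mem_notMem_of_card_lt_card
      (hcX.trans_lt (lt_of_le_of_lt ht (hdeg p hp)))
    rw [mem_filter] at hy
    obtain ⟨i, hi, hiJ⟩ := exists_mem_notMem_of_card_lt_card
      (lt_of_le_of_lt hcJ (lt_of_lt_of_le (by lia) ((hH _ _).1 hy.2).2))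
    rw [mem_filter] at hi
    have hyA : y ∉ A := fun hyA => by
      rcases mem_union.1 (hA hyA) with h | h
      · exact hyX h
      · rw [mem_biUnion] at h
        obtain ⟨i', hi', h⟩ := h
        exact hST y hy.1 i' (hJ hi') h
    have hAT : Disjoint A (T i) := by
      rw [Finset.disjoint_left]
      intro z hz hzT
      rcases mem_union.1 (hA hz) with h | h
      · exact hST z (hX h) i hi.1 hzT
      · rw [mem_biUnion] at h
        obtain ⟨i', hi', h⟩ := h
        exact Finset.disjoint_left.1 (hT i' (hJ hi') i hi.1 fun h => hiJ (h ▸ hi')) h hzT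
    obtain ⟨A', hA', hsub⟩ := hstep i hi.1 _ _ hi.2 _ _ h hAT hyA
    refine ⟨A', y, insert y X, ?_, insert i J, ?_, hA', hy.1, ?_, ?_, ?_⟩
    · exact insert_subset hy.1 hX
    · exact insert_subset hi.1 hJ
    · intro z hz
      rcases mem_insert.1 (hsub hz) with h | h
      · simp [h]
      · rcases mem_union.1 h with h | h
        · rcases mem_union.1 (hA h) with h | h
          · simp [h]
          · exact mem_union_right _ (biUnion_subset_biUnion_of_subset_left _
              (subset_insert _ _) h)
        · exact mem_union_right _ (mem_biUnion.2 ⟨i, mem_insert_self _ _, h⟩)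
    · exact (card_insert_le _ _).trans (by lia)
    · exact (card_insert_le _ _).trans (by lia)

/-- Either there are `M` disjoint sets with property `P`, or few vertices meet all such sets. -/
theorem exists_disjoint_family_or_hitting (P : Finset V → Prop) (c : ℕ)
    (hP : ∀ s, P s → #s ≤ c ∧ s.Nonempty) (M : ℕ) :
    (∃ I : Finset (Finset V), #I = M ∧ (∀ s ∈ I, P s) ∧
      ∀ s ∈ I, ∀ t ∈ I, s ≠ t → Disjoint s t) ∨
    ∃ U : Finset V, #U ≤ M * c ∧ ∀ s, P s → ¬ Disjoint s U := by
  induction M with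
  | zero => exact Or.inl ⟨∅, by simp⟩
  | succ M ih =>
    rcases ih with ⟨I, hI, hIP, hd⟩ | ⟨U, hU, h⟩
    · by_cases hs : ∃ s, P s ∧ Disjoint s (I.biUnion id)
      · obtain ⟨s, hs, hsd⟩ := hs
        rw [disjoint_biUnion_right] at hsd
        replace hsd : ∀ t ∈ I, Disjoint s t := hsd
        have hsI : s ∉ I := fun h =>
          (hP s hs).2.ne_empty (disjoint_self_iff_empty s |>.1 (hsd s h))
        refine Or.inl ⟨insert s I, by rw [card_insert_of_notMem hsI, hI], ?_, ?_⟩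
        · rintro t ht
          rcases mem_insert.1 ht with rfl | ht
          · exact hs
          · exact hIP t ht
        · intro t ht u hu htu
          rcases mem_insert.1 ht with ht | ht <;> rcases mem_insert.1 hu with hu | hu
          · exact absurd (ht.trans hu.symm) htu
          · exact ht ▸ hsd u hu
          · exact hu ▸ (hsd t ht).symm
          · exact hd t ht u hu htu
      · push Not at hs
        refine Or.inr ⟨I.biUnion id, ?_, hs⟩
        refine (card_biUnion_le_card_mul _ _ c fun s hs => (hP s (hIP s hs)).1).trans ?_
        rw [hI]; exact Nat.mul_le_mul_right _ (by lia)
    · exact Or.inr ⟨U, hU.trans (Nat.mul_le_mul_right _ (by lia)), h⟩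

end

/-! ### Hitting all cliques when `q ≥ 3` -/

section

variable {V : Type*} [Fintype V] {G : SimpleGraph V} {q l k m : ℕ} {K S U : Finset V}
  {p v w x y : V}

theorem NearTuran.sum_card_not_adj_le (h : G.NearTuran q m) (S K : Finset V) :
    ∑ x ∈ S, #{u ∈ K | ¬ G.Adj u x} ≤ #K * m := by
  calc ∑ x ∈ S, #{u ∈ K | ¬ G.Adj u x} = ∑ u ∈ K, #{x ∈ S | ¬ G.Adj u x} := by
        simp only [card_filter]; exact sum_comm
    _ ≤ ∑ u ∈ K, m := sum_le_sum fun u _ =>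
        (card_le_card fun x hx => by simpa using (mem_filter.1 hx).2).trans (h.card_nonNbr_le u)
    _ = #K * m := by simp

theorem NearTuran.le_card_adj_add (h : G.NearTuran q m) (x : V) (S : Finset V) :
    #S ≤ #{y ∈ S | G.Adj x y} + m := by
  have h1 := card_filter_add_card_filter_not (s := S) (fun y => G.Adj x y)
  have h2 : #{y ∈ S | ¬ G.Adj x y} ≤ m :=
    (card_le_card fun y hy => by simpa using (mem_filter.1 hy).2).trans (h.card_nonNbr_le x)
  lia

theorem card_filter_prod (R : V → V → Prop) :
    #{z : V × V | R z.1 z.2} = ∑ x, #{y | R x y} := by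
  rw [card_filter, Fintype.sum_prod_type]
  simp only [← card_filter]

/-- Arithmetic for a fixed clique: `nᵢ` counts the vertices missing `i` of its vertices (`n₃`: at
least three) and `s` the vertices set aside. A vertex of the first kind may be paired with its
neighbours missing at most two, one of the second kind with those missing at most one. As `q ≥ 3`,
`(q + 1) * m` is about `4 * n / 3` at most. -/
theorem sq_le_of_counts {n n₀ n₁ n₂ n₃ m s q P a b : ℕ} (hq : 3 ≤ q) (hqm : q * m + 1 ≤ n + q)
    (hsum : n₁ + 2 * n₂ + 3 * n₃ ≤ (q + 1) * m) (htot : n₀ + n₁ + n₂ + n₃ + s = n)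
    (hs : 400 * s ≤ n) (hn : 8000 * (q + 1) ≤ n) (hP : n₀ * a + n₁ * b ≤ P)
    (ha : n₀ + n₁ + n₂ ≤ a + m) (hb : n₀ + n₁ ≤ b + m) : n ^ 2 ≤ 20 * P := by
  have h3 : 3 * m ≤ q * m := Nat.mul_le_mul_right _ hq
  have h4 : 24000 * m ≤ 8001 * n := by lia
  have h5 : 10000 * n₁ + 20000 * n₂ + 30000 * n₃ ≤ 13336 * n := by
    have : (q + 1) * m = q * m + m := by ring
    lia
  -- If `n₀ + n₁ ≥ n / 2`, each of these vertices has at least `n / 10` partners. Otherwise `n₀`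
  -- exceeds `0.16 n`, with at least `0.325 n` partners each.
  rcases le_or_gt n (2 * (n₀ + n₁)) with hu | hu
  · have ha' : n₀ + n₁ ≤ a + m := by lia
    have h6 : n ≤ 10 * a := by lia
    have h6' : n ≤ 10 * b := by lia
    have h7 := Nat.mul_le_mul_left n₀ h6
    have h8 := Nat.mul_le_mul_left n₁ h6'
    have h9 := Nat.mul_le_mul_right n hu
    linarith
  · have h6 : 1614 * n ≤ 10000 * n₀ := by lia
    have h7 : 3250 * n ≤ 10000 * a := by lia
    have h8 : (1614 * n) * (3250 * n) ≤ (10000 * n₀) * (10000 * a) := Nat.mul_le_mul h6 h7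
    have h9 : 0 ≤ n₁ * b := Nat.zero_le _
    have h10 : 0 ≤ n ^ 2 := Nat.zero_le _
    linarith

/-- For `q ≥ 3`, all `(q + 1)`-cliques can be hit with few vertices. -/
theorem NearTuran.exists_hitting (h : G.NearTuran q m) (hq : 3 ≤ q) (hk : 1 ≤ k)
    (hfree : ∀ A p, ¬ G.HasCliquePath q k A p) (hn₁ : 8000 * k * (q + 1) ≤ Fintype.card V)
    (hn₂ : 60 * k ^ 2 ≤ Fintype.card V) :
    ∃ U : Finset V, #U ≤ 20 * k * (q + 1) ∧
      ∀ K : Finset V, G.IsClique K ∧ #K = q + 1 → ¬ Disjoint K U := by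
  rcases exists_disjoint_family_or_hitting (fun K : Finset V => G.IsClique K ∧ #K = q + 1) (q + 1)
    (fun s hs => ⟨hs.2.le, card_pos.1 (by lia)⟩) (20 * k) with ⟨I, hI, hIK, hd⟩ | hU
  swap
  · exact hU
  exfalso
  set n := Fintype.card V with hndef
  let U := I.biUnion id
  have hUc : #U = 20 * k * (q + 1) := by
    rw [card_biUnion (t := id) hd]
    simp only [id]
    rw [ sum_congr rfl fun s hs => (hIK s hs).2, sum_const, hI, smul_eq_mul]
  let B : Finset V → V → Finset V := fun K x => {u ∈ K | ¬ G.Adj u x}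
  -- If adjacent `x` and `y` together miss at most two vertices of `K`, then `q - 1` vertices of `K`
  -- remain, which form a `(q + 1)`-clique with `x` and `y`.
  obtain ⟨R, hR⟩ : ∃ R : Finset V → V → V → Prop, ∀ K x y, R K x y ↔
      (G.Adj x y ∧ #(B K x ∪ B K y) ≤ 2 ∧ x ∉ U ∧ y ∉ U) := ⟨_, fun _ _ _ => Iff.rfl⟩
  have hcount : ∀ K ∈ I, n ^ 2 / 20 ≤ #{z : V × V | R K z.1 z.2} := by
    intro K hK
    set V' : Finset V := univ \ U with hV'
    let S : ℕ → Finset V := fun i => {x ∈ V' | #(B K x) = i}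
    let S₃ : Finset V := {x ∈ V' | 3 ≤ #(B K x)}
    have hV'c : #V' + #U = n := by
      rw [hV', card_sdiff_of_subset (subset_univ _), card_univ]
      have := card_le_univ U; lia
    have hdisj : ∀ i j, i ≠ j → Disjoint (S i) (S j) := fun i j hij => by
      rw [Finset.disjoint_left]; intro x hx hx'
      exact hij ((mem_filter.1 hx).2.symm.trans (mem_filter.1 hx').2)
    have htot : #(S 0) + #(S 1) + #(S 2) + #S₃ = #V' := by
      have e : S 0 ∪ S 1 ∪ S 2 ∪ S₃ = V' := by
        ext x
        simp only [S, S₃, mem_union, mem_filter]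
        constructor
        · tauto
        · intro hx
          have : #(B K x) = 0 ∨ #(B K x) = 1 ∨ #(B K x) = 2 ∨ 3 ≤ #(B K x) := by lia
          tauto
      rw [← e, card_union_of_disjoint, card_union_of_disjoint, card_union_of_disjoint]
      · exact hdisj _ _ (by lia)
      · exact disjoint_union_left.2 ⟨hdisj _ _ (by lia), hdisj _ _ (by lia)⟩
      · rw [Finset.disjoint_left]; intro x hx hx'
        have := (mem_filter.1 hx').2
        simp only [S, mem_union, mem_filter] at hx
        lia
    have hsum : #(S 1) + 2 * #(S 2) + 3 * #S₃ ≤ (q + 1) * m := by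
      refine le_trans ?_ ((h.sum_card_not_adj_le V' K).trans_eq (by rw [(hIK K hK).2]))
      have e : ∀ x ∈ V', (if #(B K x) = 1 then 1 else 0) + 2 * (if #(B K x) = 2 then 1 else 0) +
          3 * (if 3 ≤ #(B K x) then 1 else 0) ≤ #(B K x) := by
        intro x _; split_ifs <;> lia
      have := sum_le_sum e
      rw [sum_add_distrib, sum_add_distrib, ← mul_sum, ← mul_sum, ← card_filter, ← card_filter,
        ← card_filter] at this
      exact this
    have hsub : ∀ x y, x ∈ V' → y ∈ V' → G.Adj x y → #(B K x) + #(B K y) ≤ 2 → R K x y := by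
      intro x y hx hy hxy hb
      rw [hR]
      exact ⟨hxy, (card_union_le _ _).trans hb, (mem_sdiff.1 hx).2, (mem_sdiff.1 hy).2⟩
    have hpairs : #(S 0) * (#(S 0 ∪ S 1 ∪ S 2) - m) + #(S 1) * (#(S 0 ∪ S 1) - m) ≤
        #{z : V × V | R K z.1 z.2} := by
      rw [card_filter_prod]
      calc _ ≤ ∑ x ∈ S 0, #{y | R K x y} + ∑ x ∈ S 1, #{y | R K x y} := by
            refine add_le_add ?_ ?_
            · rw [← smul_eq_mul]
              refine card_nsmul_le_sum _ _ _ fun x hx => ?_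
              have h1 := h.le_card_adj_add x (S 0 ∪ S 1 ∪ S 2)
              refine le_trans (by lia) (card_le_card (s := {y ∈ S 0 ∪ S 1 ∪ S 2 | G.Adj x y}) ?_)
              intro y hy
              simp only [S, mem_filter, mem_union, mem_univ, true_and] at hx hy ⊢
              exact hsub x y hx.1 (by tauto) hy.2 (by lia)
            · rw [← smul_eq_mul]
              refine card_nsmul_le_sum _ _ _ fun x hx => ?_
              have h1 := h.le_card_adj_add x (S 0 ∪ S 1)
              refine le_trans (by lia) (card_le_card (s := {y ∈ S 0 ∪ S 1 | G.Adj x y}) ?_)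
              intro y hy
              simp only [S, mem_filter, mem_union, mem_univ, true_and] at hx hy ⊢
              exact hsub x y hx.1 (by tauto) hy.2 (by lia)
        _ = ∑ x ∈ S 0 ∪ S 1, #{y | R K x y} := (sum_union (hdisj _ _ (by lia))).symm
        _ ≤ _ := sum_le_sum_of_subset (subset_univ _)
    have c1 : #(S 0 ∪ S 1) = #(S 0) + #(S 1) := card_union_of_disjoint (hdisj _ _ (by lia))
    have c2 : #(S 0 ∪ S 1 ∪ S 2) = #(S 0) + #(S 1) + #(S 2) := by
      rw [card_union_of_disjoint, c1]
      exact disjoint_union_left.2 ⟨hdisj _ _ (by lia), hdisj _ _ (by lia)⟩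
    have hkq : 8000 * (q + 1) ≤ 8000 * k * (q + 1) := Nat.mul_le_mul_right _ (by lia)
    have := sq_le_of_counts (s := #U) hq h.mul_le hsum (by rw [htot, hV'c])
      (by rw [hUc]; nlinarith) (hkq.trans hn₁) hpairs (by rw [c2]; lia) (by rw [c1]; lia)
    lia
  obtain ⟨A, p, hA⟩ := exists_hasCliquePath_of_labels (G := G) (q := q) (I := I) (T := id) (R := R)
    (c := 1) (j := k) (N := n ^ 2 / 20) hd
    (fun K _ x y hxy => by
      rw [hR] at hxy ⊢
      exact ⟨hxy.1.symm, by rw [union_comm]; exact hxy.2.1, hxy.2.2.2, hxy.2.2.1⟩)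
    (fun K _ x y hxy => ((hR _ _ _).1 hxy).1.ne)
    (fun K _ x y hxy K' hK' hx => ((hR _ _ _).1 hxy).2.2.1 (mem_biUnion.2 ⟨K', hK', hx⟩))
    (fun K hK x y hxy l A hA hd hy => by
      rw [hR] at hxy
      obtain ⟨hxy, hB, hxU, hyU⟩ := hxy
      have hyK : y ∉ K := fun h => hyU (mem_biUnion.2 ⟨K, hK, h⟩)
      have hD : q - 1 ≤ #(K \ (B K x ∪ B K y)) := by
        have := le_card_sdiff (B K x ∪ B K y) K
        have := (hIK K hK).2
        lia
      obtain ⟨D, hDs, hDc⟩ := exists_subset_card_eq hD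
      have hDK : ∀ z ∈ D, z ∈ K ∧ G.Adj z x ∧ G.Adj z y := by
        intro z hz
        have := hDs hz
        simp only [B, mem_sdiff, mem_union, mem_filter, not_or, not_and, not_not] at this
        exact ⟨this.1, this.2.1 this.1, this.2.2 this.1⟩
      have hyD : y ∉ D := fun h => hyK (hDK y h).1
      refine ⟨A ∪ insert y D, hA.step ?_ ?_ (mem_insert_self _ _) ?_, ?_⟩
      · rw [disjoint_insert_right]
        exact ⟨hy, hd.mono_right fun z hz => (hDK z hz).1⟩
      · rw [card_insert_of_notMem hyD, hDc]; lia
      · rw [coe_insert, coe_insert, isClique_insert, isClique_insert]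
        refine ⟨⟨(hIK K hK).1.subset fun z hz => (hDK z hz).1, fun z hz _ => (hDK z hz).2.2.symm⟩,
          fun z hz _ => ?_⟩
        rcases hz with rfl | hz
        · exact hxy
        · exact (hDK z hz).2.1.symm
      · intro z hz
        simp only [mem_union, mem_insert, id] at hz ⊢
        rcases hz with hz | hz | hz
        · tauto
        · tauto
        · exact Or.inr (Or.inr (hDK z hz).1))
    hcount hk (by
      rw [hI]
      have h1 : n ^ 2 < 20 * (n ^ 2 / 20) + 20 := by lia
      obtain ⟨d, rfl⟩ := Nat.exists_eq_add_of_le' hk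
      simp only [Nat.add_sub_cancel]
      set N := n ^ 2 / 20
      have h2 : (d + 1) * (n ^ 2) ≤ (d + 1) * (20 * N + 19) := Nat.mul_le_mul_left _ (by lia)
      have h3 : 60 * (d + 1) ^ 2 * n ≤ n * n := Nat.mul_le_mul_right _ hn₂
      have h4 : 60 * (d + 1) ≤ n := by nlinarith
      nlinarith)
  exact hfree A p (by simpa using hA)

end

/-! ### Turán numbers and edge counts -/

section

variable {V : Type*} [Fintype V] {G : SimpleGraph V} {q l k m : ℕ} {K S U : Finset V}
  {p v w x y : V}

theorem ncard_edgeSet_eq {W : Type*} [Fintype W] (H : SimpleGraph W) [Fintype H.edgeSet] :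
    H.edgeSet.ncard = #H.edgeFinset := by
  rw [← coe_edgeFinset, Set.ncard_coe_finset]

theorem sum_card_adj_eq {V : Type*} (H : SimpleGraph V) (S : Finset V) :
    ∑ x ∈ S, #{y ∈ S | H.Adj x y} = 2 * (H.induce (S : Set V)).edgeSet.ncard := by
  rw [ncard_edgeSet_eq, ← sum_degrees_eq_twice_card_edges, ← sum_coe_sort]
  refine sum_congr rfl fun x _ => ?_
  rw [← card_neighborFinset_eq_degree, ← card_map (Function.Embedding.subtype (· ∈ (S : Set V)))]
  congr 1
  ext y
  simp only [mem_filter, mem_map, mem_neighborFinset, comap_adj, Function.Embedding.subtype_apply]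
  constructor
  · rintro ⟨h1, h2⟩; exact ⟨⟨y, h1⟩, h2, rfl⟩
  · rintro ⟨z, h1, rfl⟩; exact ⟨z.2, h1⟩

theorem sum_card_adj_univ_eq (H : SimpleGraph V) :
    ∑ x, #{y | H.Adj x y} = 2 * H.edgeSet.ncard := by
  rw [ncard_edgeSet_eq, ← sum_degrees_eq_twice_card_edges]
  refine sum_congr rfl fun x _ => ?_
  rw [← card_neighborFinset_eq_degree]
  congr 1; ext y; simp

theorem card_adj_add_card_nonNbr (G : SimpleGraph V) (x : V) :
    #{y | G.Adj x y} + #(G.nonNbr x) = Fintype.card V := by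
  rw [nonNbr, card_filter_add_card_filter_not, card_univ]

theorem two_mul_ncard_edgeSet_turanGraph {q : ℕ} (hq : 1 ≤ q) (a b : ℕ) (hb : b < q) :
    2 * (turanGraph (a * q + b) q).edgeSet.ncard = a * (a * q + 2 * b) * (q - 1) + b * (b - 1) := by
  rw [ncard_edgeSet_eq, card_edgeFinset_turanGraph]
  obtain ⟨c, rfl⟩ := Nat.exists_eq_add_of_le' hq
  have h1 : (a * (c + 1) + b) % (c + 1) = b := by
    rw [Nat.mul_comm, Nat.mul_add_mod]; exact Nat.mod_eq_of_lt hb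
  have h2 : (a * (c + 1) + b) ^ 2 - b ^ 2 = a * (c + 1) * (a * (c + 1) + 2 * b) := by
    rw [Nat.sub_eq_iff_eq_add (Nat.pow_le_pow_left (by lia) 2)]; ring
  rw [h1, h2, Nat.add_sub_cancel, mul_add, Nat.choose_two_right,
    Nat.mul_div_cancel' (Nat.even_mul_pred_self b).two_dvd]
  congr 1
  have h3 : a * (c + 1) * (a * (c + 1) + 2 * b) * c = (c + 1) * (a * (a * (c + 1) + 2 * b) * c) := by
    ring
  rw [h3, mul_comm 2 (c + 1), Nat.mul_div_mul_left _ _ (by lia)]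
  apply Nat.mul_div_cancel'
  rw [mul_add, add_mul]
  refine dvd_add ?_ ⟨a * b * c, by ring⟩
  have := (Nat.even_mul_succ_self c).two_dvd
  rw [show a * (a * (c + 1)) * c = a * a * (c * (c + 1)) by ring]
  exact Dvd.dvd.mul_left this _

theorem mul_ncard_edgeSet_turanGraph_le (hq : 1 ≤ q) (N : ℕ) :
    q * (2 * (turanGraph N q).edgeSet.ncard) ≤ (q - 1) * N ^ 2 := by
  have h := two_mul_ncard_edgeSet_turanGraph hq (N / q) (N % q) (Nat.mod_lt _ hq)
  rw [Nat.div_add_mod'] at h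
  rw [h]
  have hN : N = N / q * q + N % q := (Nat.div_add_mod' N q).symm
  have hb := Nat.mod_lt N hq
  generalize N / q = a at *
  generalize N % q = b at *
  subst hN
  obtain ⟨c, rfl⟩ := Nat.exists_eq_add_of_le' hq
  rw [Nat.add_sub_cancel]
  rcases b with _ | b
  · nlinarith
  · rw [Nat.add_sub_cancel]
    nlinarith

/-- With `b = N % q` the exact difference is `b * (q - b)`, which is at most `q ^ 2`. -/
theorem le_mul_ncard_edgeSet_turanGraph (hq : 1 ≤ q) (N : ℕ) :
    (q - 1) * N ^ 2 ≤ q * (2 * (turanGraph N q).edgeSet.ncard) + q ^ 2 := by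
  have h := two_mul_ncard_edgeSet_turanGraph hq (N / q) (N % q) (Nat.mod_lt _ hq)
  rw [Nat.div_add_mod'] at h
  rw [h]
  have hN : N = N / q * q + N % q := (Nat.div_add_mod' N q).symm
  have hb := Nat.mod_lt N hq
  generalize N / q = a at *
  generalize N % q = b at *
  subst hN
  obtain ⟨c, rfl⟩ := Nat.exists_eq_add_of_le' hq
  rw [Nat.add_sub_cancel]
  rcases b with _ | b
  · nlinarith
  · rw [Nat.add_sub_cancel]
    nlinarith

/-- A new vertex joins a smallest part, of size `N / q`, and is adjacent to everything else. -/
theorem ncard_edgeSet_turanGraph_succ (hq : 1 ≤ q) (N : ℕ) :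
    (turanGraph (N + 1) q).edgeSet.ncard + N / q = (turanGraph N q).edgeSet.ncard + N := by
  have h := two_mul_ncard_edgeSet_turanGraph hq (N / q) (N % q) (Nat.mod_lt _ hq)
  rw [Nat.div_add_mod'] at h
  have hN : N = N / q * q + N % q := (Nat.div_add_mod' N q).symm
  have hb := Nat.mod_lt N hq
  obtain ⟨c, rfl⟩ := Nat.exists_eq_add_of_le' hq
  rcases Nat.lt_or_ge (N % (c + 1) + 1) (c + 1) with hlt | hge
  · have h' := two_mul_ncard_edgeSet_turanGraph hq (N / (c + 1)) (N % (c + 1) + 1) hlt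
    rw [← add_assoc, Nat.div_add_mod'] at h'
    generalize N / (c + 1) = a at *
    generalize N % (c + 1) = b at *
    rw [Nat.add_sub_cancel] at *
    rcases b with _ | b
    · simp only [Nat.zero_add, Nat.mul_zero, Nat.zero_mul, Nat.sub_self, Nat.add_zero] at *
      nlinarith
    · rw [Nat.add_sub_cancel] at *
      nlinarith
  · have hbc : N % (c + 1) = c := by lia
    have h' := two_mul_ncard_edgeSet_turanGraph hq (N / (c + 1) + 1) 0 (by lia)
    have e : (N / (c + 1) + 1) * (c + 1) + 0 = N + 1 := by rw [hbc] at hN; lia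
    rw [e] at h'
    rw [hbc] at h hN
    generalize N / (c + 1) = a at *
    rw [Nat.add_sub_cancel] at *
    rcases c with _ | c
    · lia
    · rw [Nat.add_sub_cancel] at *
      nlinarith

theorem CliqueFree.ncard_edgeSet_le (hG : G.CliqueFree (q + 1)) (hq : 1 ≤ q) :
    G.edgeSet.ncard ≤ (turanGraph (Fintype.card V) q).edgeSet.ncard ∧
      (G.edgeSet.ncard = (turanGraph (Fintype.card V) q).edgeSet.ncard →
        Nonempty (G ≃g turanGraph (Fintype.card V) q)) := by
  obtain ⟨J, _, hJ⟩ := exists_isTuranMaximal (V := V) hq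
  obtain ⟨e⟩ := hJ.nonempty_iso_turanGraph
  have hc : (turanGraph (Fintype.card V) q).edgeSet.ncard = J.edgeSet.ncard := by
    rw [ncard_edgeSet_eq, ncard_edgeSet_eq]; exact e.card_edgeFinset_eq.symm
  have hle : G.edgeSet.ncard ≤ J.edgeSet.ncard := by
    rw [ncard_edgeSet_eq, ncard_edgeSet_eq]
    exact hJ.2 hG
  refine ⟨hc ▸ hle, fun heq => ?_⟩
  have : G.IsTuranMaximal q := by
    refine ⟨hG, fun H _ hH => ?_⟩
    have h1 := hJ.2 hH
    rw [hc, ncard_edgeSet_eq, ncard_edgeSet_eq] at heq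
    rw [heq]
    exact h1
  exact this.nonempty_iso_turanGraph

/-- Outside `U` the graph `H` is `K_{q+1}`-free and obeys Turán's bound; the edges meeting `U` and
the edges of `F` outside `U` are paid for separately. -/
theorem mul_ncard_edgeSet_le {H F : SimpleGraph V} (hq : 1 ≤ q)
    (hHF : ∀ x y, G.Adj x y → H.Adj x y ∨ F.Adj x y) (U : Finset V)
    (hU : ∀ K : Finset V, H.IsClique K ∧ #K = q + 1 → ¬ Disjoint K U) :
    q * (2 * G.edgeSet.ncard) ≤ (q - 1) * (Fintype.card V - #U) ^ 2 +
      q * (2 * ∑ w ∈ U, #{y | G.Adj w y}) + q * ∑ x ∈ Uᶜ, #{y ∈ Uᶜ | F.Adj x y} := by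
  have h1 : (Fintype.card V - #U) = #Uᶜ := (card_compl U).symm
  have h2 : q * ∑ x ∈ Uᶜ, #{y ∈ Uᶜ | H.Adj x y} ≤ (q - 1) * #Uᶜ ^ 2 := by
    rw [sum_card_adj_eq]
    have hfree : (H.induce (Uᶜ : Finset V)).CliqueFree (q + 1) := by
      intro K hK
      rw [isNClique_iff] at hK
      refine hU (K.map (Function.Embedding.subtype _)) ⟨?_, by rw [card_map, hK.2]⟩ ?_
      · intro a ha b hb hab
        rw [mem_coe, mem_map] at ha hb
        obtain ⟨a, ha, rfl⟩ := ha
        obtain ⟨b, hb, rfl⟩ := hb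
        exact hK.1 ha hb fun h => hab (h ▸ rfl)
      · rw [Finset.disjoint_left]
        intro a ha
        rw [mem_map] at ha
        obtain ⟨a, -, rfl⟩ := ha
        exact mem_compl.1 a.2
    have h3 := (hfree.ncard_edgeSet_le hq).1
    have h4 : Fintype.card ((Uᶜ : Finset V) : Set V) = #Uᶜ :=
      (Set.toFinset_card _).symm.trans (by rw [Finset.toFinset_coe])
    rw [h4] at h3
    exact (Nat.mul_le_mul_left _ (Nat.mul_le_mul_left _ h3)).trans
      (mul_ncard_edgeSet_turanGraph_le hq _)
  have h3 : ∑ x ∈ Uᶜ, #{y ∈ Uᶜ | G.Adj x y} ≤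
      ∑ x ∈ Uᶜ, #{y ∈ Uᶜ | H.Adj x y} + ∑ x ∈ Uᶜ, #{y ∈ Uᶜ | F.Adj x y} := by
    rw [← sum_add_distrib]
    refine sum_le_sum fun x _ => ?_
    rw [← card_union_add_card_inter]
    refine le_trans (card_le_card fun y hy => ?_) (Nat.le_add_right _ _)
    simp only [mem_union, mem_filter] at hy ⊢
    have := hHF x y hy.2
    tauto
  have h4 : 2 * G.edgeSet.ncard ≤ ∑ x ∈ Uᶜ, #{y ∈ Uᶜ | G.Adj x y} +
      2 * ∑ w ∈ U, #{y | G.Adj w y} := by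
    rw [← sum_card_adj_univ_eq, ← sum_add_sum_compl U]
    have h5 : ∑ x ∈ Uᶜ, #{y | G.Adj x y} =
        ∑ x ∈ Uᶜ, #{y ∈ U | G.Adj x y} + ∑ x ∈ Uᶜ, #{y ∈ Uᶜ | G.Adj x y} := by
      rw [← sum_add_distrib]
      refine sum_congr rfl fun x _ => ?_
      rw [← card_union_of_disjoint (disjoint_filter_filter disjoint_compl_right),
        ← filter_union, union_compl]
    have h6 : ∑ x ∈ Uᶜ, #{y ∈ U | G.Adj x y} ≤ ∑ w ∈ U, #{y | G.Adj w y} := by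
      calc _ = ∑ w ∈ U, #{x ∈ Uᶜ | G.Adj x w} := by simp only [card_filter]; exact sum_comm
        _ ≤ _ := sum_le_sum fun w _ => card_le_card fun x hx => by
          simpa [G.adj_comm] using (mem_filter.1 hx).2
    lia
  rw [h1]
  have h5 := Nat.mul_le_mul_left q h3
  have h6 := Nat.mul_le_mul_left q h4
  rw [mul_add] at h5 h6
  lia

end

/-! ### Many edges force vertices of large degree -/

section

variable {V : Type*} [Fintype V] {G : SimpleGraph V} {q l k m f E : ℕ} {K S U : Finset V}
  {p v w x y : V}

/-- If `G` has many edges and `U` meets all `(q + 1)`-cliques of `G` up to the edges in `F`, then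
`U` contains many vertices of large degree, and these have few non-neighbours. -/
theorem NearTuran.card_mul_add_sum_le (h : G.NearTuran q m) {H F : SimpleGraph V}
    (hHF : ∀ x y, G.Adj x y → H.Adj x y ∨ F.Adj x y) (U : Finset V)
    (hU : ∀ K : Finset V, H.IsClique K ∧ #K = q + 1 → ¬ Disjoint K U) (hf : f ≤ Fintype.card V)
    (he : f * (Fintype.card V - f) + (turanGraph (Fintype.card V - f) q).edgeSet.ncard ≤
      G.edgeSet.ncard) :
    2 * f * Fintype.card V + 2 * q * ∑ w ∈ U with #(G.nonNbr w) + E ≤ m, #(G.nonNbr w) ≤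
      2 * #{w ∈ U | #(G.nonNbr w) + E ≤ m} * Fintype.card V +
        q * (#U ^ 2 + 2 * #U * E + 2 * f ^ 2 + q + ∑ x ∈ Uᶜ, #{y ∈ Uᶜ | F.Adj x y}) := by
  have hq : 1 ≤ q := by have := h.two_le; lia
  have h1 := mul_ncard_edgeSet_le hq hHF U hU
  have h2 := le_mul_ncard_edgeSet_turanGraph hq (Fintype.card V - f)
  set n := Fintype.card V with hn
  set φ := ∑ x ∈ Uᶜ, #{y ∈ Uᶜ | F.Adj x y}
  set Y := {w ∈ U | #(G.nonNbr w) + E ≤ m} with hY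
  have hYs : #Y ≤ #U := card_filter_le _ _
  have hsn : #U ≤ n := card_le_univ U
  have h3 : q * ∑ w ∈ U, #{y | G.Adj w y} + q * ∑ w ∈ Y, #(G.nonNbr w) + (#U - #Y) * n ≤
      q * (#U * n) + q * ((#U - #Y) * E) := by
    have e1 : ∀ w ∈ Y, q * #{y | G.Adj w y} + q * #(G.nonNbr w) = q * n := fun w _ => by
      rw [← mul_add, card_adj_add_card_nonNbr]
    -- A vertex that is not large has degree below `n - m + E`, and `q * m ≥ n`: up to `E`, it falls
    -- short of a universal vertex by `n / q`.
    have e2 : ∀ w ∈ U \ Y, q * #{y | G.Adj w y} + n ≤ q * n + q * E := by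
      intro w hw
      rw [hY, mem_sdiff, mem_filter, not_and] at hw
      have a1 : m < #(G.nonNbr w) + E := not_le.1 (hw.2 hw.1)
      have a2 := card_adj_add_card_nonNbr G w
      have a3 := h.card_le
      rw [← hn] at a2 a3
      have a4 : q * (#{y | G.Adj w y} + m) ≤ q * (n + E) := Nat.mul_le_mul_left _ (by lia)
      rw [mul_add, mul_add] at a4
      lia
    have e3 := sum_le_sum e2
    have e4 := sum_congr rfl e1
    rw [sum_add_distrib, sum_const, ← mul_sum, smul_eq_mul,
      card_sdiff_of_subset (filter_subset _ _)] at e3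
    rw [sum_add_distrib, sum_const, ← mul_sum, ← mul_sum, smul_eq_mul] at e4
    rw [sum_const, smul_eq_mul, card_sdiff_of_subset (filter_subset _ _), mul_add] at e3
    rw [← sum_sdiff (filter_subset _ U : Y ⊆ U), mul_add]
    have e5 : #U = (#U - #Y) + #Y := by lia
    have e6 : q * (#U * n) = (#U - #Y) * (q * n) + #Y * (q * n) := by
      rw [← add_mul, ← e5]; ring
    have e7 : q * ((#U - #Y) * E) = (#U - #Y) * (q * E) := by ring
    lia
  generalize ∑ w ∈ U, #{y | G.Adj w y} = D at *
  generalize ∑ w ∈ Y, #(G.nonNbr w) = y at *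
  generalize (turanGraph (n - f) q).edgeSet.ncard = t at *
  generalize G.edgeSet.ncard = e at *
  generalize #Y = a at *
  generalize #U = s at *
  obtain ⟨b, rfl⟩ := Nat.exists_eq_add_of_le hYs
  obtain ⟨c, rfl⟩ := Nat.exists_eq_add_of_le' hq
  clear_value n φ
  obtain ⟨g, rfl⟩ := Nat.exists_eq_add_of_le hf
  rw [Nat.add_sub_cancel_left] at *
  rw [Nat.add_sub_cancel] at *
  have h4 := Nat.mul_le_mul_left (c + 1) (Nat.mul_le_mul_left 2 he)
  obtain ⟨d, hd⟩ := Nat.exists_eq_add_of_le hsn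
  rw [hd, Nat.add_sub_cancel_left] at h1
  zify at *
  have hd' : (d : ℤ) = f + g - (a + b) := by linarith
  rw [hd'] at h1
  have p1 : (0 : ℤ) ≤ a * E := by positivity
  have p2 : (0 : ℤ) ≤ c * (a * E) := by positivity
  have p3 : (0 : ℤ) ≤ c * f ^ 2 := by positivity
  have p4 : (0 : ℤ) ≤ (a + b) ^ 2 := by positivity
  nlinarith only [h1, h2, h3, h4, p1, p2, p3, p4]

end

/-! ### Exactly `f` vertices of large degree; thick edges -/

section

variable {V : Type*} [Fintype V] {G F : SimpleGraph V} {q l k m f E : ℕ} {K S U W : Finset V}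
  {p v w x y : V}

theorem NearTuran.card_le_of_free (h : G.NearTuran q m) (hkf : k ≤ 2 * f + 2)
    (hE : (2 * f + 6) * (q + 1) ≤ E) (hfree : ∀ A p, ¬ G.HasCliquePath q k A p)
    (hW : ∀ w ∈ W, #(G.nonNbr w) + E ≤ m) : #W ≤ f := by
  by_contra! hlt
  obtain ⟨W', hW', hc⟩ := exists_subset_card_eq (show f + 1 ≤ #W from hlt)
  obtain ⟨w, L, hL⟩ := List.exists_cons_of_ne_nil (l := W'.toList)
    (by rw [Ne, toList_eq_nil]; rintro rfl; simp at hc)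
  have hlen : L.length = f := by
    have := congrArg List.length hL
    rw [length_toList, hc, List.length_cons] at this
    lia
  obtain ⟨A, p, hA⟩ := h.hasCliquePath_of_list (w := w) (L := L) (E := E)
    (fun v hv => hW v (hW' (by rw [← mem_toList, hL]; exact hv))) (hL ▸ nodup_toList W')
    (by rw [hlen]; exact hE)
  obtain ⟨A', p', hA'⟩ := hA.exists_of_le (k := k) (by lia)
  exact hfree A' p' hA'

/-- The hitting set has size of order `k * q`, so the error `q * D` in the edge comparison is below
`2 * n`. Hence `U` contains at least `f` large vertices; there are no more by `card_le_of_free`, and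
the remaining slack bounds their non-neighbours by `D / 2`. -/
theorem NearTuran.exists_large_degree_of_three_le (h : G.NearTuran q m) (hq : 3 ≤ q) (hk : 3 ≤ k)
    (hf₁ : 2 * f + 1 ≤ k) (hf₂ : k ≤ 2 * f + 2)
    (hn : 9 * k ^ 4 * (q + 1) ^ 5 ≤ Fintype.card V)
    (hfree : ∀ A p, ¬ G.HasCliquePath q k A p)
    (he : f * (Fintype.card V - f) + (turanGraph (Fintype.card V - f) q).edgeSet.ncard ≤
      G.edgeSet.ncard) :
    ∃ W : Finset V, #W = f ∧ ∀ w ∈ W, #(G.nonNbr w) + (2 * f + 6) * (q + 1) ≤ m ∧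
      6 * #(G.nonNbr w) ≤ Fintype.card V := by
  set n := Fintype.card V with hndef
  set r := q + 1 with hr
  have b1 : 9 ≤ k ^ 2 := by nlinarith
  have b2 : 16 ≤ r ^ 2 := by nlinarith
  have b4 : 1296 * (k ^ 2 * r ^ 3) ≤ n := by
    calc 1296 * (k ^ 2 * r ^ 3) = 9 * (k ^ 2 * 9) * (r ^ 3 * 16) := by ring
      _ ≤ 9 * (k ^ 2 * k ^ 2) * (r ^ 3 * r ^ 2) := by gcongr
      _ = 9 * k ^ 4 * r ^ 5 := by ring
      _ ≤ n := hn
  have b5 : k ^ 2 * r ^ 2 * 4 ≤ k ^ 2 * r ^ 3 := by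
    calc k ^ 2 * r ^ 2 * 4 ≤ k ^ 2 * r ^ 2 * r := by gcongr; lia
      _ = _ := by ring
  have b6 : k * r * 12 ≤ k ^ 2 * r ^ 2 := by
    calc k * r * 12 ≤ k * r * (k * r) := by gcongr; nlinarith
      _ = _ := by ring
  have b7 : k ^ 2 * 16 ≤ k ^ 2 * r ^ 2 := by gcongr
  have b8 : r ≤ k * r := Nat.le_mul_of_pos_left _ (by lia)
  have hfn : f ≤ n := by nlinarith
  obtain ⟨U, hUc, hU⟩ := h.exists_hitting hq (by lia) hfree (by rw [mul_assoc]; lia) (by lia)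
  obtain ⟨F, hF⟩ : ∃ F : SimpleGraph V, ∀ x y, ¬ F.Adj x y := ⟨⊥, by simp⟩
  have h1 := h.card_mul_add_sum_le (H := G) (F := F) (E := (2 * f + 6) * r)
    (fun x y hxy => Or.inl hxy) U hU hfn he
  set W := {w ∈ U | #(G.nonNbr w) + (2 * f + 6) * r ≤ m} with hW
  have hWf : #W ≤ f := h.card_le_of_free hf₂ le_rfl hfree fun w hw => (mem_filter.1 hw).2
  have hφ : ∑ x ∈ Uᶜ, #{y ∈ Uᶜ | F.Adj x y} = 0 :=
    sum_eq_zero fun x _ => by simp [hF]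
  set φ := ∑ x ∈ Uᶜ, #{y ∈ Uᶜ | F.Adj x y}
  obtain ⟨D, hD⟩ : ∃ D, D = #U ^ 2 + 2 * #U * ((2 * f + 6) * r) + 2 * f ^ 2 + q + φ := ⟨_, rfl⟩
  rw [← hD, ← hndef] at h1
  have hE : (2 * f + 6) * r ≤ 3 * (k * r) := by
    calc (2 * f + 6) * r ≤ (3 * k) * r := Nat.mul_le_mul_right _ (by lia)
      _ = _ := by ring
  have hU' : #U ≤ 20 * (k * r) := by rw [← mul_assoc]; exact hUc
  have hD' : D ≤ 522 * (k ^ 2 * r ^ 2) := by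
    have e1 : #U ^ 2 ≤ (20 * (k * r)) ^ 2 := Nat.pow_le_pow_left hU' 2
    have e2 : #U * ((2 * f + 6) * r) ≤ (20 * (k * r)) * (3 * (k * r)) := Nat.mul_le_mul hU' hE
    have e3 : f ^ 2 ≤ k ^ 2 := Nat.pow_le_pow_left (by lia) 2
    have e4 : (20 * (k * r)) ^ 2 = 400 * (k ^ 2 * r ^ 2) := by ring
    have e5 : (20 * (k * r)) * (3 * (k * r)) = 60 * (k ^ 2 * r ^ 2) := by ring
    rw [hD, hφ, mul_assoc 2 #U]
    lia
  have hqD : q * D < 2 * n := by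
    calc q * D ≤ r * (522 * (k ^ 2 * r ^ 2)) := Nat.mul_le_mul (by lia) hD'
      _ = 522 * (k ^ 2 * r ^ 3) := by ring
      _ < 2 * n := by
        have : 0 < k ^ 2 * r ^ 3 := by positivity
        lia
  have hWc : #W = f := by
    by_contra hne
    have : #W + 1 ≤ f := by lia
    have := Nat.mul_le_mul_right (2 * n) this
    have := Nat.zero_le (2 * q * ∑ w ∈ W, #(G.nonNbr w))
    linarith
  refine ⟨W, hWc, fun w hw => ⟨(mem_filter.1 hw).2, ?_⟩⟩
  have h2 : #(G.nonNbr w) ≤ ∑ w ∈ W, #(G.nonNbr w) :=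
    single_le_sum (f := fun w => #(G.nonNbr w)) (fun _ _ => Nat.zero_le _) hw
  rw [hWc] at h1
  have h3 : q * (2 * ∑ w ∈ W, #(G.nonNbr w)) ≤ q * D := by linarith
  have h4 := Nat.le_of_mul_le_mul_left h3 (by lia)
  lia

/-- The common neighbours of `u` and `v`. -/
noncomputable def commonNbr (G : SimpleGraph V) (u v : V) : Finset V := {x | G.Adj u x ∧ G.Adj v x}

@[simp] theorem mem_commonNbr : x ∈ G.commonNbr v w ↔ G.Adj v x ∧ G.Adj w x := by
  simp [commonNbr]

theorem commonNbr_comm : G.commonNbr v w = G.commonNbr w v := by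
  ext; simp [and_comm]

/-- The adjacency between `u` and `v` is thick if `u` and `v` have many common neighbours. -/
def IsThick (G : SimpleGraph V) (u v : V) : Prop :=
  G.Adj u v ∧ Fintype.card V ≤ 6 * #(G.commonNbr u v) + 3

theorem IsThick.symm (h : G.IsThick x y) : G.IsThick y x :=
  ⟨h.1.symm, by rw [commonNbr_comm]; exact h.2⟩

/-- The three degrees sum to at least `3 * (n - 1) / 2`. A vertex adjacent to `i` of the three
corners contributes at most one more than its number of adjacent pairs of corners, so the three
common neighbourhoods have total size at least `(n - 3) / 2`. -/
theorem NearTuran.exists_isThick (h : G.NearTuran 2 m) (hxy : G.Adj x y) (hxv : G.Adj x v)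
    (hyv : G.Adj y v) : G.IsThick x y ∨ G.IsThick x v ∨ G.IsThick y v := by
  by_contra! hcon
  obtain ⟨h1, h2, h3⟩ := hcon
  have a1 := not_le.1 fun h => h1 ⟨hxy, h⟩
  have a2 := not_le.1 fun h => h2 ⟨hxv, h⟩
  have a3 := not_le.1 fun h => h3 ⟨hyv, h⟩
  have key : ∀ u, (if G.Adj x u then 1 else 0) + (if G.Adj y u then 1 else 0) +
      (if G.Adj v u then 1 else 0) ≤ 1 + (if G.Adj x u ∧ G.Adj y u then 1 else 0) +
      (if G.Adj x u ∧ G.Adj v u then 1 else 0) + (if G.Adj y u ∧ G.Adj v u then 1 else 0) := by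
    intro u
    by_cases p1 : G.Adj x u <;> by_cases p2 : G.Adj y u <;> by_cases p3 : G.Adj v u <;>
      simp [p1, p2, p3]
  have hs := sum_le_sum fun u (_ : u ∈ univ) => key u
  simp only [sum_add_distrib, ← card_filter, sum_const, card_univ, smul_eq_mul, mul_one] at hs
  simp only [commonNbr] at a1 a2 a3
  have b1 := card_adj_add_card_nonNbr G x
  have b2 := card_adj_add_card_nonNbr G y
  have b3 := card_adj_add_card_nonNbr G v
  have c1 := h.card_nonNbr_le x
  have c2 := h.card_nonNbr_le y
  have c3 := h.card_nonNbr_le v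
  have d := h.mul_le
  lia

/-- In the case of triangles, few vertices meet all pairs of thick edges with a common end. -/
theorem exists_hitting_thick
    (hfree : ∀ A p, ¬ G.HasCliquePath 2 (2 * (f + 1)) A p)
    (hn₁ : 60000 * f + 3000 ≤ Fintype.card V)
    (hn₂ : 74 * (f + 1) * (37 * f + 1) < Fintype.card V) :
    ∃ U : Finset V, #U ≤ 111 * f + 3 ∧ ∀ v a a', a ≠ a' → G.IsThick v a → G.IsThick v a' →
      ¬ Disjoint {v, a, a'} U := by
  rcases exists_disjoint_family_or_hitting (fun s : Finset V => ∃ v a a', a ≠ a' ∧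
    G.IsThick v a ∧ G.IsThick v a' ∧ s = {v, a, a'}) 3
    (by rintro s ⟨v, a, a', -, -, -, rfl⟩; exact ⟨card_le_three, insert_nonempty _ _⟩)
    (37 * f + 1) with ⟨I, hI, hIP, hd⟩ | ⟨U, hUc, hU⟩
  swap
  · exact ⟨U, by lia, fun v a a' hne h1 h2 => hU _ ⟨v, a, a', hne, h1, h2, rfl⟩⟩
  exfalso
  set n := Fintype.card V with hndef
  let U := I.biUnion id
  have hUc : #U ≤ 111 * f + 3 := by
    refine (card_biUnion_le_card_mul I id 3 fun s hs => ?_).trans (by lia)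
    obtain ⟨v, a, a', -, -, -, rfl⟩ := hIP s hs
    exact card_le_three
  -- A pair of thick edges `v a`, `v a'` carries the two triangles `x a v` and `v a' y`, which share
  -- only `v`; one label thus yields two cliques.
  obtain ⟨R, hR⟩ : ∃ R : Finset V → V → V → Prop, ∀ s x y, R s x y ↔
      (x ≠ y ∧ x ∉ U ∧ y ∉ U ∧ ∃ v a a', a ≠ a' ∧ s = {v, a, a'} ∧ G.Adj v a ∧ G.Adj v a' ∧
        G.Adj v x ∧ G.Adj a x ∧ G.Adj v y ∧ G.Adj a' y) := ⟨_, fun _ _ _ => Iff.rfl⟩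
  -- Lower bound for the common neighbours of a thick edge outside `U`. As `n * n ≤ 37 * (z * (z -
  -- 1))`, a family of `37 * f + 1` labels is large enough.
  obtain ⟨z, hz⟩ : ∃ z, z = (n - 3) / 6 - (111 * f + 3) := ⟨_, rfl⟩
  have hcount : ∀ s ∈ I, z * (z - 1) ≤ #{z : V × V | R s z.1 z.2} := by
    intro s hs
    obtain ⟨v, a, a', hne, h1, h2, rfl⟩ := hIP s hs
    have hX : ∀ b, G.IsThick v b → z ≤ #(G.commonNbr v b \ U) := by
      intro b hb
      have a1 := hb.2
      have a2 := le_card_sdiff U (G.commonNbr v b)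
      lia
    rw [card_filter_prod]
    calc z * (z - 1) ≤ #(G.commonNbr v a \ U) * (z - 1) :=
          Nat.mul_le_mul_right _ (hX a h1)
      _ ≤ ∑ x ∈ G.commonNbr v a \ U, #{y | R {v, a, a'} x y} := by
        rw [← smul_eq_mul]
        refine card_nsmul_le_sum _ _ _ fun x hx => ?_
        have a1 := hX a' h2
        have a2 := pred_card_le_card_erase (a := x)
          (s := (G.commonNbr v a' \ U : Finset V))
        refine le_trans (by lia) (card_le_card
          (s := (G.commonNbr v a' \ U : Finset V).erase x) fun y hy => ?_)
        simp only [mem_erase, mem_sdiff, mem_filter, mem_univ, true_and, mem_commonNbr] at hx hy ⊢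
        rw [hR]
        exact ⟨hy.1.symm, hx.2, hy.2.2, v, a, a', hne, rfl, h1.1, h2.1, hx.1.1, hx.1.2, hy.2.1.1,
          hy.2.1.2⟩
      _ ≤ _ := sum_le_sum_of_subset (subset_univ _)
  obtain ⟨A, p, hA⟩ := exists_hasCliquePath_of_labels (G := G) (q := 2) (I := I) (T := id) (R := R)
    (c := 2) (j := f + 1) (N := z * (z - 1)) hd
    (fun s _ x y hxy => by
      rw [hR] at hxy ⊢
      obtain ⟨h1, h2, h3, v, a, a', h4, h5, h6, h7, h8, h9, h10, h11⟩ := hxy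
      exact ⟨h1.symm, h3, h2, v, a', a, h4.symm, by rw [h5, pair_comm], h7, h6, h10, h11, h8, h9⟩)
    (fun s _ x y hxy => ((hR _ _ _).1 hxy).1)
    (fun s _ x y hxy s' hs' hx => ((hR _ _ _).1 hxy).2.1 (mem_biUnion.2 ⟨s', hs', hx⟩))
    (fun s hs x y hxy l A hA hd hy => by
      rw [hR] at hxy
      obtain ⟨h1, h2, h3, v, a, a', h4, rfl, h6, h7, h8, h9, h10, h11⟩ := hxy
      have hyU : ∀ b ∈ ({v, a, a'} : Finset V), y ≠ b := fun b hb hyb =>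
        h3 (mem_biUnion.2 ⟨_, hs, hyb ▸ hb⟩)
      simp only [id, disjoint_insert_right, disjoint_singleton_right] at hd
      have s1 := hA.step (Q := {a, v}) (x := v)
        (by simp [hd.1, hd.2.1]) (card_pair h6.ne') (by simp)
        (by
          simp only [coe_insert, coe_singleton, isClique_insert, isClique_singleton, true_and]
          refine ⟨by simp [h6.symm], fun b hb _ => ?_⟩
          rcases hb with rfl | rfl
          · exact h9.symm
          · exact h8.symm)
      have s2 := s1.step (Q := {a', y}) (x := y)
        (by simp [hd.2.2, hy, h4.symm, h7.ne', hyU v (by simp), hyU a (by simp)])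
        (card_pair (hyU a' (by simp)).symm) (by simp)
        (by
          simp only [coe_insert, coe_singleton, isClique_insert, isClique_singleton, true_and]
          refine ⟨by simp [h11], fun b hb _ => ?_⟩
          rcases hb with rfl | rfl
          · exact h7
          · exact h10)
      refine ⟨_, s2, fun u hu => ?_⟩
      simp only [mem_union, mem_insert, mem_singleton, id] at hu ⊢
      tauto)
    hcount (by lia) (by
      rw [hI, Nat.add_sub_cancel]
      have c1 : 987 * n ≤ 6000 * (z - 1) := by lia
      have c2 : 987 * n ≤ 6000 * z := by lia
      have c3 := Nat.mul_le_mul c2 c1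
      have c4 : n * n ≤ 37 * (z * (z - 1)) := by nlinarith
      have c5 : 2 * (f + 1) * (37 * f + 1) * 37 * n < n * n :=
        Nat.mul_lt_mul_of_pos_right (by lia) (by lia)
      nlinarith)
  exact hfree A p hA

end

/-! ### Large degrees in the case of triangles -/

section

variable {V : Type*} [Fintype V] {G F : SimpleGraph V} {q l k m f E : ℕ} {K S U W : Finset V}
  {p v w x y : V}

/-- A matching of thick edges that covers almost all vertices yields a clique-path of triangles. -/
theorem exists_hasCliquePath_of_thick_matching {C : Finset V} {π : V → V} (hC : C.Nonempty)
    (hππ : ∀ x ∈ C, π (π x) = x) (hthick : ∀ x ∈ C, G.IsThick x (π x))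
    (hn : 6 * (Fintype.card V - #C) + 24 * k + 20 ≤ Fintype.card V) :
    ∃ A p, G.HasCliquePath 2 k A p := by
  -- The partner of the end stays unused: the next triangle is `p`, `π p` and a common neighbour
  -- `y`, chosen in `C` so that neither `y` nor `π y` has been used.
  suffices ∀ t ≤ k, ∃ A p, G.HasCliquePath 2 t A p ∧ p ∈ C ∧ π p ∉ A by
    obtain ⟨A, p, h, -⟩ := this k le_rfl
    exact ⟨A, p, h⟩
  intro t ht
  induction t with
  | zero =>
    obtain ⟨p, hp⟩ := hC
    exact ⟨{p}, p, hasCliquePath_zero, hp, by simpa using (hthick p hp).1.ne'⟩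
  | succ t ih =>
    obtain ⟨A, p, h, hp, hpA⟩ := ih (by lia)
    have hpp := hthick p hp
    have hcard : #(Cᶜ ∪ (A ∪ A.image π)) < #(G.commonNbr p (π p)) := by
      have h1 := card_union_le Cᶜ (A ∪ A.image π)
      have h2 := card_union_le A (A.image π)
      have h3 : #(A.image π) ≤ #A := card_image_le
      have h4 := hpp.2
      rw [card_compl] at h1
      rw [h.card] at h2 h3
      lia
    obtain ⟨y, hy, hyn⟩ := exists_mem_notMem_of_card_lt_card hcard
    simp only [mem_union, mem_compl, not_or, not_not] at hyn
    rw [mem_commonNbr] at hy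
    have hyA := hyn.2.1
    have hπy : π y ∉ A := fun hA => hyn.2.2 (mem_image.2 ⟨_, hA, hππ y hyn.1⟩)
    refine ⟨_, y, h.step (Q := {π p, y}) (x := y) (by simp [hpA, hyA]) (card_pair hy.2.ne)
      (by simp) ?_, hyn.1, ?_⟩
    · simp only [coe_insert, coe_singleton, isClique_insert, isClique_singleton, true_and]
      refine ⟨by simp [hy.2], fun b hb _ => ?_⟩
      rcases hb with rfl | rfl
      · exact hpp.1
      · exact hy.1
    · simp only [mem_union, mem_insert, mem_singleton, not_or]
      refine ⟨hπy, fun h' => hyA ?_, (hthick y hyn.1).1.ne'⟩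
      have := hππ y hyn.1
      rw [h', hππ p hp] at this
      exact this ▸ h.mem

-- Thick edges outside `U` form the matching `π` on `C`, so the exceptional graph `F` costs at most
-- `#C` in the degree sum. This is no longer negligible, and two structural arguments replace the
-- pure count: a nearly perfect thick matching gives a long clique-path, and so do two matching
-- edges near the two ends of the chain through `W`.
set_option maxHeartbeats 400000 in
theorem NearTuran.exists_large_degree_of_two (h : G.NearTuran 2 m) (hk : 3 ≤ k)
    (hf₁ : 2 * f + 1 ≤ k) (hf₂ : k ≤ 2 * f + 2)
    (hn : 9 * k ^ 4 * (2 + 1) ^ 5 ≤ Fintype.card V)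
    (hfree : ∀ A p, ¬ G.HasCliquePath 2 k A p)
    (he : f * (Fintype.card V - f) + (turanGraph (Fintype.card V - f) 2).edgeSet.ncard ≤
      G.edgeSet.ncard) :
    ∃ W : Finset V, #W = f ∧ ∀ w ∈ W, #(G.nonNbr w) + (2 * f + 6) * (2 + 1) ≤ m ∧
      6 * #(G.nonNbr w) ≤ Fintype.card V := by
  set n := Fintype.card V with hndef
  have hf : 1 ≤ f := by lia
  have hfk : 9 * f ≤ k ^ 2 ∧ f ≤ f ^ 2 := by constructor <;> nlinarith
  have b1 : 177147 * f ^ 2 ≤ n := by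
    calc 177147 * f ^ 2 = 9 * ((9 * f) * (9 * f)) * 243 := by ring
      _ ≤ 9 * (k ^ 2 * k ^ 2) * 243 := by
        have := Nat.mul_le_mul hfk.1 hfk.1
        lia
      _ = 9 * k ^ 4 * (2 + 1) ^ 5 := by ring
      _ ≤ n := hn
  obtain ⟨hfk1, hff⟩ := hfk
  have b2 : 74 * (f + 1) * (37 * f + 1) < n := by nlinarith
  obtain ⟨U, hUc, hU⟩ := exists_hitting_thick (G := G) (f := f)
    (fun A p hA => by
      obtain ⟨A', p', hA'⟩ := hA.exists_of_le (k := k) (by lia)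
      exact hfree A' p' hA') (by lia) b2
  obtain ⟨F, hF⟩ : ∃ F : SimpleGraph V, ∀ x y, F.Adj x y ↔ G.IsThick x y :=
    ⟨{ Adj := G.IsThick
       symm := ⟨fun x y h => h.symm⟩
       loopless := ⟨fun x h => h.1.ne rfl⟩ }, fun _ _ => Iff.rfl⟩
  -- Without its thick edges `G` is triangle-free, so every set meets all triangles of `G \ F`.
  have h1 := h.card_mul_add_sum_le (H := G \ F) (F := F) (E := (2 * f + 6) * (2 + 1))
    (fun x y hxy => by rw [sdiff_adj]; tauto) U
    (fun K hK => by
      exfalso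
      obtain ⟨x, y, v, hxy, hxv, hyv, rfl⟩ := card_eq_three.1 hK.2
      have a1 := hK.1 (by simp : x ∈ _) (by simp : y ∈ _) hxy
      have a2 := hK.1 (by simp : x ∈ _) (by simp : v ∈ _) hxv
      have a3 := hK.1 (by simp : y ∈ _) (by simp : v ∈ _) hyv
      rw [sdiff_adj, hF] at a1 a2 a3
      rcases h.exists_isThick a1.1 a2.1 a3.1 with h | h | h
      · exact a1.2 h
      · exact a2.2 h
      · exact a3.2 h) (by lia) he
  set W := {w ∈ U | #(G.nonNbr w) + (2 * f + 6) * (2 + 1) ≤ m} with hW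
  have hWU : W ⊆ U := filter_subset _ _
  have hWr : ∀ w ∈ W, #(G.nonNbr w) + (2 * f + 6) * (2 + 1) ≤ m := fun w hw => (mem_filter.1 hw).2
  have hWf : #W ≤ f := h.card_le_of_free hf₂ le_rfl hfree hWr
  obtain ⟨C, hC⟩ : ∃ C : Finset V, ∀ x, x ∈ C ↔ x ∉ U ∧ ∃ y, y ∉ U ∧ G.IsThick x y :=
    ⟨({x | x ∉ U ∧ ∃ y, y ∉ U ∧ G.IsThick x y} : Set V).toFinset, by simp⟩
  have huniq : ∀ x, x ∉ U → ∀ y, y ∉ U → G.IsThick x y → ∀ z, z ∉ U → G.IsThick x z → y = z := by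
    intro x hx y hy hxy z hz hxz
    by_contra hyz
    exact hU x y z hyz hxy hxz (by simp [hx, hy, hz])
  have hφ : ∑ x ∈ Uᶜ, #{y ∈ Uᶜ | F.Adj x y} ≤ #C := by
    have : ∀ x ∈ Uᶜ, #{y ∈ Uᶜ | F.Adj x y} ≤ if x ∈ C then 1 else 0 := by
      intro x hx
      split_ifs with hxC
      · refine card_le_one.2 fun y hy z hz => ?_
        rw [mem_filter, mem_compl, hF] at hy hz
        exact huniq x (mem_compl.1 hx) y hy.1 hy.2 z hz.1 hz.2
      · rw [Nat.le_zero, card_eq_zero, filter_eq_empty_iff]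
        intro y hy hxy
        rw [hF] at hxy
        exact hxC ((hC x).2 ⟨mem_compl.1 hx, y, mem_compl.1 hy, hxy⟩)
    refine (sum_le_sum this).trans ?_
    rw [← card_filter]
    exact card_le_card fun x hx => (mem_filter.1 hx).2
  have hCn : #C ≤ n := card_le_univ C
  have hchoice : ∀ x, ∃ y, x ∈ C → y ∉ U ∧ G.IsThick x y := fun x => by
    by_cases hx : x ∈ C
    · obtain ⟨y, hy⟩ := ((hC x).1 hx).2
      exact ⟨y, fun _ => hy⟩
    · exact ⟨x, fun h => absurd h hx⟩
  choose π hπ using hchoice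
  have hπC : ∀ x ∈ C, π x ∈ C := fun x hx =>
    (hC _).2 ⟨(hπ x hx).1, x, ((hC x).1 hx).1, (hπ x hx).2.symm⟩
  have hππ : ∀ x ∈ C, π (π x) = x := fun x hx =>
    huniq (π x) (hπ x hx).1 _ (hπ _ (hπC x hx)).1 (hπ _ (hπC x hx)).2 _ ((hC x).1 hx).1
      (hπ x hx).2.symm
  set φ := ∑ x ∈ Uᶜ, #{y ∈ Uᶜ | F.Adj x y}
  obtain ⟨D, hD⟩ : ∃ D, D = #U ^ 2 + 2 * #U * ((2 * f + 6) * (2 + 1)) + 2 * f ^ 2 + 2 := ⟨_, rfl⟩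
  rw [← hD] at h1
  have hDb : D ≤ 18472 * f ^ 2 := by
    have e0 : #U ≤ 114 * f := by lia
    have e1 : #U ^ 2 ≤ (114 * f) ^ 2 := Nat.pow_le_pow_left e0 2
    have e2 : #U * ((2 * f + 6) * (2 + 1)) ≤ (114 * f) * (24 * f) := Nat.mul_le_mul e0 (by lia)
    have e3 : (114 * f) ^ 2 = 12996 * f ^ 2 := by ring
    have e4 : (114 * f) * (24 * f) = 2736 * f ^ 2 := by ring
    rw [hD, mul_assoc 2 #U]
    lia
  -- With fewer than `f` large vertices the edge count forces `n ≤ D + #C`, so the thick matching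
  -- covers all but `D` vertices.
  have hWc : #W = f := by
    by_contra hne
    have a1 : #W + 1 ≤ f := by lia
    have a2 := Nat.mul_le_mul_right (2 * n) a1
    have a3 := Nat.zero_le (2 * 2 * ∑ w ∈ W, #(G.nonNbr w))
    have a4 : n ≤ D + #C := by linarith
    obtain ⟨A, p, hA⟩ := exists_hasCliquePath_of_thick_matching (G := G) (k := k) (C := C) (π := π)
      (card_pos.1 (by lia)) hππ (fun x hx => (hπ x hx).2) (by lia)
    exact hfree A p hA
  rw [hWc] at h1
  have h2 : 2 * ∑ w ∈ W, #(G.nonNbr w) ≤ D + #C := by linarith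
  have h3 : ∀ w ∈ W, #(G.nonNbr w) ≤ ∑ w ∈ W, #(G.nonNbr w) := fun w hw =>
    single_le_sum (f := fun w => #(G.nonNbr w)) (fun _ _ => Nat.zero_le _) hw
  -- This turns `2 * ∑ ≤ D + #C` into `∑ ≤ D + 2`, far below `n / 6`.
  suffices ∃ w ∈ W, #C ≤ #(G.nonNbr w) + 2 by
    obtain ⟨w₀, hw₀, hCw⟩ := this
    have := h3 w₀ hw₀
    refine ⟨W, hWc, fun w hw => ⟨hWr w hw, ?_⟩⟩
    have := h3 w hw
    lia
  have hsplit : ∀ w, #C ≤ #(G.nonNbr w) + #{x ∈ C | G.Adj w x} := by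
    intro w
    have a1 := card_filter_add_card_filter_not (s := C) (fun x => G.Adj w x)
    have a2 : #{x ∈ C | ¬ G.Adj w x} ≤ #(G.nonNbr w) :=
      card_le_card fun x hx => by simpa using (mem_filter.1 hx).2
    lia
  obtain ⟨a, L, hL⟩ := List.exists_cons_of_ne_nil (l := W.toList)
    (by rw [Ne, toList_eq_nil]; intro h; rw [h] at hWc; simp at hWc; lia)
  have hmemL : ∀ v ∈ a :: L, v ∈ W := fun v hv => by rw [← mem_toList, hL]; exact hv
  have hlen : L.length + 1 = f := by
    have := congrArg List.length hL
    rw [length_toList, hWc, List.length_cons] at this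
    lia
  obtain ⟨b, hb⟩ : ∃ b, b = (a :: L).getLast (by simp) := ⟨_, rfl⟩
  have hbW : b ∈ W := hmemL b (hb ▸ List.getLast_mem _)
  by_cases hCa : {x ∈ C | G.Adj a x} = ∅
  · refine ⟨a, hmemL a (by simp), ?_⟩
    have := hsplit a
    rw [hCa, card_empty] at this
    lia
  refine ⟨b, hbW, ?_⟩
  obtain ⟨u₁, hu₁⟩ := nonempty_iff_ne_empty.2 hCa
  rw [mem_filter] at hu₁
  -- Otherwise two different matching edges, one with an end adjacent to `a` and one with an end
  -- adjacent to `b`, complete to disjoint triangles, which are bridged through all of `W` by `2 * f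
  -- + 2` cliques in total.
  suffices {x ∈ C | G.Adj b x} ⊆ {u₁, π u₁} by
    have a1 := card_le_card this
    have a2 : #{u₁, π u₁} ≤ 2 := card_le_two
    have := hsplit b
    lia
  intro u₂ hu₂
  rw [mem_filter] at hu₂
  by_contra hne
  rw [mem_insert, mem_singleton, not_or] at hne
  have hne1 : π u₂ ≠ u₁ := fun h => hne.2 (by rw [← h, hππ u₂ hu₂.1])
  have hne2 : π u₂ ≠ π u₁ := fun h => hne.1 (by rw [← hππ u₂ hu₂.1, h, hππ u₁ hu₁.1])
  have hnb : ∀ (u : V) (Z : Finset V), u ∈ C → #Z ≤ f + 3 → ∃ x, x ∉ Z ∧ G.Adj u x ∧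
      G.Adj (π u) x := by
    intro u Z hu hZ
    have a1 := (hπ u hu).2.2
    obtain ⟨x, hx, hxZ⟩ := exists_mem_notMem_of_card_lt_card
      (show #Z < #(G.commonNbr u (π u)) by lia)
    rw [mem_commonNbr] at hx
    exact ⟨x, hxZ, hx⟩
  obtain ⟨x₁, hx₁, hx₁'⟩ := hnb u₁ (W ∪ {u₂, π u₂}) hu₁.1 (by
    have := card_union_le W {u₂, π u₂}
    have : #{u₂, π u₂} ≤ 2 := card_le_two
    lia)
  obtain ⟨x₂, hx₂, hx₂'⟩ := hnb u₂ (W ∪ {u₁, π u₁, x₁}) hu₂.1 (by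
    have := card_union_le W {u₁, π u₁, x₁}
    have : #{u₁, π u₁, x₁} ≤ 3 := card_le_three
    lia)
  simp only [mem_union, mem_insert, mem_singleton, not_or] at hx₁ hx₂
  have htri : ∀ u x, u ∈ C → G.Adj u x → G.Adj (π u) x →
      G.IsClique ({u, π u, x} : Finset V) ∧ #{u, π u, x} = 2 + 1 := by
    intro u x hu h1 h2
    have h3 := (hπ u hu).2.1
    have := is3Clique_triple_iff.2 ⟨h3, h1, h2⟩
    exact ⟨this.1, this.2⟩
  have hCW : ∀ u ∈ C, u ∉ W := fun u hu h => ((hC u).1 hu).1 (hWU h)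
  obtain ⟨A, p, hA⟩ := h.bridge (w := a) (L := L) (E := (2 * f + 6) * (2 + 1))
    (fun v hv => hWr v (hmemL v hv)) (hL ▸ nodup_toList W) (Nat.mul_le_mul_right _ (by lia))
    (htri u₁ x₁ hu₁.1 hx₁'.1 hx₁'.2).1 (htri u₁ x₁ hu₁.1 hx₁'.1 hx₁'.2).2
    (htri u₂ x₂ hu₂.1 hx₂'.1 hx₂'.2).1 (htri u₂ x₂ hu₂.1 hx₂'.1 hx₂'.2).2
    (by
      simp only [disjoint_insert_left, disjoint_singleton_left, mem_insert, mem_singleton, not_or]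
      exact ⟨⟨Ne.symm hne.1, hne1.symm, Ne.symm hx₂.2.1⟩,
        ⟨Ne.symm hne.2, hne2.symm, Ne.symm hx₂.2.2.1⟩, hx₁.2.1, hx₁.2.2, Ne.symm hx₂.2.2.2⟩)
    (fun v hv => by
      have hvW := hmemL v hv
      have a1 := hCW u₁ hu₁.1
      have a2 := hCW _ (hπC u₁ hu₁.1)
      have a3 := hCW u₂ hu₂.1
      have a4 := hCW _ (hπC u₂ hu₂.1)
      simp only [mem_insert, mem_singleton, not_or]
      exact ⟨⟨fun h => a1 (h ▸ hvW), fun h => a2 (h ▸ hvW), fun h => hx₁.1 (h ▸ hvW)⟩,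
        fun h => a3 (h ▸ hvW), fun h => a4 (h ▸ hvW), fun h => hx₂.1 (h ▸ hvW)⟩)
    (mem_insert_self _ _) (mem_insert_self _ _) hu₁.2.symm (hb ▸ hu₂.2.symm)
  obtain ⟨A', p', hA'⟩ := hA.exists_of_le (k := k) (by lia)
  exact hfree A' p' hA'

end

/-! ### Colouring graphs without two cliques sharing one vertex -/

section

variable {V : Type*} {G : SimpleGraph V} {q k m θ : ℕ} {K K₁ K₂ S U Z : Finset V} {p v w x y : V}

/-- Cliques can be extended greedily by one vertex from each of several sets that are almost
completely joined. -/
theorem exists_clique_extension {ι : Type*} {C : ι → Finset V} (hK : G.IsClique K) (J : Finset ι)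
    (h₁ : ∀ u ∈ K, ∀ i ∈ J, #{x ∈ C i | ¬ G.Adj u x} ≤ θ)
    (h₂ : ∀ i ∈ J, ∀ j ∈ J, i ≠ j → ∀ u ∈ C i, #{x ∈ C j | ¬ G.Adj u x} ≤ θ)
    (h₃ : ∀ i ∈ J, (#K + #J) * θ + #Z < #(C i)) :
    ∃ Q : Finset V, #Q = #J ∧ Disjoint Q Z ∧ Disjoint Q K ∧ G.IsClique (K ∪ Q : Finset V) ∧
      ∀ x ∈ Q, ∃ i ∈ J, x ∈ C i := by
  induction J using Finset.induction_on with
  | empty => exact ⟨∅, by simp [hK]⟩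
  | insert i J hi ih =>
    obtain ⟨Q, hQ, hQZ, hQK, hc, hQC⟩ := ih
      (fun u hu j hj => h₁ u hu j (mem_insert_of_mem hj))
      (fun j hj j' hj' => h₂ j (mem_insert_of_mem hj) j' (mem_insert_of_mem hj'))
      (fun j hj => lt_of_le_of_lt (by
        rw [card_insert_of_notMem hi]; gcongr; lia) (h₃ j (mem_insert_of_mem hj)))
    have hbad : #((K ∪ Q).biUnion (fun u => {x ∈ C i | ¬ G.Adj u x}) ∪ Z) < #(C i) := by
      refine lt_of_le_of_lt ((card_union_le _ _).trans (Nat.add_le_add_right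
        (card_biUnion_le_card_mul _ _ θ ?_) _))
        (lt_of_le_of_lt (b := (#K + #(insert i J)) * θ + #Z) ?_ (h₃ i (mem_insert_self _ _)))
      · intro u hu
        rcases mem_union.1 hu with hu | hu
        · exact h₁ u hu i (mem_insert_self _ _)
        · obtain ⟨j, hj, huj⟩ := hQC u hu
          exact h₂ j (mem_insert_of_mem hj) i (mem_insert_self _ _)
            (fun h => hi (h ▸ hj)) u huj
      · have := card_union_le K Q
        rw [card_insert_of_notMem hi]
        gcongr
        lia
    obtain ⟨x, hx, hxn⟩ := exists_mem_notMem_of_card_lt_card hbad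
    simp only [mem_union, mem_biUnion, mem_filter, not_or, not_exists, not_and, not_not] at hxn
    have hadj : ∀ u ∈ K ∪ Q, G.Adj u x := fun u hu => hxn.1 u (mem_union.1 hu) hx
    have hxK : x ∉ K := fun h => (hadj x (mem_union_left _ h)).ne rfl
    have hxQ : x ∉ Q := fun h => (hadj x (mem_union_right _ h)).ne rfl
    refine ⟨insert x Q, ?_, ?_, ?_, ?_, ?_⟩
    · rw [card_insert_of_notMem hxQ, card_insert_of_notMem hi, hQ]
    · rw [disjoint_insert_left]; exact ⟨hxn.2, hQZ⟩
    · rw [disjoint_insert_left]; exact ⟨hxK, hQK⟩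
    · rw [union_insert, coe_insert, isClique_insert]
      exact ⟨hc, fun u hu _ => (hadj u hu).symm⟩
    · intro z hz
      rcases mem_insert.1 hz with rfl | hz
      · exact ⟨i, mem_insert_self _ _, hx⟩
      · obtain ⟨j, hj, h⟩ := hQC z hz
        exact ⟨j, mem_insert_of_mem hj, h⟩

theorem hasCliquePath_two (hq : 1 ≤ q) {T₁ T₂ : Finset V} (hT₁ : G.IsClique T₁) (hT₂ : G.IsClique T₂)
    (hc₁ : #T₁ = q + 1) (hc₂ : #T₂ = q + 1) (hp₁ : p ∈ T₁) (hp₂ : p ∈ T₂)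
    (h : ∀ x ∈ T₁, x ∈ T₂ → x = p) : ∃ A x, G.HasCliquePath q 2 A x := by
  obtain ⟨x, hx, hxp⟩ := exists_mem_ne (by lia : 1 < #T₂) p
  refine ⟨_, x, (hT₁.hasCliquePath_one hc₁ hp₁ hq).step (Q := T₂.erase p) ?_ ?_
    (mem_erase.2 ⟨hxp, hx⟩) (by rwa [insert_erase hp₂])⟩
  · rw [Finset.disjoint_left]
    intro y hy hy'
    rw [mem_erase] at hy'
    exact hy'.1 (h y hy hy'.2)
  · rw [card_erase_of_mem hp₂, hc₂]; rfl

/-- The Andrásfai–Erdős–Sós theorem for the subgraph induced on `S`; vertices outside `S` receive a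
default colour. -/
theorem exists_coloring_of_lt (hq : 2 ≤ q) (H : SimpleGraph V) (S : Finset V)
    (hS : S.Nonempty) (hfree : ∀ K : Finset V, H.IsClique K → #K = q + 1 → ¬ K ⊆ S)
    (hd : ∀ x ∈ S, (3 * q - 4) * #S < (3 * q - 1) * #{y ∈ S | H.Adj x y}) :
    ∃ c : V → Fin q, ∀ x ∈ S, ∀ y ∈ S, H.Adj x y → c x ≠ c y := by
  have hcf : (H.induce (S : Set V)).CliqueFree (q + 1) := by
    intro K hK
    rw [isNClique_iff] at hK
    refine hfree (K.map (Function.Embedding.subtype _)) ?_ (by rw [card_map, hK.2]) ?_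
    · intro a ha b hb hab
      rw [mem_coe, mem_map] at ha hb
      obtain ⟨a, ha, rfl⟩ := ha
      obtain ⟨b, hb, rfl⟩ := hb
      exact hK.1 ha hb fun h => hab (h ▸ rfl)
    · intro a ha
      rw [mem_map] at ha
      obtain ⟨a, -, rfl⟩ := ha
      exact a.2
  have hne : Nonempty (S : Set V) := hS.to_subtype
  have hcol : (H.induce (S : Set V)).Colorable q := by
    refine colorable_of_cliqueFree_lt_minDegree hcf ?_
    obtain ⟨x, hx⟩ := exists_minimal_degree_vertex (H.induce (S : Set V))
    rw [hx]
    have h1 := hd x x.2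
    have h2 : #{y ∈ S | H.Adj x y} = (H.induce (S : Set V)).degree x := by
      rw [← card_neighborFinset_eq_degree,
        ← card_map (Function.Embedding.subtype (· ∈ (S : Set V)))]
      congr 1
      ext y
      simp only [mem_filter, mem_map, mem_neighborFinset, comap_adj,
        Function.Embedding.subtype_apply]
      constructor
      · rintro ⟨h1, h2⟩; exact ⟨⟨y, h1⟩, h2, rfl⟩
      · rintro ⟨z, h1, rfl⟩; exact ⟨z.2, h1⟩
    have h3 : Fintype.card (S : Set V) = #S :=
      (Set.toFinset_card _).symm.trans (by rw [Finset.toFinset_coe])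
    rw [h2] at h1
    rw [h3]
    exact Nat.div_lt_of_lt_mul h1
  obtain ⟨c⟩ := hcol
  refine ⟨fun x => if h : x ∈ S then c ⟨x, h⟩ else ⟨0, by lia⟩, fun x hx y hy hxy => ?_⟩
  dsimp only
  rw [dif_pos hx, dif_pos hy]
  exact c.valid (v := ⟨x, hx⟩) (w := ⟨y, hy⟩) hxy

/-- A graph without two cliques sharing a vertex that has large minimum degree is, up to few
vertices, almost `q`-partite. -/
theorem NearTuran.exists_coloring [Fintype V] (h : G.NearTuran q m)
    (hn : 64 * (q + 1) ^ 5 ≤ Fintype.card V) (hfree : ∀ A p, ¬ G.HasCliquePath q 2 A p) :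
    ∃ (U : Finset V) (c : V → Fin q), #U ≤ 40 * (q + 1) ∧
      ∀ v ∉ U, #{y ∈ Uᶜ | G.Adj v y ∧ c v = c y} ≤ 1 := by
  have hq := h.two_le
  have hqm := h.mul_le
  set n := Fintype.card V with hndef
  have hr2 : 9 ≤ (q + 1) ^ 2 := by nlinarith
  have hr4 : 9 * 9 ≤ (q + 1) ^ 4 := by
    calc 9 * 9 ≤ (q + 1) ^ 2 * (q + 1) ^ 2 := Nat.mul_le_mul hr2 hr2
      _ = _ := by ring
  have hn₁ : 5184 * (q + 1) ≤ n := by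
    calc 5184 * (q + 1) = 64 * (9 * 9) * (q + 1) := by ring
      _ ≤ 64 * (q + 1) ^ 4 * (q + 1) := by gcongr
      _ = 64 * (q + 1) ^ 5 := by ring
      _ ≤ n := hn
  have hn₂ : 1728 * (q + 1) ^ 2 ≤ n := by
    calc 1728 * (q + 1) ^ 2 = 64 * 9 * (q + 1) ^ 2 * 3 := by ring
      _ ≤ 64 * (q + 1) ^ 2 * (q + 1) ^ 2 * (q + 1) := by gcongr; lia
      _ = 64 * (q + 1) ^ 5 := by ring
      _ ≤ n := hn
  rcases hq.eq_or_lt with rfl | hq3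
  -- Two thick edges at `v` would give two triangles sharing only `v`. So thick edges form a
  -- matching, and removing them leaves a triangle-free graph whose degrees drop by at most one.
  · have hpair : ∀ v a a', G.IsThick v a → G.IsThick v a' → a = a' := by
      intro v a a' h1 h2
      by_contra hne
      obtain ⟨x, hx, hxn⟩ := exists_mem_notMem_of_card_lt_card
        (show #{a'} < #(G.commonNbr v a) by rw [card_singleton]; have := h1.2; lia)
      obtain ⟨x', hx', hxn'⟩ := exists_mem_notMem_of_card_lt_card
        (show #{a, x} < #(G.commonNbr v a') by
          have : #{a, x} ≤ 2 := card_le_two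
          have := h2.2; lia)
      rw [mem_commonNbr] at hx hx'
      simp only [mem_insert, mem_singleton, not_or] at hxn hxn'
      have t1 := is3Clique_triple_iff.2 ⟨h1.1, hx.1, hx.2⟩
      have t2 := is3Clique_triple_iff.2 ⟨h2.1, hx'.1, hx'.2⟩
      obtain ⟨A, p, hA⟩ := hasCliquePath_two (p := v) (by lia) t1.1 t2.1 t1.2 t2.2 (by simp)
        (by simp) (by
          intro y hy hy'
          simp only [mem_insert, mem_singleton] at hy hy'
          rcases hy with rfl | rfl | rfl
          · rfl
          · rcases hy' with h | h | h
            · exact h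
            · exact absurd h hne
            · exact absurd h.symm hxn'.1
          · rcases hy' with h | h | h
            · exact h
            · exact absurd h hxn
            · exact absurd h.symm hxn'.2)
      exact hfree A p hA
    obtain ⟨H, hH⟩ : ∃ H : SimpleGraph V, ∀ x y, H.Adj x y ↔ G.Adj x y ∧ ¬ G.IsThick x y :=
      ⟨{ Adj := fun x y => G.Adj x y ∧ ¬ G.IsThick x y
         symm := ⟨fun x y h => ⟨h.1.symm, fun h' => h.2 h'.symm⟩⟩
         loopless := ⟨fun x h => h.1.ne rfl⟩ }, fun _ _ => Iff.rfl⟩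
    have hF : ∀ x, #{y | G.IsThick x y} ≤ 1 := fun x => card_le_one.2 fun y hy z hz =>
      hpair x y z (mem_filter.1 hy).2 (mem_filter.1 hz).2
    obtain ⟨c, hc⟩ := exists_coloring_of_lt le_rfl H univ
      (card_pos.1 (by rw [card_univ]; lia))
      (fun K hK hKc _ => by
        obtain ⟨x, y, v, hxy, hxv, hyv, rfl⟩ := card_eq_three.1 hKc
        have a1 := hK (by simp : x ∈ _) (by simp : y ∈ _) hxy
        have a2 := hK (by simp : x ∈ _) (by simp : v ∈ _) hxv
        have a3 := hK (by simp : y ∈ _) (by simp : v ∈ _) hyv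
        rw [hH] at a1 a2 a3
        rcases h.exists_isThick a1.1 a2.1 a3.1 with h | h | h
        · exact a1.2 h
        · exact a2.2 h
        · exact a3.2 h)
      (fun x _ => by
        have a1 := card_adj_add_card_nonNbr G x
        have a2 := h.card_nonNbr_le x
        have a3 := card_union_le ({y | H.Adj x y} : Finset V) {y | G.IsThick x y}
        have a4 : #{y | G.Adj x y} ≤ #(({y | H.Adj x y} : Finset V) ∪ ({y | G.IsThick x y} : Finset V)) :=
          card_le_card fun y hy => by
            have := (mem_filter.1 hy).2
            simp only [mem_union, mem_filter, mem_univ, true_and, hH]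
            tauto
        have a5 := hF x
        rw [card_univ]
        lia)
    refine ⟨∅, c, by simp, fun v _ => (card_le_card fun y hy => ?_).trans (hF v)⟩
    simp only [mem_filter, mem_univ, true_and] at hy ⊢
    by_contra hne
    exact hc v (mem_univ _) y (mem_univ _) ((hH _ _).2 ⟨hy.2.1, hne⟩) hy.2.2
  · have hn₃ : 16000 * (q + 1) ≤ n := by
      have hr2' : 16 ≤ (q + 1) ^ 2 := by nlinarith
      calc 16000 * (q + 1) ≤ 64 * (16 * 16) * (q + 1) := by gcongr; lia
        _ ≤ 64 * ((q + 1) ^ 2 * (q + 1) ^ 2) * (q + 1) := by gcongr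
        _ = 64 * (q + 1) ^ 5 := by ring
        _ ≤ n := hn
    obtain ⟨U, hUc, hU⟩ := h.exists_hitting hq3 (k := 2) (by lia) hfree (by lia) (by lia)
    have hUn : #Uᶜ + #U = n := by
      rw [card_compl]; have := card_le_univ U; lia
    obtain ⟨c, hc⟩ := exists_coloring_of_lt hq G Uᶜ (card_pos.1 (by lia))
      (fun K hK hKc hKU => hU K ⟨hK, hKc⟩ (Finset.disjoint_left.2 fun x hx =>
        mem_compl.1 (hKU hx)))
      (fun x _ => by
        have a1 := h.le_card_adj_add x Uᶜ
        obtain ⟨d, rfl⟩ : ∃ d, q = d + 2 := ⟨q - 2, by lia⟩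
        rw [show 3 * (d + 2) - 4 = 3 * d + 2 by lia, show 3 * (d + 2) - 1 = 3 * d + 5 by lia]
        have a2 : (d + 2) * ((3 * d + 5) * m) < (d + 2) * (3 * #Uᶜ) := by nlinarith
        have a3 := Nat.lt_of_mul_lt_mul_left a2
        have a4 := Nat.mul_le_mul_left (3 * d + 5) a1
        nlinarith)
    refine ⟨U, c, by lia, fun v hv => ?_⟩
    rw [filter_false_of_mem]
    · simp
    · rintro y hy ⟨h1, h2⟩
      exact hc v (mem_compl.2 hv) y hy h1 h2

end

/-! ### Recolouring so that different colours are almost completely joined -/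

section

variable {V : Type*} [Fintype V] {G : SimpleGraph V} {q k m θ : ℕ} {K K₁ K₂ S U Z : Finset V}
  {p v w x y : V}

theorem cliqueFree_of_coloring {V : Type*} {G : SimpleGraph V} (c : V → Fin q)
    (hc : ∀ x y, G.Adj x y → c x ≠ c y) : G.CliqueFree (q + 1) := by
  have : G.Colorable q := ⟨Coloring.mk c fun {x y} h => hc x y h⟩
  exact this.cliqueFree (Nat.lt_succ_self q)

/-- All vertices can be coloured such that every vertex is adjacent to almost all vertices of the
other colours, where the colour classes are restricted to the complement of a small set. -/
theorem NearTuran.exists_coloring_card_not_adj_le (h : G.NearTuran q m)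
    (hn : 64 * (q + 1) ^ 5 ≤ Fintype.card V) (hfree : ∀ A p, ¬ G.HasCliquePath q 2 A p) :
    ∃ (c : V → Fin q) (C : Fin q → Finset V) (θ : ℕ), (∀ i, ∀ x ∈ C i, c x = i) ∧
      (∀ v i, i ≠ c v → #{x ∈ C i | ¬ G.Adj v x} ≤ θ) ∧
      ∀ i, (q + 2) * θ + 3 * (q + 1) < #(C i) := by
  have hq := h.two_le
  have hqm := h.mul_le
  have hmn := h.card_le
  obtain ⟨U, c, hUc, hc⟩ := h.exists_coloring hn hfree
  set n := Fintype.card V with hndef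
  obtain ⟨C, hC⟩ : ∃ C : Fin q → Finset V, ∀ i x, x ∈ C i ↔ x ∉ U ∧ c x = i :=
    ⟨fun i => {x ∈ Uᶜ | c x = i}, by simp⟩
  have hUn : #Uᶜ + #U = n := by
    rw [card_compl]; have := card_le_univ U; lia
  have hCle : ∀ i, #(C i) ≤ m + 1 := by
    intro i
    rcases (C i).eq_empty_or_nonempty with he | ⟨v, hv⟩
    · simp [he]
    · rw [hC] at hv
      have h1 : C i ⊆ G.nonNbr v ∪ {y ∈ Uᶜ | G.Adj v y ∧ c v = c y} := by
        intro x hx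
        rw [hC] at hx
        simp only [mem_union, mem_nonNbr, mem_filter, mem_compl]
        by_cases hvx : G.Adj v x
        · exact Or.inr ⟨hx.1, hvx, hv.2.trans hx.2.symm⟩
        · exact Or.inl hvx
      exact (card_le_card h1).trans ((card_union_le _ _).trans
        (Nat.add_le_add (h.card_nonNbr_le v) (hc v hv.1)))
  have hCge : ∀ i, m ≤ #(C i) + #U + 2 * q := by
    intro i
    have h1 : #Uᶜ = ∑ j, #(C j) := by
      rw [card_eq_sum_card_fiberwise (f := c) (t := univ) (fun x _ => mem_univ _)]
      refine sum_congr rfl fun j _ => ?_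
      congr 1; ext x; simp [hC]
    rw [← add_sum_erase _ _ (mem_univ i)] at h1
    have h2 : ∑ j ∈ univ.erase i, #(C j) ≤ (q - 1) * (m + 1) := by
      refine (sum_le_card_nsmul _ _ (m + 1) fun j _ => hCle j).trans ?_
      rw [card_erase_of_mem (mem_univ i), card_univ, Fintype.card_fin, smul_eq_mul]
    obtain ⟨d, rfl⟩ := Nat.exists_eq_add_of_le' (show 1 ≤ q by lia)
    rw [Nat.add_sub_cancel] at h2
    nlinarith
  -- Every class has about `m` vertices, and so does a non-neighbourhood at most: a vertex that
  -- misses nearly all of one class is adjacent to nearly all of every other.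
  have hsum : ∀ v i j, i ≠ j → #{x ∈ C i | ¬ G.Adj v x} + #(C j) ≤
      m + #{x ∈ C j | G.Adj v x} := by
    intro v i j hij
    have h1 := card_filter_add_card_filter_not (s := C j) (fun x => G.Adj v x)
    have h2 : Disjoint {x ∈ C i | ¬ G.Adj v x} {x ∈ C j | ¬ G.Adj v x} := by
      rw [Finset.disjoint_left]
      intro x hx hx'
      rw [mem_filter, hC] at hx hx'
      exact hij (hx.1.2.symm.trans hx'.1.2)
    have h3 : #({x ∈ C i | ¬ G.Adj v x} ∪ {x ∈ C j | ¬ G.Adj v x}) ≤ m := by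
      refine (card_le_card fun x hx => ?_).trans (h.card_nonNbr_le v)
      simp only [mem_union, mem_filter] at hx
      rw [mem_nonNbr]; tauto
    rw [card_union_of_disjoint h2] at h3
    lia
  have hown : ∀ v ∉ U, #{x ∈ C (c v) | G.Adj v x} ≤ 1 := by
    intro v hv
    refine (card_le_card fun x hx => ?_).trans (hc v hv)
    rw [mem_filter, hC] at hx
    rw [mem_filter, mem_compl]
    exact ⟨hx.1.1, hx.2, hx.1.2.symm⟩
  obtain ⟨η, hη⟩ : ∃ η, η = #U + 2 * q + 1 := ⟨_, rfl⟩
  obtain ⟨τ, hτ⟩ : ∃ τ, τ = q * η + 2 * q + 2 := ⟨_, rfl⟩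
  have hcross : ∀ v ∉ U, ∀ i, i ≠ c v → #{x ∈ C i | ¬ G.Adj v x} ≤ η := by
    intro v hv i hi
    have h1 := hsum v i (c v) hi
    have h2 := hown v hv
    have h3 := hCge (c v)
    lia
  -- Vertices of `U` get a new colour, that of a class they hardly meet. If there were none, `w`
  -- would extend greedily, through one neighbour in each class, to two cliques sharing only `w`;
  -- the value of `τ` leaves room for both.
  have hlight : ∀ w, ∃ i, #{x ∈ C i | G.Adj w x} ≤ τ ∧ (w ∉ U → i = c w) := by
    intro w
    by_cases hw : w ∈ U
    · by_contra! hcon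
      have hbig : ∀ i, τ < #{x ∈ C i | G.Adj w x} := by
        intro i
        by_contra! hle
        exact (hcon i hle).1 hw
      have hext : ∀ Z : Finset V, #Z ≤ q → ∃ Q : Finset V, #Q = q ∧ Disjoint Q Z ∧
          G.IsClique Q ∧ ∀ x ∈ Q, G.Adj w x := by
        intro Z hZ
        obtain ⟨Q, h1, h2, -, h3, h4⟩ := exists_clique_extension (G := G) (K := ∅) (Z := Z) (θ := η)
          (C := fun i => {x ∈ C i | G.Adj w x}) (by simp) univ (by simp)
          (fun i _ j _ hij u hu => by
            rw [mem_filter, hC] at hu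
            refine le_trans (card_le_card ?_) (hcross u hu.1.1 j (by rw [hu.1.2]; exact hij.symm))
            exact filter_subset_filter _ (filter_subset _ _))
          (fun i _ => by
            have := hbig i
            rw [card_empty, card_univ, Fintype.card_fin, Nat.zero_add]
            lia)
        refine ⟨Q, by rw [h1, card_univ, Fintype.card_fin], h2, by simpa using h3, fun x hx => ?_⟩
        obtain ⟨i, -, hi⟩ := h4 x hx
        exact (mem_filter.1 hi).2
      obtain ⟨Q₁, a1, -, a3, a4⟩ := hext ∅ (by simp)
      obtain ⟨Q₂, b1, b2, b3, b4⟩ := hext Q₁ a1.le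
      have hw₁ : w ∉ Q₁ := fun h => (a4 w h).ne rfl
      have hw₂ : w ∉ Q₂ := fun h => (b4 w h).ne rfl
      obtain ⟨A, x, hA⟩ := hasCliquePath_two (G := G) (q := q) (p := w) (T₁ := insert w Q₁)
        (T₂ := insert w Q₂) (by lia)
        (by rw [coe_insert, isClique_insert]; exact ⟨a3, fun x hx _ => a4 x hx⟩)
        (by rw [coe_insert, isClique_insert]; exact ⟨b3, fun x hx _ => b4 x hx⟩)
        (by rw [card_insert_of_notMem hw₁, a1]) (by rw [card_insert_of_notMem hw₂, b1])
        (by simp) (by simp) (by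
          intro x hx hx'
          rw [mem_insert] at hx hx'
          rcases hx with hx | hx
          · exact hx
          · rcases hx' with hx' | hx'
            · exact hx'
            · exact absurd hx (Finset.disjoint_left.1 b2 hx'))
      exact hfree A x hA
    · exact ⟨c w, by have := hown w hw; lia, fun _ => rfl⟩
  choose c' hc' hc'U using hlight
  refine ⟨c', C, τ + #U + 2 * q, ?_, ?_, ?_⟩
  · intro i x hx
    rw [hC] at hx
    rw [hc'U x hx.1, hx.2]
  · intro v i hi
    have h1 := hsum v i (c' v) hi
    have h2 := hc' v
    have h3 := hCge (c' v)
    lia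
  · intro i
    have h1 := hCge i
    obtain ⟨r, hr⟩ : ∃ r, r = q + 1 := ⟨_, rfl⟩
    rw [← hr] at hn hUc ⊢
    have hr3 : 3 ≤ r := by lia
    have h2 : η ≤ 42 * r := by lia
    have h3 : τ ≤ 42 * r ^ 2 := by
      rw [hτ]
      calc q * η + 2 * q + 2 ≤ q * (42 * r) + 42 * r := by
            have := Nat.mul_le_mul_left q h2
            lia
        _ = 42 * r ^ 2 := by rw [hr]; ring
    have hrr : 3 * r ≤ r ^ 2 := by nlinarith
    have hrrr : 3 * r ^ 2 ≤ r ^ 3 := by nlinarith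
    have h4 : (q + 2) * (τ + #U + 2 * q) + 3 * r + #U + 2 * q < 64 * r ^ 4 := by
      calc (q + 2) * (τ + #U + 2 * q) + 3 * r + #U + 2 * q
          ≤ (r + 1) * (42 * r ^ 2 + 42 * r) + 45 * r := by
            have : (q + 2) * (τ + #U + 2 * q) ≤ (r + 1) * (42 * r ^ 2 + 42 * r) :=
              Nat.mul_le_mul (by lia) (by lia)
            lia
        _ < 64 * (3 * r ^ 3) := by nlinarith
        _ ≤ 64 * (r * r ^ 3) := by gcongr
        _ = 64 * r ^ 4 := by ring
    have h5 : 64 * r ^ 4 ≤ m := by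
      have h6 : q * (64 * r ^ 4) ≤ q * m := by
        calc q * (64 * r ^ 4) ≤ r * (64 * r ^ 4) := Nat.mul_le_mul_right _ (by lia)
          _ = 64 * r ^ 5 := by ring
          _ ≤ q * m := hn.trans hmn
      exact Nat.le_of_mul_le_mul_left h6 (by lia)
    lia

end

/-! ### The single monochromatic edge -/

section

variable {V : Type*} [Fintype V] {G : SimpleGraph V} {q k m θ : ℕ} {K K₁ K₂ S U Z : Finset V}
  {p v w x y : V}

/-- A graph of large minimum degree with more edges than the Turán graph and without two cliques
sharing a vertex has an edge that lies in all `(q + 1)`-cliques. -/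
theorem NearTuran.exists_deleteEdges_cliqueFree (h : G.NearTuran q m)
    (hn : 64 * (q + 1) ^ 5 ≤ Fintype.card V) (hfree : ∀ A p, ¬ G.HasCliquePath q 2 A p)
    (he : (turanGraph (Fintype.card V) q).edgeSet.ncard < G.edgeSet.ncard) :
    ∃ a b, G.Adj a b ∧ (G.deleteEdges {s(a, b)}).CliqueFree (q + 1) := by
  have hq := h.two_le
  obtain ⟨c, C, θ, hCc, hcross, hbig⟩ := h.exists_coloring_card_not_adj_le hn hfree
  -- Partial cliques meeting only in `p` are completed by one vertex from each class in `J₁`, `J₂`,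
  -- which contradicts `hfree`.
  have hembed : ∀ p (K₁ K₂ : Finset V) (J₁ J₂ : Finset (Fin q)), G.IsClique K₁ → G.IsClique K₂ →
      p ∈ K₁ → p ∈ K₂ → (∀ x ∈ K₁, x ∈ K₂ → x = p) → #K₁ + #J₁ = q + 1 → #K₂ + #J₂ = q + 1 →
      (∀ u ∈ K₁, c u ∉ J₁) → (∀ u ∈ K₂, c u ∉ J₂) → False := by
    intro p K₁ K₂ J₁ J₂ hK₁ hK₂ hp₁ hp₂ hK hc₁ hc₂ hJ₁ hJ₂
    have hext : ∀ (K Z : Finset V) (J : Finset (Fin q)), G.IsClique K → #K + #J = q + 1 →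
        (∀ u ∈ K, c u ∉ J) → #Z ≤ q + 1 → ∃ Q : Finset V, #Q = #J ∧ Disjoint Q Z ∧ Disjoint Q K ∧
          G.IsClique (K ∪ Q : Finset V) := by
      intro K Z J hK hc hJ hZ
      obtain ⟨Q, h1, h2, h3, h4, -⟩ := exists_clique_extension (G := G) (C := C) (θ := θ) (Z := Z)
        hK J (fun u hu i hi => hcross u i fun h => hJ u hu (h ▸ hi))
        (fun i _ j _ hij u hu => hcross u j (by rw [hCc i u hu]; exact hij.symm))
        (fun i _ => by
          have := hbig i
          rw [hc]
          nlinarith)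
      exact ⟨Q, h1, h2, h3, h4⟩
    obtain ⟨Q₁, a1, a2, a3, a4⟩ := hext K₁ K₂ J₁ hK₁ hc₁ hJ₁ (by lia)
    have hT₁ : #(K₁ ∪ Q₁) = q + 1 := by rw [card_union_of_disjoint a3.symm, a1, hc₁]
    obtain ⟨Q₂, b1, b2, b3, b4⟩ := hext K₂ (K₁ ∪ Q₁) J₂ hK₂ hc₂ hJ₂ hT₁.le
    have hT₂ : #(K₂ ∪ Q₂) = q + 1 := by rw [card_union_of_disjoint b3.symm, b1, hc₂]
    obtain ⟨A, x, hA⟩ := hasCliquePath_two (p := p) (by lia) a4 b4 hT₁ hT₂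
      (mem_union_left _ hp₁) (mem_union_left _ hp₂) (by
        intro x hx hx'
        rcases mem_union.1 hx' with hx' | hx'
        · rcases mem_union.1 hx with hx | hx
          · exact hK x hx hx'
          · exact absurd hx' (Finset.disjoint_left.1 a2 hx)
        · exact absurd hx (Finset.disjoint_left.1 b2 hx'))
    exact hfree A x hA
  -- The monochromatic edges. The aim is that there is exactly one.
  obtain ⟨B, hB⟩ : ∃ B : V → V → Prop, ∀ a b, B a b ↔ G.Adj a b ∧ c a = c b :=
    ⟨_, fun _ _ => Iff.rfl⟩
  have hBs : ∀ {a b}, B a b → B b a := fun {a b} h => by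
    rw [hB] at h ⊢; exact ⟨h.1.symm, h.2.symm⟩
  have hBadj : ∀ {a b}, B a b → G.Adj a b := fun h => ((hB _ _).1 h).1
  have hBc : ∀ {a b}, B a b → c a = c b := fun h => ((hB _ _).1 h).2
  have hshare : ∀ {a b b'}, B a b → B a b' → b = b' := by
    intro a b b' h1 h2
    by_contra hne
    have ha := hBadj h1
    have ha' := hBadj h2
    refine hembed a {a, b} {a, b'} (univ.erase (c a)) (univ.erase (c a)) (by simp [ha])
      (by simp [ha']) (by simp) (by simp) ?_ ?_ ?_ ?_ ?_
    · intro x hx hx'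
      simp only [mem_insert, mem_singleton] at hx hx'
      rcases hx with hx | hx
      · exact hx
      · rcases hx' with hx' | hx'
        · exact hx'
        · exact absurd (hx.symm.trans hx') hne
    · rw [card_pair ha.ne, card_erase_of_mem (mem_univ _), card_univ, Fintype.card_fin]; lia
    · rw [card_pair ha'.ne, card_erase_of_mem (mem_univ _), card_univ, Fintype.card_fin]; lia
    · intro u hu
      rw [mem_insert, mem_singleton] at hu
      rcases hu with rfl | rfl
      · simp
      · simp [hBc h1]
    · intro u hu
      rw [mem_insert, mem_singleton] at hu
      rcases hu with rfl | rfl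
      · simp
      · simp [hBc h2]
  have htriple : ∀ {a b p}, B a b → G.Adj a p → G.Adj b p →
      G.IsClique ({a, b, p} : Finset V) ∧ #{a, b, p} = 3 := by
    intro a b p h1 h2 h3
    have := is3Clique_triple_iff.2 ⟨hBadj h1, h2, h3⟩
    exact ⟨this.1, this.2⟩
  have hdisj : ∀ {a b a' b'}, B a b → B a' b' → a ≠ a' → a ≠ b' → b ≠ a' → b ≠ b' →
      ∀ l, l ≠ c a → l ≠ c a' → False := by
    intro a b a' b' h1 h2 n1 n2 n3 n4 l hl hl'
    -- A vertex `p` of the free colour `l`, adjacent to all four ends, closes both edges to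
    -- triangles sharing only `p`.
    obtain ⟨p, hp, hpn⟩ := exists_mem_notMem_of_card_lt_card (s := ({a, b, a', b'} : Finset V).biUnion
      (fun u => {x ∈ C l | ¬ G.Adj u x})) (t := C l) (by
        refine lt_of_le_of_lt (card_biUnion_le_card_mul _ _ θ fun u hu => hcross u l ?_) ?_
        · simp only [mem_insert, mem_singleton] at hu
          rcases hu with rfl | rfl | rfl | rfl
          · exact hl
          · rwa [← hBc h1]
          · exact hl'
          · rwa [← hBc h2]
        · have : #{a, b, a', b'} ≤ 4 := card_le_four
          have := hbig l
          nlinarith)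
    simp only [mem_biUnion, mem_filter, not_exists, not_and, not_not] at hpn
    have q1 := hpn a (by simp) hp
    have q2 := hpn b (by simp) hp
    have q3 := hpn a' (by simp) hp
    have q4 := hpn b' (by simp) hp
    have t1 := htriple h1 q1 q2
    have t2 := htriple h2 q3 q4
    have hcard : ∀ j : Fin q, l ≠ j → 3 + #(univ \ {j, l}) = q + 1 := by
      intro j hj
      rw [card_sdiff_of_subset (subset_univ _), card_pair hj.symm, card_univ, Fintype.card_fin]
      lia
    refine hembed p {a, b, p} {a', b', p} (univ \ {c a, l}) (univ \ {c a', l}) t1.1 t2.1 (by simp)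
      (by simp) ?_ (by rw [t1.2, hcard _ hl]) (by rw [t2.2, hcard _ hl']) ?_ ?_
    · intro x hx hx'
      simp only [mem_insert, mem_singleton] at hx hx'
      rcases hx with rfl | rfl | rfl
      · rcases hx' with h | h | h
        · exact absurd h n1
        · exact absurd h n2
        · exact h
      · rcases hx' with h | h | h
        · exact absurd h n3
        · exact absurd h n4
        · exact h
      · rfl
    · intro u hu
      simp only [mem_insert, mem_singleton] at hu
      rcases hu with rfl | rfl | rfl
      · simp
      · simp [hBc h1]
      · simp [hCc l u hp]
    · intro u hu
      simp only [mem_insert, mem_singleton] at hu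
      rcases hu with rfl | rfl | rfl
      · simp
      · simp [hBc h2]
      · simp [hCc l u hp]
  have hne4 : ∀ {a b a' b'}, B a b → B a' b' → s(a, b) ≠ s(a', b') →
      a ≠ a' ∧ a ≠ b' ∧ b ≠ a' ∧ b ≠ b' := by
    intro a b a' b' h1 h2 hne
    refine ⟨?_, ?_, ?_, ?_⟩ <;> rintro rfl
    · exact hne (by rw [hshare h1 h2])
    · exact hne (by rw [hshare h1 (hBs h2), Sym2.eq_swap])
    · exact hne (by rw [hshare (hBs h1) h2, Sym2.eq_swap])
    · exact hne (by rw [hshare (hBs h1) (hBs h2)])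
  have hsame : ∀ {a b a' b'}, B a b → B a' b' → c a = c a' → s(a, b) = s(a', b') := by
    intro a b a' b' h1 h2 hc
    by_contra hne
    obtain ⟨n1, n2, n3, n4⟩ := hne4 h1 h2 hne
    have : Nontrivial (Fin q) := Fin.nontrivial_iff_two_le.2 hq
    obtain ⟨l, hl⟩ := exists_ne (c a)
    exact hdisj h1 h2 n1 n2 n3 n4 l hl (hc ▸ hl)
  have huniq : ∀ {a b a' b'}, B a b → B a' b' → s(a, b) = s(a', b') := by
    intro a b a' b' h1 h2
    by_contra hne
    obtain ⟨n1, n2, n3, n4⟩ := hne4 h1 h2 hne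
    have hcne : c a ≠ c a' := fun h => hne (hsame h1 h2 h)
    rcases hq.eq_or_lt with rfl | hq3
    swap
    · obtain ⟨l, hl⟩ : ∃ l : Fin q, l ∉ ({c a, c a'} : Finset (Fin q)) := by
        by_contra! hall
        have h3 := card_le_card (s := univ) (fun l _ => hall l)
        have h4 : #{c a, c a'} ≤ 2 := card_le_two
        rw [card_univ, Fintype.card_fin] at h3
        lia
      rw [mem_insert, mem_singleton, not_or] at hl
      exact hdisj h1 h2 n1 n2 n3 n4 l hl.1 hl.2
    have hcol : ∀ i : Fin 2, i = c a ∨ i = c a' := by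
      intro i
      have := Fin.val_ne_of_ne hcne
      rw [Fin.ext_iff, Fin.ext_iff]
      lia
    -- For `q = 2` no third colour is left. But if `u` were adjacent to both `a` and `b`, the
    -- triangle `a b u` and a triangle on `u u'` with third vertex of colour `c a` would share only
    -- `u`.
    have hmiss : ∀ {u u'}, B u u' → c u = c a' → a ≠ u' → b ≠ u' → ∃ z, (z = a ∨ z = b) ∧
        ¬ G.Adj u z := by
      intro u u' hu hcu n2 n4
      by_contra! hcon
      have t1 := htriple h1 (hcon a (Or.inl rfl)).symm (hcon b (Or.inr rfl)).symm
      refine hembed u {a, b, u} {u, u'} ∅ {c a} t1.1 (by simp [hBadj hu]) (by simp) (by simp) ?_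
        (by rw [t1.2, card_empty]) (by rw [card_pair (hBadj hu).ne, card_singleton]) (by simp) ?_
      · intro x hx hx'
        simp only [mem_insert, mem_singleton] at hx hx'
        rcases hx' with hx' | hx'
        · exact hx'
        · subst hx'
          rcases hx with h | h | h
          · exact absurd h.symm n2
          · exact absurd h.symm n4
          · exact h
      · intro v hv
        simp only [mem_insert, mem_singleton] at hv ⊢
        rcases hv with rfl | rfl
        · rw [hcu]; exact hcne.symm
        · rw [← hBc hu, hcu]; exact hcne.symm
    obtain ⟨z, hz, hza⟩ := hmiss h2 rfl n2 n4
    obtain ⟨z', hz', hzb⟩ := hmiss (hBs h2) (hBc h2).symm n1 n3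
    have hcz : c z = c a := by rcases hz with rfl | rfl; exacts [rfl, (hBc h1).symm]
    have hcz' : c z' = c a := by rcases hz' with rfl | rfl; exacts [rfl, (hBc h1).symm]
    have hnz : a' ≠ z := fun h => hcne (by rw [← hcz, ← h])
    have hnz' : b' ≠ z' := fun h => hcne (by rw [← hcz', ← h, hBc h2])
    -- Exchanging the two monochromatic edges for the two missing edges between the colours gives a
    -- bipartite graph with as many edges as `G`, more than Turán's theorem allows.
    obtain ⟨G', hG'⟩ : ∃ G' : SimpleGraph V, G' =
      G.deleteEdges {s(a, b), s(a', b')} ⊔ edge a' z ⊔ edge b' z' := ⟨_, rfl⟩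
    have hcf : G'.CliqueFree (2 + 1) := by
      refine cliqueFree_of_coloring c fun x y hxy => ?_
      rw [hG', sup_adj, sup_adj, deleteEdges_adj, edge_adj, edge_adj] at hxy
      rcases hxy with (⟨hxy, hn⟩ | ⟨h | h, -⟩) | ⟨h | h, -⟩
      · intro hcxy
        have hBxy := (hB _ _).2 ⟨hxy, hcxy⟩
        apply hn
        rcases hcol (c x) with hx | hx
        · rw [hsame hBxy h1 hx]; simp
        · rw [hsame hBxy h2 hx]; simp
      · rw [h.1, h.2, hcz]; exact hcne.symm
      · rw [h.1, h.2, hcz]; exact hcne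
      · rw [h.1, h.2, hcz', ← hBc h2]; exact hcne.symm
      · rw [h.1, h.2, hcz', ← hBc h2]; exact hcne
    have h3 := (hcf.ncard_edgeSet_le (by lia)).1
    have h4 : G'.edgeSet = insert s(b', z') (insert s(a', z) (G.edgeSet \ {s(a, b), s(a', b')})) := by
      rw [hG', edgeSet_sup, edgeSet_sup, edgeSet_deleteEdges, edgeSet_edge_of_ne hnz,
        edgeSet_edge_of_ne hnz', Set.union_singleton, Set.union_singleton]
    have h5 : G'.edgeSet.ncard = G.edgeSet.ncard := by
      have e1 : s(a', z) ∉ G.edgeSet := hza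
      have e2 : s(b', z') ∉ G.edgeSet := hzb
      have e3 : s(b', z') ≠ s(a', z) := by
        rw [Ne, Sym2.eq_iff, not_or]
        refine ⟨fun h => (hBadj h2).ne h.1.symm, fun h => ?_⟩
        exact hcne (by rw [← hcz, ← h.1, hBc h2])
      have e4 : ({s(a, b), s(a', b')} : Set (Sym2 V)) ⊆ G.edgeSet := by
        intro e he
        rcases he with rfl | rfl
        · exact hBadj h1
        · exact hBadj h2
      rw [h4, Set.ncard_insert_of_notMem _ (Set.toFinite _),
        Set.ncard_insert_of_notMem _ (Set.toFinite _), Set.ncard_sdiff e4 (Set.toFinite _),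
        Set.ncard_pair hne]
      · have e5 := Set.ncard_le_ncard e4 (Set.toFinite _)
        rw [Set.ncard_pair hne] at e5
        lia
      · exact fun h => e1 h.1
      · rintro (h | h)
        · exact e3 h
        · exact e2 h.1
    lia
  have hex : ∃ a b, B a b := by
    by_contra! hcon
    have : G.CliqueFree (q + 1) := cliqueFree_of_coloring c fun x y hxy hc =>
      hcon x y ((hB _ _).2 ⟨hxy, hc⟩)
    have := (this.ncard_edgeSet_le (by lia)).1
    lia
  obtain ⟨a, b, hab⟩ := hex
  refine ⟨a, b, hBadj hab, cliqueFree_of_coloring c fun x y hxy hc => ?_⟩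
  rw [deleteEdges_adj] at hxy
  exact hxy.2 (huniq ((hB _ _).2 ⟨hxy.1, hc⟩) hab)

end

/-! ### Attaching cliques to a chain of vertices of large degree -/

section

variable {V : Type*} [Fintype V] {G : SimpleGraph V} {q l k m E : ℕ} {A K Z Q T T₁ T₂ : Finset V}
  {p v w x y y₁ y₂ : V}

/-- A clique-path whose end is adjacent to a vertex of large degree can be extended by two cliques
for each vertex of large degree. -/
theorem NearTuran.exists_extend_list (h : G.NearTuran q m) {L : List V}
    (hA : G.HasCliquePath q l A y) (hl : l ≤ 2) (hL : ∀ v ∈ w :: L, #(G.nonNbr v) + E ≤ m)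
    (hnd : (w :: L).Nodup) (hE : (2 * L.length + 6) * (q + 1) ≤ E)
    (hLA : ∀ v ∈ w :: L, v ∉ A) (hyw : G.Adj y w) :
    ∃ A p, G.HasCliquePath q (l + 2 * L.length + 2) A p := by
  have hq := h.two_le
  have h2m := h.two_mul_le
  have hZ : #(w :: L).toFinset ≤ L.length + 1 := List.toFinset_card_le _
  have hw := hL w (by simp)
  have hlq : l * q ≤ 2 * q := Nat.mul_le_mul_right _ hl
  obtain ⟨A₁, h1, hz₁⟩ := h.step (Z := (w :: L).toFinset) (E := E)
    hA hyw (hLA w (by simp)) (Or.inr hw) (by rw [hA.card]; nlinarith)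
  have hL2 : ∀ v ∈ L, v ∉ A₁ ∧ v ∈ (w :: L).toFinset := by
    intro v hv
    have hvZ : v ∈ (w :: L).toFinset := by simp [hv]
    refine ⟨fun hvA => ?_, hvZ⟩
    rcases hz₁ v hvA with h | h | h
    · exact hLA v (by simp [hv]) h
    · exact (List.nodup_cons.1 hnd).1 (h ▸ hv)
    · exact h hvZ
  obtain ⟨A₃, h3, -⟩ := h.chain (Z := (w :: L).toFinset) (E := E) L h1 hw
    (fun v hv => hL v (by simp [hv])) (List.nodup_cons.1 hnd).2 hL2
    (by rw [h1.card]; nlinarith)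
  set u := (w :: L).getLast (by simp) with hu
  have hur := hL u (List.getLast_mem _)
  obtain ⟨y', hyA, hy'⟩ := exists_forall_adj_of_sum_lt (G := G) (K := {u}) (Z := A₃)
    (by rw [sum_singleton, h3.card]; nlinarith)
  obtain ⟨A₄, h4, -⟩ := h.step (Z := ∅) (E := E) h3 (hy' u (by simp)) hyA (Or.inl hur)
    (by rw [h3.card, card_empty]; nlinarith)
  exact ⟨A₄, y', by convert h4 using 1; lia⟩

/-- The vertices of `T` have at most `(q + 1) * m` non-adjacencies in total, so at most `(q + 1) * m
/ 2` vertices miss two of them. This is at most about `3 * n / 4`, leaving a margin over the `n / 6`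
non-neighbours of `w`. -/
theorem NearTuran.exists_card_not_adj_le_one (h : G.NearTuran q m) (hT : #T = q + 1)
    (hw : 6 * #(G.nonNbr w) ≤ Fintype.card V) (hZ : 12 * #Z + 6 * q ≤ Fintype.card V) :
    ∃ y ∉ Z, G.Adj y w ∧ #{u ∈ T | ¬ G.Adj u y} ≤ 1 := by
  have h1 := h.sum_card_not_adj_le univ T
  have h2 : #({x | 2 ≤ #{u ∈ T | ¬ G.Adj u x}} : Finset V) * 2 ≤
      ∑ x, #{u ∈ T | ¬ G.Adj u x} := by
    refine le_trans ?_ (sum_le_sum_of_subset (filter_subset (fun x => 2 ≤ #{u ∈ T | ¬ G.Adj u x}) _))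
    exact (card_nsmul_le_sum _ _ 2 fun x hx => (mem_filter.1 hx).2)
  have h3 := h.mul_le
  have h4 := h.two_mul_le
  rw [hT, add_mul, one_mul] at h1
  obtain ⟨y, hyZ, hy⟩ := exists_forall_adj_of_sum_lt (G := G) (K := {w})
    (Z := Z ∪ ({x | 2 ≤ #{u ∈ T | ¬ G.Adj u x}} : Finset V)) (by
      rw [sum_singleton]
      have := card_union_le Z ({x | 2 ≤ #{u ∈ T | ¬ G.Adj u x}} : Finset V)
      lia)
  simp only [mem_union, mem_filter, mem_univ, true_and, not_or, not_le] at hyZ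
  exact ⟨y, hyZ.1, (hy w (by simp)).symm, Nat.lt_succ_iff.1 hyZ.2⟩

theorem isClique_insert_erase {V : Type*} {G : SimpleGraph V} {T : Finset V} {u y : V}
    (hT : G.IsClique (T : Set V)) (hy : ∀ t ∈ T.erase u, G.Adj t y) :
    G.IsClique (insert y (T.erase u) : Finset V) := by
  rw [coe_insert, isClique_insert]
  exact ⟨hT.subset (by exact_mod_cast erase_subset _ _), fun b hb _ => (hy b hb).symm⟩

theorem card_insert_erase {V : Type*} {T : Finset V} {u y : V} (hc : #T = q + 1) (hu : u ∈ T)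
    (hy : y ∉ T) : #(insert y (T.erase u)) = q + 1 := by
  rw [card_insert_of_notMem fun h => hy (mem_of_mem_erase h), card_erase_of_mem hu, hc]
  rfl

/-- A clique and vertices of large degree outside of it yield a long clique-path. -/
theorem NearTuran.hasCliquePath_of_isClique (h : G.NearTuran q m) {L : List V}
    (hL : ∀ v ∈ w :: L, #(G.nonNbr v) + E ≤ m) (hnd : (w :: L).Nodup)
    (hE : (2 * L.length + 6) * (q + 1) ≤ E) (hw : 6 * #(G.nonNbr w) ≤ Fintype.card V)
    (hn : 12 * ((2 * L.length + 6) * (q + 1)) ≤ Fintype.card V)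
    (hT : G.IsClique (T : Set V)) (hc : #T = q + 1) (hLT : ∀ v ∈ w :: L, v ∉ T) :
    ∃ A p, G.HasCliquePath q (2 * L.length + 3) A p := by
  have hq := h.two_le
  have hZ : #(T ∪ (w :: L).toFinset) ≤ q + 1 + (L.length + 1) := by
    refine (card_union_le _ _).trans ?_
    rw [hc]
    exact Nat.add_le_add_left (List.toFinset_card_le _) _
  obtain ⟨y, hyZ, hyw, hy1⟩ := h.exists_card_not_adj_le_one (Z := T ∪ (w :: L).toFinset) hc hw
    (by nlinarith)
  rw [mem_union, not_or, List.mem_toFinset] at hyZ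
  -- Exchanging `u` for `y` turns `T` into a clique through a neighbour of `w`; if `y` misses
  -- nothing, any `u` will do.
  obtain ⟨u, huT, hu⟩ : ∃ u ∈ T, ∀ t ∈ T.erase u, G.Adj t y := by
    by_cases hex : ∃ u ∈ T, ¬ G.Adj u y
    · obtain ⟨u, hu, huy⟩ := hex
      refine ⟨u, hu, fun t ht => ?_⟩
      rw [mem_erase] at ht
      by_contra hty
      exact ht.1 (card_le_one.1 hy1 t (by simp [ht.2, hty]) u (by simp [hu, huy]))
    · push Not at hex
      obtain ⟨u, hu⟩ := card_pos.1 (by lia : 0 < #T)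
      exact ⟨u, hu, fun t ht => hex t (mem_of_mem_erase ht)⟩
  have hcp := (isClique_insert_erase hT hu).hasCliquePath_one (card_insert_erase hc huT hyZ.1)
    (mem_insert_self _ _) (by lia)
  obtain ⟨A, p, hA⟩ := h.exists_extend_list hcp (by lia) hL hnd hE (fun v hv => by
    rw [mem_insert, not_or]
    exact ⟨fun hvy => hyZ.2 (hvy ▸ hv), fun hvT => hLT v hv (mem_of_mem_erase hvT)⟩) hyw
  exact ⟨A, p, by convert hA using 1; lia⟩

/-- Two cliques sharing a vertex and vertices of large degree outside of them yield a long
clique-path. -/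
theorem NearTuran.hasCliquePath_of_hasCliquePath_two (h : G.NearTuran q m) {L : List V}
    (hL : ∀ v ∈ w :: L, #(G.nonNbr v) + E ≤ m) (hnd : (w :: L).Nodup)
    (hE : (2 * L.length + 6) * (q + 1) ≤ E)
    (hw : ∀ v ∈ w :: L, 6 * #(G.nonNbr v) ≤ Fintype.card V)
    (hn : 12 * ((2 * L.length + 6) * (q + 1)) ≤ Fintype.card V)
    (hA : G.HasCliquePath q 2 A x) (hLA : ∀ v ∈ w :: L, v ∉ A) :
    ∃ A p, G.HasCliquePath q (2 * L.length + 4) A p := by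
  have hq := h.two_le
  obtain ⟨T₁, p, Q, ⟨A', p', Q', hA', hd', hQ', hpQ', hcl', hT₁⟩, hd, hQ, -, hcl, rfl⟩ := hA
  rw [HasCliquePath] at hA'
  subst hA'
  rw [singleton_union] at hT₁
  rw [← hT₁] at hcl'
  have hc₁ : #T₁ = q + 1 := by
    rw [hT₁, card_insert_of_notMem (by simpa using hd'), hQ']
  have hp₁ : p ∈ T₁ := by rw [hT₁]; simp [hpQ']
  have hpQ : p ∉ Q := Finset.disjoint_left.1 hd hp₁
  obtain ⟨T₂, hT₂⟩ : ∃ T₂, T₂ = insert p Q := ⟨_, rfl⟩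
  rw [← hT₂] at hcl
  have hc₂ : #T₂ = q + 1 := by rw [hT₂, card_insert_of_notMem hpQ, hQ]
  have hp₂ : p ∈ T₂ := by rw [hT₂]; simp
  have hT₁₂ : ∀ x ∈ T₁, x ∈ T₂ → x = p := by
    intro x hx hx'
    rw [hT₂, mem_insert] at hx'
    exact hx'.resolve_right (Finset.disjoint_left.1 hd hx)
  have hLT : ∀ v ∈ w :: L, v ∉ T₁ ∧ v ∉ T₂ := by
    intro v hv
    have hv' := hLA v hv
    rw [mem_union, not_or] at hv'
    refine ⟨hv'.1, ?_⟩
    rw [hT₂, mem_insert, not_or]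
    exact ⟨fun hvp => hv'.1 (hvp ▸ hp₁), hv'.2⟩
  have hgood : ∀ T : Finset V, ∀ y, #{u ∈ T | ¬ G.Adj u y} ≤ 1 →
      (∃ u ∈ T, u ≠ p ∧ ∀ t ∈ T.erase u, G.Adj t y) ∨ (∀ t ∈ T.erase p, G.Adj t y) := by
    intro T y hy1
    by_cases hex : ∃ u ∈ T, u ≠ p ∧ ¬ G.Adj u y
    · obtain ⟨u, hu, hup, huy⟩ := hex
      refine Or.inl ⟨u, hu, hup, fun t ht => ?_⟩
      rw [mem_erase] at ht
      by_contra hty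
      exact ht.1 (card_le_one.1 hy1 t (by simp [ht.2, hty]) u (by simp [hu, huy]))
    · push Not at hex
      exact Or.inr fun t ht => hex t (mem_of_mem_erase ht) (ne_of_mem_erase ht)
  -- When `T₂` can exchange a vertex other than `p` for `y`, the two cliques still share exactly
  -- `p`, and the path of two cliques now ends next to the large vertex `w`.
  have hattach : ∀ (w : V) (L' : List V), L'.length = L.length →
      (∀ v ∈ w :: L', #(G.nonNbr v) + E ≤ m) → (w :: L').Nodup →
      ∀ T₁ T₂ : Finset V, G.IsClique (T₁ : Set V) → G.IsClique (T₂ : Set V) →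
      #T₁ = q + 1 → #T₂ = q + 1 → p ∈ T₁ → p ∈ T₂ → (∀ x ∈ T₁, x ∈ T₂ → x = p) →
      (∀ v ∈ w :: L', v ∉ T₁ ∧ v ∉ T₂) → ∀ y, y ∉ T₁ → y ∉ T₂ → y ∉ w :: L' → G.Adj y w →
      (∃ u ∈ T₂, u ≠ p ∧ ∀ t ∈ T₂.erase u, G.Adj t y) →
      ∃ A p, G.HasCliquePath q (2 * L.length + 4) A p := by
    intro w L' hlen hL hnd T₁ T₂ hcl₁ hcl₂ hc₁ hc₂ hp₁ hp₂ h12 hLT y hy₁ hy₂ hyL hyw ⟨u, hu, hup, huy⟩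
    have hpu : p ∈ insert y (T₂.erase u) := mem_insert_of_mem (mem_erase.2 ⟨hup.symm, hp₂⟩)
    have hyp : y ≠ p := fun hyp => hy₁ (hyp ▸ hp₁)
    have hcp := (hcl₁.hasCliquePath_one hc₁ hp₁ (by lia)).step (x := y)
      (Q := (insert y (T₂.erase u)).erase p) (by
        rw [Finset.disjoint_left]
        intro z hz hz'
        rw [mem_erase, mem_insert, mem_erase] at hz'
        rcases hz'.2 with hzy | hzT
        · exact hy₁ (hzy ▸ hz)
        · exact hz'.1 (h12 z hz hzT.2))
      (by rw [card_erase_of_mem hpu, card_insert_erase hc₂ hu hy₂]; rfl)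
      (mem_erase.2 ⟨hyp, mem_insert_self _ _⟩)
      (by rw [insert_erase hpu]; exact isClique_insert_erase hcl₂ huy)
    obtain ⟨A, p, hA⟩ := h.exists_extend_list hcp (by lia) hL hnd (by rwa [hlen])
      (fun v hv => by
      rw [mem_union, not_or, mem_erase, mem_insert, mem_erase]
      refine ⟨(hLT v hv).1, fun hv' => ?_⟩
      rcases hv'.2 with hvy | hvT
      · exact hyL (hvy ▸ hv)
      · exact (hLT v hv).2 hvT.2) hyw
    exact ⟨A, p, by convert hA using 1; lia⟩
  obtain ⟨Z, hZ⟩ : ∃ Z, Z = T₁ ∪ T₂ ∪ (w :: L).toFinset := ⟨_, rfl⟩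
  have hZc : #Z ≤ 2 * q + 2 + (L.length + 1) := by
    have h1 := card_union_le (T₁ ∪ T₂) (w :: L).toFinset
    have h2 := card_union_le T₁ T₂
    have h3 : #(w :: L).toFinset ≤ L.length + 1 := List.toFinset_card_le _
    rw [hZ]; lia
  have hmZ : ∀ y, y ∉ Z → y ∉ T₁ ∧ y ∉ T₂ ∧ y ∉ w :: L := by
    intro y hy
    rw [hZ, mem_union, mem_union, List.mem_toFinset] at hy
    exact ⟨fun h => hy (Or.inl (Or.inl h)), fun h => hy (Or.inl (Or.inr h)),
      fun h => hy (Or.inr h)⟩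
  have hLq : L.length * 1 ≤ L.length * q := Nat.mul_le_mul_left _ (by lia)
  obtain ⟨z₁, hz₁Z, hz₁w, hz₁⟩ := h.exists_card_not_adj_le_one (Z := Z) hc₁ (hw w (by simp))
    (by nlinarith)
  obtain ⟨z₃, hz₃Z, hz₃w, hz₃⟩ := h.exists_card_not_adj_le_one (Z := insert z₁ Z) hc₂
    (hw ((w :: L).getLast (by simp)) (List.getLast_mem _))
    (by have := card_insert_le z₁ Z; nlinarith)
  rw [mem_insert, not_or] at hz₃Z
  obtain ⟨a1, a2, a3⟩ := hmZ _ hz₁Z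
  obtain ⟨b1, b2, b3⟩ := hmZ _ hz₃Z.2
  rcases hgood T₁ z₁ hz₁ with hg₁ | hg₁
  · exact hattach w L rfl hL hnd T₂ T₁ hcl hcl' hc₂ hc₁ hp₂ hp₁ (fun x hx hx' => hT₁₂ x hx' hx)
      (fun v hv => (hLT v hv).symm) z₁ a2 a1 a3 hz₁w hg₁
  rcases hgood T₂ z₃ hz₃ with hg₃ | hg₃
  -- `z₃` is adjacent to the last large vertex, so the chain is run backwards.
  · obtain ⟨w', L', hrev⟩ : ∃ w' L', (w :: L).reverse = w' :: L' :=
      List.exists_cons_of_ne_nil (by simp)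
    have hlen : L'.length = L.length := by
      have := congrArg List.length hrev
      simpa using this.symm
    have hmem : ∀ v, v ∈ w' :: L' → v ∈ w :: L := fun v hv => by
      rwa [← hrev, List.mem_reverse] at hv
    have hlast : (w :: L).getLast (by simp) = w' := by
      have : w :: L = L'.reverse ++ [w'] := by
        rw [← List.reverse_cons, ← hrev, List.reverse_reverse]
      simp [this]
    rw [hlast] at hz₃w
    exact hattach w' L' hlen (fun v hv => hL v (hmem v hv))
      (by rw [← hrev]; exact List.nodup_reverse.2 hnd) T₁ T₂ hcl' hcl hc₁ hc₂ hp₁ hp₂ hT₁₂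
      (fun v hv => hLT v (hmem v hv)) z₃ b1 b2 (fun hb => b3 (hmem _ hb)) hz₃w hg₃
  -- Both exchanges remove `p`: the new cliques are disjoint and lie at opposite ends of the chain,
  -- with the same total number of cliques.
  refine h.bridge (T₁ := insert z₁ (T₁.erase p)) (T₂ := insert z₃ (T₂.erase p)) hL hnd hE
    (isClique_insert_erase hcl' hg₁) (card_insert_erase hc₁ hp₁ a1)
    (isClique_insert_erase hcl hg₃) (card_insert_erase hc₂ hp₂ b2) ?_ (fun v hv => ?_)
    (mem_insert_self _ _) (mem_insert_self _ _) hz₁w hz₃w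
  · rw [Finset.disjoint_left]
    intro z hz hz'
    rw [mem_insert, mem_erase] at hz hz'
    rcases hz with rfl | hz
    · rcases hz' with hz' | hz'
      · exact hz₃Z.1 hz'.symm
      · exact a2 hz'.2
    · rcases hz' with rfl | hz'
      · exact b1 hz.2
      · exact hz.1 (hT₁₂ z hz.2 hz'.2)
  · rw [mem_insert, mem_insert, mem_erase, mem_erase]
    exact ⟨fun hv' => hv'.elim (fun e => a3 (e ▸ hv)) fun e => (hLT v hv).1 e.2,
      fun hv' => hv'.elim (fun e => b3 (e ▸ hv)) fun e => (hLT v hv).2 e.2⟩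

end

/-! ### The extremal graphs under the degree condition -/

section

variable {V A B A' B' : Type*} {q l k m f : ℕ}

@[simp] theorem graphJoin_adj_inl_inl {G : SimpleGraph A} {H : SimpleGraph B} {a a' : A} :
    (graphJoin G H).Adj (Sum.inl a) (Sum.inl a') ↔ G.Adj a a' := by simp [graphJoin]

@[simp] theorem graphJoin_adj_inl_inr {G : SimpleGraph A} {H : SimpleGraph B} {a : A} {b : B} :
    (graphJoin G H).Adj (Sum.inl a) (Sum.inr b) := by simp [graphJoin]

@[simp] theorem graphJoin_adj_inr_inl {G : SimpleGraph A} {H : SimpleGraph B} {a : A} {b : B} :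
    (graphJoin G H).Adj (Sum.inr b) (Sum.inl a) := by simp [graphJoin]

@[simp] theorem graphJoin_adj_inr_inr {G : SimpleGraph A} {H : SimpleGraph B} {b b' : B} :
    (graphJoin G H).Adj (Sum.inr b) (Sum.inr b') ↔ H.Adj b b' := by simp [graphJoin]

/-- Isomorphisms of joins with complete graphs. -/
def graphJoinTopIso {H : SimpleGraph B} {H' : SimpleGraph B'} (e : A ≃ A') (φ : H ≃g H') :
    graphJoin (⊤ : SimpleGraph A) H ≃g graphJoin (⊤ : SimpleGraph A') H' where
  toEquiv := Equiv.sumCongr e φ.toEquiv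
  map_rel_iff' := by
    rintro (a | b) (a' | b')
    · simp
    · simp
    · simp
    · simpa using φ.map_adj_iff

theorem graphJoin_sup_edge (G : SimpleGraph A) (H : SimpleGraph B) (a b : B) :
    graphJoin G (H ⊔ edge a b) = graphJoin G H ⊔ edge (Sum.inr a) (Sum.inr b) := by
  ext (x | x) (y | y) <;> simp [edge_adj]

theorem Iso.ncard_edgeSet_eq {G : SimpleGraph A} {H : SimpleGraph B} (φ : G ≃g H) :
    G.edgeSet.ncard = H.edgeSet.ncard :=
  Nat.card_congr φ.mapEdgeSet

theorem two_mul_ncard_edgeSet_graphJoin_top [Fintype A] [Fintype B] (H : SimpleGraph B) :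
    2 * (graphJoin (⊤ : SimpleGraph A) H).edgeSet.ncard + Fintype.card A =
      Fintype.card A ^ 2 + 2 * (Fintype.card A * Fintype.card B) + 2 * H.edgeSet.ncard := by
  rw [← sum_card_adj_univ_eq, ← sum_card_adj_univ_eq, Fintype.sum_sum_type]
  have h1 : ∀ a : A, #{y | (graphJoin (⊤ : SimpleGraph A) H).Adj (Sum.inl a) y} + 1 =
      Fintype.card A + Fintype.card B := by
    intro a
    have : ({y | (graphJoin (⊤ : SimpleGraph A) H).Adj (Sum.inl a) y} : Finset (A ⊕ B)) =
        univ.erase (Sum.inl a) := by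
      ext (y | y) <;> simp [eq_comm]
    rw [this, card_erase_add_one (mem_univ _), card_univ, Fintype.card_sum]
  have h2 : ∀ b : B, #{y | (graphJoin (⊤ : SimpleGraph A) H).Adj (Sum.inr b) y} =
      Fintype.card A + #{y | H.Adj b y} := by
    intro b
    simp only [card_filter, Fintype.sum_sum_type]
    simp
  have h3 := sum_congr (rfl : (univ : Finset A) = univ) fun a _ => h1 a
  rw [sum_add_distrib, sum_const, sum_const, card_univ] at h3
  simp only [h2, sum_add_distrib, sum_const, card_univ, smul_eq_mul] at h3 ⊢
  linarith

/-- Making the vertices of a set universal does not decrease the number of edges, and changes it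
unless these vertices were universal before. -/
theorem ncard_edgeSet_le_graphJoin_induce [Finite V] (G : SimpleGraph V) (W : Finset V) :
    G.edgeSet.ncard ≤
      (graphJoin (⊤ : SimpleGraph {x // x ∈ W}) (G.induce {x | x ∉ W})).edgeSet.ncard ∧
    (G.edgeSet.ncard =
      (graphJoin (⊤ : SimpleGraph {x // x ∈ W}) (G.induce {x | x ∉ W})).edgeSet.ncard →
      Nonempty (G ≃g graphJoin (⊤ : SimpleGraph {x // x ∈ W}) (G.induce {x | x ∉ W}))) := by
  set J := graphJoin (⊤ : SimpleGraph {x // x ∈ W}) (G.induce {x | x ∉ W}) with hJ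
  let σ : {x // x ∈ W} ⊕ {x // x ∈ {x | x ∉ W}} ≃ V := Equiv.sumCompl (· ∈ W)
  let G' := G.comap σ
  have φ : G' ≃g G := Iso.comap σ G
  have hle : G' ≤ J := by
    rintro (x | x) (y | y) h
    · rw [hJ, graphJoin_adj_inl_inl, top_adj]
      rintro rfl
      exact h.ne rfl
    · exact graphJoin_adj_inl_inr
    · exact graphJoin_adj_inr_inl
    · rw [hJ, graphJoin_adj_inr_inr]
      exact h
  rw [← φ.ncard_edgeSet_eq]
  refine ⟨Set.ncard_le_ncard (edgeSet_mono hle) (Set.toFinite _), fun h => ?_⟩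
  have hG : G' = J := edgeSet_injective
    (Set.eq_of_subset_of_ncard_le (edgeSet_mono hle) h.ge (Set.toFinite _))
  exact ⟨φ.symm.trans (hG ▸ Iso.refl)⟩

theorem hasCliquePath_of_hasCliquePath_induce {G : SimpleGraph V} {W : Finset V}
    {A : Finset {x | x ∉ W}} {p : {x | x ∉ W}} (h : (G.induce {x | x ∉ W}).HasCliquePath q l A p) :
    G.HasCliquePath q l (A.image (↑)) p ∧ Disjoint (A.image (↑)) W := by
  refine ⟨h.map (Embedding.induce {x | x ∉ W}).toHom Subtype.val_injective, ?_⟩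
  rw [Finset.disjoint_left]
  intro x hx
  obtain ⟨y, -, rfl⟩ := mem_image.1 hx
  exact y.2

theorem cliqueFree_induce_of_forall {G : SimpleGraph V} {W : Finset V}
    (h : ∀ T : Finset V, G.IsClique (T : Set V) → #T = q + 1 → ¬ Disjoint T W) :
    (G.induce {x | x ∉ W}).CliqueFree (q + 1) := by
  intro K hK
  rw [isNClique_iff] at hK
  refine h (K.map (Function.Embedding.subtype _)) ?_ (by rw [card_map, hK.2]) ?_
  · intro a ha b hb hab
    rw [mem_coe, mem_map] at ha hb
    obtain ⟨a, ha, rfl⟩ := ha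
    obtain ⟨b, hb, rfl⟩ := hb
    exact hK.1 ha hb fun e => hab (by rw [e])
  · rw [Finset.disjoint_left]
    intro x hx
    obtain ⟨y, -, rfl⟩ := mem_map.1 hx
    exact y.2

variable [Fintype V] {G : SimpleGraph V}

/-- A set that meets all cliques (or all pairs of cliques with one common vertex). -/
theorem NearTuran.exists_core (h : G.NearTuran q m) (hk : 1 ≤ k) (hf : f = (k - 1) / 2)
    (hn : 9 * k ^ 4 * (q + 1) ^ 5 ≤ Fintype.card V) (hfree : ∀ A p, ¬ G.HasCliquePath q k A p)
    (he : f * (Fintype.card V - f) + (turanGraph (Fintype.card V - f) q).edgeSet.ncard ≤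
      G.edgeSet.ncard) :
    ∃ W : Finset V, #W = f ∧
      (Odd k → ∀ T : Finset V, G.IsClique (T : Set V) → #T = q + 1 → ¬ Disjoint T W) ∧
      (Even k → ∀ A p, G.HasCliquePath q 2 A p → ¬ Disjoint A W) := by
  have hq := h.two_le
  rcases le_or_gt k 2 with hk2 | hk3
  · refine ⟨∅, by rw [card_empty]; lia, fun hodd T hT hc _ => ?_, fun heven A p hA _ => ?_⟩
    · obtain rfl : k = 1 := by obtain ⟨j, rfl⟩ := hodd; lia
      obtain ⟨y, hy⟩ := card_pos.1 (by lia : 0 < #T)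
      exact hfree _ _ (hT.hasCliquePath_one hc hy (by lia))
    · obtain rfl : k = 2 := by obtain ⟨j, rfl⟩ := heven; lia
      exact hfree _ _ hA
  obtain ⟨W, hW, hWr⟩ : ∃ W : Finset V, #W = f ∧ ∀ w ∈ W,
      #(G.nonNbr w) + (2 * f + 6) * (q + 1) ≤ m ∧ 6 * #(G.nonNbr w) ≤ Fintype.card V := by
    rcases hq.eq_or_lt with rfl | hq3
    · exact h.exists_large_degree_of_two hk3 (by lia) (by lia) hn hfree he
    · exact h.exists_large_degree_of_three_le hq3 hk3 (by lia) (by lia) hn hfree he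
  obtain ⟨w, L, hwL⟩ : ∃ w L, W.toList = w :: L := by
    refine List.exists_cons_of_ne_nil fun h => ?_
    rw [toList_eq_nil] at h
    rw [h, card_empty] at hW
    lia
  have hmem : ∀ v ∈ w :: L, v ∈ W := fun v hv => by rwa [← hwL, mem_toList] at hv
  have hlen : L.length + 1 = f := by
    rw [← hW, ← length_toList, hwL, List.length_cons]
  have hnd : (w :: L).Nodup := hwL ▸ nodup_toList W
  have hsize : 12 * ((2 * L.length + 6) * (q + 1)) ≤ Fintype.card V := by
    refine le_trans ?_ hn
    have h1 : (q + 1) * 1 ≤ (q + 1) * (q + 1) ^ 4 := Nat.mul_le_mul_left _ (Nat.one_le_pow _ _ (by lia))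
    have h2 : 27 * k ≤ k ^ 4 := by
      have : 3 ^ 3 ≤ k ^ 3 := Nat.pow_le_pow_left (by lia) 3
      calc 27 * k ≤ k ^ 3 * k := Nat.mul_le_mul_right _ this
        _ = k ^ 4 := by ring
    calc 12 * ((2 * L.length + 6) * (q + 1)) = (12 * (2 * L.length + 6)) * (q + 1) := by ring
      _ ≤ (9 * k ^ 4) * (q + 1) ^ 5 := Nat.mul_le_mul (by lia) (by linarith [pow_succ' (q + 1) 4])
  have hE : (2 * L.length + 6) * (q + 1) ≤ (2 * f + 6) * (q + 1) :=
    Nat.mul_le_mul_right _ (by lia)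
  have hdis : ∀ T : Finset V, Disjoint T W → ∀ v ∈ w :: L, v ∉ T := fun T hd v hv hvT =>
    Finset.disjoint_left.1 hd hvT (hmem v hv)
  refine ⟨W, hW, fun hodd T hT hc hd => ?_, fun heven A p hA hd => ?_⟩
  · obtain ⟨A, p, hA⟩ := h.hasCliquePath_of_isClique (fun v hv => (hWr v (hmem v hv)).1) hnd hE
      (hWr w (hmem w (by simp))).2 hsize hT hc (hdis T hd)
    have : 2 * L.length + 3 = k := by obtain ⟨j, rfl⟩ := hodd; lia
    exact hfree _ _ (this ▸ hA)
  · obtain ⟨A, p, hA⟩ := h.hasCliquePath_of_hasCliquePath_two (fun v hv => (hWr v (hmem v hv)).1)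
      hnd hE (fun v hv => (hWr v (hmem v hv)).2) hsize hA (hdis A hd)
    have : 2 * L.length + 4 = k := by obtain ⟨j, rfl⟩ := heven; lia
    exact hfree _ _ (this ▸ hA)

theorem exists_ceil_div (hq : 1 ≤ q) (N : ℕ) : ∃ m, N ≤ q * m ∧ q * m + 1 ≤ N + q := by
  refine ⟨(N + q - 1) / q, ?_, ?_⟩
  · have := Nat.lt_mul_div_succ (N + q - 1) (by lia : 0 < q)
    rw [mul_add] at this
    lia
  · have := Nat.mul_div_le (N + q - 1) q
    lia

theorem le_ceil {N m x : ℕ} (hm : N ≤ q * m) (hx : q * x + 1 ≤ N + q) : x ≤ m := by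
  by_contra hlt
  have : q * (m + 1) ≤ q * x := Nat.mul_le_mul_left _ (by lia)
  rw [mul_add] at this
  lia

/-- The upper bound for graphs of large minimum degree. -/
theorem eq_edgeCountG_of_card_nonNbr_le (hq : 2 ≤ q) (hk : 1 ≤ k)
    (hn : 9 * k ^ 4 * (q + 1) ^ 5 ≤ Fintype.card V)
    (hdeg : ∀ v, q * #(G.nonNbr v) + 1 ≤ Fintype.card V - numUniversal k + q)
    (hfree : ∀ A p, ¬ G.HasCliquePath q k A p)
    (he : edgeCountG (Fintype.card V) k (q + 1) ≤ G.edgeSet.ncard) :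
    G.edgeSet.ncard = edgeCountG (Fintype.card V) k (q + 1) ∧
      IsoToGraphG (Fintype.card V) k (q + 1) G := by
  set f := numUniversal k with hf
  set n := Fintype.card V with hndef
  -- The colouring argument needs `64 * (q + 1) ^ 5` vertices in `G - W`. It is used only for even
  -- `k`, so `k = 1`, where the bound could fail, is exempt.
  have hkn : 64 * (q + 1) ^ 5 + f ≤ n ∨ k = 1 := by
    rcases hk.eq_or_lt with rfl | hk2
    · exact Or.inr rfl
    left
    refine le_trans ?_ hn
    have h1 : 8 * k ≤ k ^ 4 := by
      have : 2 ^ 3 ≤ k ^ 3 := Nat.pow_le_pow_left (by lia) 3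
      calc 8 * k ≤ k ^ 3 * k := Nat.mul_le_mul_right _ this
        _ = k ^ 4 := by ring
    have h2 : 1 ≤ (q + 1) ^ 5 := Nat.one_le_pow _ _ (by lia)
    have h3 : f ≤ k := by rw [hf, numUniversal]; lia
    have h4 : (64 + k) * (q + 1) ^ 5 ≤ 9 * k ^ 4 * (q + 1) ^ 5 := Nat.mul_le_mul_right _ (by lia)
    have h5 : k * 1 ≤ k * (q + 1) ^ 5 := Nat.mul_le_mul_left _ h2
    linarith
  have hfn : f ≤ n := by
    rcases hkn with h | rfl
    · lia
    · rw [hf, numUniversal]; lia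
  obtain ⟨m, hm₁, hm₂⟩ := exists_ceil_div (by lia : 1 ≤ q) n
  -- The part size for `n - f` vertices: it makes `G - W` near-Turán as well, while `m` serves for
  -- `G`.
  obtain ⟨m', hm'₁, hm'₂⟩ := exists_ceil_div (by lia : 1 ≤ q) (n - f)
  have hdeg' : ∀ v, #(G.nonNbr v) ≤ m' := fun v => le_ceil hm'₁ (hdeg v)
  have h : G.NearTuran q m :=
    ⟨hq, fun v => le_ceil hm₁ ((hdeg v).trans (by lia)), hm₁, hm₂⟩
  have hT := two_mul_ncard_edgeSet_graphJoin_top (A := Fin f) (turanGraph (n - f) q)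
  rw [Fintype.card_fin, Fintype.card_fin] at hT
  have hJT : (joinTuran n k (q + 1)).edgeSet.ncard =
    (graphJoin (⊤ : SimpleGraph (Fin f)) (turanGraph (n - f) q)).edgeSet.ncard := rfl
  have hff : f ≤ f ^ 2 := by nlinarith
  obtain ⟨W, hW, hodd, heven⟩ := h.exists_core hk (f := f) rfl hn hfree (by
    rw [edgeCountG, hJT] at he
    have he' := (Nat.le_add_right _ _).trans he
    linarith)
  obtain ⟨hle, hiso⟩ := ncard_edgeSet_le_graphJoin_induce G W
  have hcW : Fintype.card {x // x ∈ W} = f := by rw [Fintype.card_coe, hW]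
  have hcH : Fintype.card {x | x ∉ W} = n - f := by
    have : Fintype.card {x // ¬ x ∈ W} = n - Fintype.card {x // x ∈ W} :=
      Fintype.card_subtype_compl _
    rw [hcW] at this
    exact this
  have hJ := two_mul_ncard_edgeSet_graphJoin_top (A := {x // x ∈ W}) (G.induce {x | x ∉ W})
  rw [hcW, hcH] at hJ
  have eW : {x // x ∈ W} ≃ Fin f := (Fintype.equivFinOfCardEq hcW)
  rcases Nat.even_or_odd k with hk' | hk'
  · have hk2 : k ≠ 1 := by rintro rfl; exact absurd hk' (by decide)
    have hH : (G.induce {x | x ∉ W}).NearTuran q m' := by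
      refine ⟨hq, fun v => ?_, by rwa [hcH], by rwa [hcH]⟩
      refine le_trans ?_ (hdeg' v)
      refine card_le_card_of_injOn (↑) (fun x hx => ?_) Subtype.val_injective.injOn
      simpa using hx
    rw [edgeCountG, if_pos hk', hJT] at he ⊢
    obtain ⟨a, b, hab, hcf⟩ := hH.exists_deleteEdges_cliqueFree
      (by rw [hcH]; have := hkn.resolve_right hk2; lia)
      (fun A p hA => by
        obtain ⟨h1, h2⟩ := hasCliquePath_of_hasCliquePath_induce hA
        exact heven hk' _ _ h1 h2)
      (by rw [hcH]; lia)
    obtain ⟨hD, hDiso⟩ := hcf.ncard_edgeSet_le (by lia)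
    have hdel : ((G.induce {x | x ∉ W}).deleteEdges {s(a, b)}).edgeSet.ncard + 1 =
        (G.induce {x | x ∉ W}).edgeSet.ncard := by
      rw [edgeSet_deleteEdges]
      exact Set.ncard_sdiff_singleton_add_one hab (Set.toFinite _)
    rw [hcH] at hD hDiso
    have hGe : G.edgeSet.ncard = (graphJoin (⊤ : SimpleGraph {x // x ∈ W})
      (G.induce {x | x ∉ W})).edgeSet.ncard := by lia
    refine ⟨by lia, ?_⟩
    obtain ⟨φ⟩ := hDiso (by lia)
    obtain ⟨ψ⟩ := hiso hGe
    have φ' : G.induce {x | x ∉ W} ≃g turanGraph (n - f) q ⊔ edge (φ a) (φ b) := by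
      refine ⟨φ.toEquiv, fun {x y} => ?_⟩
      have h1 := φ.map_adj_iff (v := x) (w := y)
      have h2 : ∀ z w, φ.toEquiv z = φ w ↔ z = w := fun z w => φ.toEquiv.apply_eq_iff_eq
      rw [sup_adj, edge_adj]
      have h3 : (turanGraph (n - f) q).Adj (φ.toEquiv x) (φ.toEquiv y) ↔ _ := h1
      rw [h3, deleteEdges_adj, h2, h2, h2, h2, Set.mem_singleton_iff, Sym2.eq_iff]
      have h4 : φ.toEquiv x ≠ φ.toEquiv y ↔ x ≠ y := φ.toEquiv.apply_eq_iff_eq.not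
      rw [h4]
      constructor
      · rintro (h | ⟨⟨rfl, rfl⟩ | ⟨rfl, rfl⟩, -⟩)
        · exact h.1
        · exact hab
        · exact hab.symm
      · intro h
        by_cases hxy : x = a ∧ y = b ∨ x = b ∧ y = a
        · exact Or.inr ⟨hxy, h.ne⟩
        · exact Or.inl ⟨h, hxy⟩
    refine ⟨joinTuran n k (q + 1) ⊔ edge (Sum.inr (φ a)) (Sum.inr (φ b)),
      Or.inr ⟨hk', _, _, ?_, ?_, rfl⟩, ⟨ψ.trans ?_⟩⟩
    · rw [Ne, Sum.inr.injEq]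
      exact fun e => hab.ne (φ.toEquiv.injective e)
    · intro had
      have : (turanGraph (n - f) q).Adj (φ a) (φ b) := graphJoin_adj_inr_inr.1 had
      rw [φ.map_adj_iff, deleteEdges_adj] at this
      exact this.2 rfl
    · have := graphJoinTopIso eW φ'
      rwa [graphJoin_sup_edge] at this
  · rw [edgeCountG, if_neg (Nat.not_even_iff_odd.2 hk'), hJT] at he ⊢
    have hcf := cliqueFree_induce_of_forall (hodd hk')
    obtain ⟨hD, hDiso⟩ := hcf.ncard_edgeSet_le (by lia)
    rw [hcH] at hD hDiso
    have hGe : G.edgeSet.ncard = (graphJoin (⊤ : SimpleGraph {x // x ∈ W})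
      (G.induce {x | x ∉ W})).edgeSet.ncard := by lia
    refine ⟨by lia, joinTuran n k (q + 1), Or.inl ⟨hk', rfl⟩, ?_⟩
    obtain ⟨φ⟩ := hDiso (by lia)
    obtain ⟨ψ⟩ := hiso hGe
    exact ⟨ψ.trans (graphJoinTopIso eW φ)⟩

end

/-! ### Removing the degree condition -/

section

variable {V : Type u} [Fintype V] {G : SimpleGraph V} {q l k m f : ℕ}

theorem ncard_edgeSet_induce_compl_singleton (G : SimpleGraph V) (v : V) :
    (G.induce {v}ᶜ).edgeSet.ncard + #{y | G.Adj v y} = G.edgeSet.ncard := by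
  have h1 := G.card_edgeFinset_induce_compl_singleton v
  have h2 := G.card_edgeFinset_deleteIncidenceSet v
  have h3 := card_le_card (G.incidenceFinset_subset v)
  rw [card_incidenceFinset_eq_degree] at h3
  have h4 : #{y | G.Adj v y} = G.degree v := by
    rw [← card_neighborFinset_eq_degree]
    congr 1; ext y; simp
  rw [ncard_edgeSet_eq, ncard_edgeSet_eq, h4]
  lia

theorem two_mul_ncard_edgeSet_add_card_le (G : SimpleGraph V) :
    2 * G.edgeSet.ncard + Fintype.card V ≤ Fintype.card V ^ 2 := by
  rw [← sum_card_adj_univ_eq, sq]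
  calc ∑ x, #{y | G.Adj x y} + Fintype.card V = ∑ x, (#{y | G.Adj x y} + 1) := by
        rw [sum_add_distrib]; simp
    _ ≤ ∑ _x : V, Fintype.card V := sum_le_sum fun x _ => by
        rw [← card_adj_add_card_nonNbr G x]
        exact Nat.add_le_add_left (card_pos.2 ⟨x, by simp⟩) _
    _ = Fintype.card V * Fintype.card V := by simp

theorem edgeCountG_succ (hq : 1 ≤ q) (hm : numUniversal k ≤ m) :
    edgeCountG (m + 1) k (q + 1) + (m - numUniversal k) / q = edgeCountG m k (q + 1) + m := by
  obtain ⟨N, rfl⟩ := Nat.exists_eq_add_of_le hm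
  have h1 := two_mul_ncard_edgeSet_graphJoin_top (A := Fin (numUniversal k)) (turanGraph (N + 1) q)
  have h2 := two_mul_ncard_edgeSet_graphJoin_top (A := Fin (numUniversal k)) (turanGraph N q)
  have h3 := ncard_edgeSet_turanGraph_succ hq N
  have e1 : numUniversal k + N + 1 - numUniversal k = N + 1 := by lia
  have e2 : numUniversal k + N - numUniversal k = N := by lia
  have h4 : (joinTuran (numUniversal k + N + 1) k (q + 1)).edgeSet.ncard =
      (graphJoin (⊤ : SimpleGraph (Fin (numUniversal k))) (turanGraph (N + 1) q)).edgeSet.ncard :=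
    congrArg (fun M =>
      (graphJoin (⊤ : SimpleGraph (Fin (numUniversal k))) (turanGraph M q)).edgeSet.ncard) e1
  have h5 : (joinTuran (numUniversal k + N) k (q + 1)).edgeSet.ncard =
      (graphJoin (⊤ : SimpleGraph (Fin (numUniversal k))) (turanGraph N q)).edgeSet.ncard :=
    congrArg (fun M =>
      (graphJoin (⊤ : SimpleGraph (Fin (numUniversal k))) (turanGraph M q)).edgeSet.ncard) e2
  rw [edgeCountG, edgeCountG, h4, h5, e2]
  simp only [Fintype.card_fin] at h1 h2
  rw [mul_add, mul_one] at h1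
  generalize (if Even k then 1 else 0) = ε
  linarith

/-- A graph with a vertex of low degree loses few edges when this vertex is deleted. -/
theorem exists_induce_of_lt (hq : 1 ≤ q) (hV : Fintype.card V = m + 1) (hm : numUniversal k ≤ m)
    {v : V} (hv : m + 1 - numUniversal k + q < q * #(G.nonNbr v) + 1)
    (hfree : ∀ A p, ¬ G.HasCliquePath q k A p) :
    ∃ (W : Type u) (_ : Fintype W) (H : SimpleGraph W), Fintype.card W = m ∧
      (∀ A p, ¬ H.HasCliquePath q k A p) ∧
      G.edgeSet.ncard + 1 + edgeCountG m k (q + 1) ≤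
        H.edgeSet.ncard + edgeCountG (m + 1) k (q + 1) := by
  refine ⟨({v}ᶜ : Set V), inferInstance, G.induce {v}ᶜ, ?_, fun A p hA =>
    hfree _ _ (hA.map (Embedding.induce ({v}ᶜ : Set V)).toHom Subtype.val_injective), ?_⟩
  · rw [Fintype.card_compl_set, hV]; simp
  · have h1 := ncard_edgeSet_induce_compl_singleton G v
    have h2 := card_adj_add_card_nonNbr G v
    have h3 := edgeCountG_succ (k := k) hq hm
    -- The deleted vertex has degree at least one below the increment `m - (m - f) / q` of the
    -- extremal number.
    have h4 : (m - numUniversal k) / q + 2 ≤ #(G.nonNbr v) := by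
      by_contra hlt
      have h5 : q * #(G.nonNbr v) ≤ q * ((m - numUniversal k) / q + 1) :=
        Nat.mul_le_mul_left _ (by lia)
      have h6 := Nat.mul_div_le (m - numUniversal k) q
      rw [mul_add] at h5
      lia
    lia

/-- Vertices of low degree are deleted down to `N = 9 * k ^ 4 * (q + 1) ^ 5` vertices. If the degree
condition holds on the way, the bound holds there and passes back up. Otherwise the surplus grows by
`m - N` and ends at no more than `N.choose 2`, which is the second alternative. -/
theorem ncard_edgeSet_le_or (hq : 2 ≤ q) (hk : 1 ≤ k) (hm : 9 * k ^ 4 * (q + 1) ^ 5 ≤ m)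
    (hV : Fintype.card V = m) (hfree : ∀ A p, ¬ G.HasCliquePath q k A p) :
    G.edgeSet.ncard ≤ edgeCountG m k (q + 1) ∨
      2 * G.edgeSet.ncard + 2 * (m - 9 * k ^ 4 * (q + 1) ^ 5) + 9 * k ^ 4 * (q + 1) ^ 5 ≤
        2 * edgeCountG m k (q + 1) + (9 * k ^ 4 * (q + 1) ^ 5) ^ 2 := by
  have hf : numUniversal k ≤ 9 * k ^ 4 * (q + 1) ^ 5 := by
    have h1 : k ≤ k ^ 4 := Nat.le_self_pow (by lia) k
    have h2 : k ^ 4 * 1 ≤ k ^ 4 * (q + 1) ^ 5 := Nat.mul_le_mul_left _ (Nat.one_le_pow _ _ (by lia))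
    rw [numUniversal]
    lia
  induction m, hm using Nat.le_induction generalizing V with
  | base =>
    right
    have := two_mul_ncard_edgeSet_add_card_le G
    rw [hV] at this
    lia
  | succ m hm ih =>
    by_cases hdeg : ∀ v, q * #(G.nonNbr v) + 1 ≤ m + 1 - numUniversal k + q
    · left
      by_contra hlt
      rw [← hV] at hdeg hlt
      exact hlt (eq_edgeCountG_of_card_nonNbr_le hq hk (by lia) hdeg hfree (by lia)).1.le
    · push Not at hdeg
      obtain ⟨v, hv⟩ := hdeg
      obtain ⟨W, _, H, hW, hH, he⟩ := exists_induce_of_lt (by lia) hV (by lia) hv hfree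
      rcases ih hW hH with h | h
      · left; lia
      · right; lia

theorem ncard_edgeSet_le_edgeCountG (hq : 2 ≤ q) (hk : 1 ≤ k)
    (hn : 16 * k ^ 8 * (q + 1) ^ 11 < Fintype.card V)
    (hfree : ∀ A p, ¬ G.HasCliquePath q k A p) :
    G.edgeSet.ncard ≤ edgeCountG (Fintype.card V) k (q + 1) ∧
      (G.edgeSet.ncard = edgeCountG (Fintype.card V) k (q + 1) →
        IsoToGraphG (Fintype.card V) k (q + 1) G) := by
  obtain ⟨N, hN⟩ : ∃ N, N = 9 * k ^ 4 * (q + 1) ^ 5 := ⟨_, rfl⟩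
  -- Origin of `16 * k ^ 8 * r ^ 11`: as `r ≥ 3`, twice this is at least `96 * k ^ 8 * r ^ 10`,
  -- while the left side is at most `(81 + 9 + 3) * k ^ 8 * r ^ 10`.
  have hNn : N ^ 2 + N + 3 ≤ 2 * Fintype.card V := by
    have h1 : 3 * (q + 1) ^ 10 ≤ (q + 1) ^ 11 := by
      rw [pow_succ (q + 1) 10, mul_comm]
      exact Nat.mul_le_mul_left _ (by lia)
    have h2 : 32 * k ^ 8 * (3 * (q + 1) ^ 10) ≤ 32 * k ^ 8 * (q + 1) ^ 11 := Nat.mul_le_mul_left _ h1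
    have h3 : N ^ 2 = 81 * (k ^ 8 * (q + 1) ^ 10) := by rw [hN]; ring
    have h4 : N ≤ 9 * (k ^ 8 * (q + 1) ^ 10) := by
      rw [hN, mul_assoc]
      exact Nat.mul_le_mul_left _ (Nat.mul_le_mul (Nat.pow_le_pow_right hk (by lia))
        (Nat.pow_le_pow_right (by lia) (by lia)))
    have h5 : 1 ≤ k ^ 8 * (q + 1) ^ 10 :=
      Nat.mul_pos (Nat.pow_pos hk) (Nat.pow_pos (by lia))
    linarith
  have hNN : N ≤ N ^ 2 := Nat.le_self_pow (by lia) N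
  have hf : numUniversal k ≤ N := by
    have h1 : k ≤ k ^ 4 := Nat.le_self_pow (by lia) k
    have h2 : k ^ 4 * 1 ≤ k ^ 4 * (q + 1) ^ 5 := Nat.mul_le_mul_left _ (Nat.one_le_pow _ _ (by lia))
    rw [numUniversal]
    lia
  by_cases hdeg : ∀ v, q * #(G.nonNbr v) + 1 ≤ Fintype.card V - numUniversal k + q
  · have h := eq_edgeCountG_of_card_nonNbr_le hq hk (by lia) hdeg hfree
    refine ⟨?_, fun he => (h he.ge).2⟩
    by_contra hlt
    exact hlt (h (by lia)).1.le
  · push Not at hdeg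
    obtain ⟨v, hv⟩ := hdeg
    obtain ⟨m, hm⟩ : ∃ m, Fintype.card V = m + 1 := ⟨Fintype.card V - 1, by lia⟩
    rw [hm] at hv hNn ⊢
    obtain ⟨W, _, H, hW, hH, he⟩ := exists_induce_of_lt (by lia) hm (by lia) hv hfree
    have h := ncard_edgeSet_le_or hq hk (by lia) hW hH
    rw [← hN] at h
    rcases h with h | h
    · exact ⟨by lia, fun h' => by lia⟩
    · exact ⟨by lia, fun h' => by lia⟩

end

/-! ### The extremal graphs contain no clique-path -/

section

variable {V : Type*} {G : SimpleGraph V} {q l k m n r f : ℕ}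

/-- The vertex `x` of the clique-path belongs to its `i`-th clique. -/
def CliquePathMem (i : Fin k) : Fin (k + 1) ⊕ Fin k × Fin (r - 2) → Prop
  | Sum.inl j => j = i.castSucc ∨ j = i.succ
  | Sum.inr c => c.1 = i

theorem cliquePath_adj_of_mem {i : Fin k} {x y : Fin (k + 1) ⊕ Fin k × Fin (r - 2)}
    (hx : CliquePathMem i x) (hy : CliquePathMem i y) (hxy : x ≠ y) :
    (cliquePath k r).Adj x y := by
  rcases x with x | ⟨x, a⟩ <;> rcases y with y | ⟨y, b⟩ <;>
    simp only [CliquePathMem] at hx hy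
  · have hne : x ≠ y := fun h => hxy (h ▸ rfl)
    simp only [cliquePath, pathGraph_adj]
    rcases hx with rfl | rfl <;> rcases hy with rfl | rfl <;> simp_all
  · subst hy; exact hx
  · subst hx; exact hy
  · subst hx; subst hy
    exact ⟨rfl, fun h => hxy (by simp only at h; rw [h])⟩

/-- Because of this, one additional edge can serve only one clique of an embedded clique-path. -/
theorem eq_of_cliquePathMem {i i' : Fin k} {x y : Fin (k + 1) ⊕ Fin k × Fin (r - 2)} (hxy : x ≠ y)
    (hx : CliquePathMem i x) (hy : CliquePathMem i y) (hx' : CliquePathMem i' x)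
    (hy' : CliquePathMem i' y) : i = i' := by
  rcases x with x | x <;> rcases y with y | y <;> simp only [CliquePathMem] at hx hy hx' hy'
  · have hne : (x : ℕ) ≠ y := fun h => hxy (by rw [Fin.ext h])
    simp only [Fin.ext_iff, Fin.val_castSucc, Fin.val_succ] at hx hy hx' hy' ⊢
    lia
  · exact hy.symm.trans hy'
  · exact hx.symm.trans hx'
  · exact hx.symm.trans hx'

theorem card_cliquePathMem_le (x : Fin (k + 1) ⊕ Fin k × Fin (r - 2)) :
    #{i : Fin k | CliquePathMem i x} ≤ 2 := by
  rcases x with x | x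
  · by_contra hlt
    obtain ⟨a, ha, b, hb, c, hc, hab, hac, hbc⟩ := two_lt_card.1 (not_le.1 hlt)
    simp only [CliquePathMem, mem_filter, mem_univ, true_and, Fin.ext_iff, Fin.val_castSucc,
      Fin.val_succ, ne_eq] at ha hb hc hab hac hbc
    lia
  · refine (card_le_one.2 fun a ha b hb => ?_).trans one_le_two
    exact (mem_filter.1 ha).2.symm.trans (mem_filter.1 hb).2

/-- Pigeonhole: two of the `r` vertices of the clique fall into the same of the `r - 1` Turán parts.
-/
theorem exists_not_adj_of_map_clique (hr : 3 ≤ r) (i : Fin k)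
    {φ : Fin (k + 1) ⊕ Fin k × Fin (r - 2) → Fin (numUniversal k) ⊕ Fin (n - numUniversal k)}
    (hi : ∀ x, CliquePathMem i x → ∃ y, φ x = Sum.inr y) :
    ∃ x y, x ≠ y ∧ CliquePathMem i x ∧ CliquePathMem i y ∧ ¬ (joinTuran n k r).Adj (φ x) (φ y) := by
  let g : Bool ⊕ Fin (r - 2) → Fin (k + 1) ⊕ Fin k × Fin (r - 2) :=
    Sum.elim (fun b => Sum.inl (bif b then i.succ else i.castSucc)) fun j => Sum.inr (i, j)
  have hg : Function.Injective g := by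
    rintro (a | a) (b | b) h
    · cases a <;> cases b <;> simp [g, Fin.ext_iff] at h ⊢
    · simp [g] at h
    · simp [g] at h
    · simpa [g] using h
  have hgM : ∀ a, CliquePathMem i (g a) := by
    rintro (a | a)
    · cases a <;> simp [g, CliquePathMem]
    · simp [g, CliquePathMem]
  choose y hy using fun a => hi _ (hgM a)
  obtain ⟨a, b, hab, h⟩ := Fintype.exists_ne_map_eq_of_card_lt
    (fun a => (⟨(y a : ℕ) % (r - 1), Nat.mod_lt _ (by lia)⟩ : Fin (r - 1)))
    (by rw [Fintype.card_sum, Fintype.card_bool, Fintype.card_fin, Fintype.card_fin]; lia)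
  refine ⟨g a, g b, hg.ne hab, hgM a, hgM b, ?_⟩
  rw [hy, hy]
  intro hadj
  have hadj' := graphJoin_adj_inr_inr.1 hadj
  exact hadj' (Fin.ext_iff.1 h)

/-- Each universal vertex is the image of at most one vertex of the clique-path, which lies in at
most two cliques; the other cliques avoid the universal part. -/
theorem le_card_add_two_mul
    {φ : Fin (k + 1) ⊕ Fin k × Fin (r - 2) → Fin f ⊕ Fin m} (hφ : Function.Injective φ) :
    k ≤ #{i : Fin k | ∀ x, CliquePathMem i x → ∃ y, φ x = Sum.inr y} + 2 * f := by
  have h1 := card_filter_add_card_filter_not (s := (univ : Finset (Fin k)))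
    (fun i => ∀ x, CliquePathMem i x → ∃ y, φ x = Sum.inr y)
  have h2 : #{i : Fin k | ¬ ∀ x, CliquePathMem i x → ∃ y, φ x = Sum.inr y} ≤
      #((univ : Finset (Fin f)).biUnion fun u =>
        {i : Fin k | ∃ x, φ x = Sum.inl u ∧ CliquePathMem i x}) := by
    refine card_le_card fun i hi => ?_
    simp only [mem_filter, mem_univ, true_and, not_forall] at hi
    obtain ⟨x, hx, hi⟩ := hi
    rcases hφx : φ x with u | y
    · simp only [mem_biUnion, mem_filter, mem_univ, true_and]
      exact ⟨u, x, hφx, hx⟩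
    · exact absurd ⟨y, hφx⟩ hi
  have h3 : ∀ u : Fin f, #{i : Fin k | ∃ x, φ x = Sum.inl u ∧ CliquePathMem i x} ≤ 2 := by
    intro u
    by_cases hu : ∃ x, φ x = Sum.inl u
    · obtain ⟨x, hx⟩ := hu
      refine (card_le_card fun i hi => ?_).trans (card_cliquePathMem_le (r := r) x)
      simp only [mem_filter, mem_univ, true_and] at hi ⊢
      obtain ⟨x', hx', hi⟩ := hi
      rwa [hφ (hx.trans hx'.symm)]
    · rw [filter_false_of_mem fun i _ hi => hu (hi.imp fun x hx => hx.1), card_empty]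
      exact Nat.zero_le _
  have h4 := h2.trans (card_biUnion_le_card_mul _ _ 2 fun u _ => h3 u)
  rw [card_univ, Fintype.card_fin] at h1 h4
  lia

theorem IsGraphG.free (hk : 1 ≤ k) (hr : 3 ≤ r)
    {H : SimpleGraph (Fin (numUniversal k) ⊕ Fin (n - numUniversal k))} (h : IsGraphG n k r H) :
    (cliquePath k r).Free H := by
  rintro ⟨⟨φ, hφ⟩⟩
  have hcard := le_card_add_two_mul hφ
  have hf : numUniversal k = (k - 1) / 2 := rfl
  rcases h with ⟨hk', rfl⟩ | ⟨hk', a, b, hab, hn, rfl⟩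
  · obtain ⟨i, hi⟩ : (({i : Fin k | ∀ x, CliquePathMem i x → ∃ y, φ x = Sum.inr y}) :
        Finset (Fin k)).Nonempty := by
      rw [← card_pos]
      obtain ⟨j, rfl⟩ := hk'
      lia
    obtain ⟨x, y, hxy, hx, hy, hadj⟩ := exists_not_adj_of_map_clique hr i (mem_filter.1 hi).2
    exact hadj (φ.map_adj (cliquePath_adj_of_mem hx hy hxy))
  · obtain ⟨i, hi, i', hi', hii'⟩ := one_lt_card.1 (by
      obtain ⟨j, rfl⟩ := hk'
      lia : 1 < #{i : Fin k | ∀ x, CliquePathMem i x → ∃ y, φ x = Sum.inr y})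
    -- A clique in the Turán part must use the additional edge, hence contains the preimages of both
    -- `a` and `b`; with `k = 2 * f + 2` there are two such cliques.
    have key : ∀ i : Fin k, (∀ x, CliquePathMem i x → ∃ y, φ x = Sum.inr y) →
        ∃ x y, φ x = a ∧ φ y = b ∧ CliquePathMem i x ∧ CliquePathMem i y := by
      intro i hi
      obtain ⟨x, y, hxy, hx, hy, hadj⟩ := exists_not_adj_of_map_clique hr i hi
      have h1 := φ.map_adj (cliquePath_adj_of_mem hx hy hxy)
      rw [sup_adj, edge_adj] at h1
      rcases h1 with h1 | ⟨⟨h1, h2⟩ | ⟨h1, h2⟩, -⟩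
      · exact absurd h1 hadj
      · exact ⟨x, y, h1, h2, hx, hy⟩
      · exact ⟨y, x, h2, h1, hy, hx⟩
    obtain ⟨x, y, hx, hy, hxi, hyi⟩ := key i (mem_filter.1 hi).2
    obtain ⟨x', y', hx', hy', hxi', hyi'⟩ := key i' (mem_filter.1 hi').2
    obtain rfl : x = x' := hφ (hx.trans hx'.symm)
    obtain rfl : y = y' := hφ (hy.trans hy'.symm)
    have hxy : x ≠ y := fun e => hab (hx.symm.trans ((congrArg φ e).trans hy))
    exact hii' (eq_of_cliquePathMem hxy hxi hyi hxi' hyi')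

end

end SimpleGraph
end

theorem theorem2 (n k r : ℕ) (hk : 1 ≤ k) (hr : 3 ≤ r) (hn : 16 * k ^ 8 * r ^ 11 < n)
    {V : Type*} [Fintype V] (hV : Fintype.card V = n) (G : SimpleGraph V) :
    ((cliquePath k r).Free G →
      G.edgeSet.ncard ≤ edgeCountG n k r ∧
        (G.edgeSet.ncard = edgeCountG n k r ↔ IsoToGraphG n k r G)) ∧
    (IsoToGraphG n k r G → (cliquePath k r).Free G) := by
  obtain ⟨q, rfl⟩ : ∃ q, r = q + 1 := ⟨r - 1, by lia⟩
  subst hV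
  refine ⟨fun hfree => ?_, ?_⟩
  · obtain ⟨h1, h2⟩ := SimpleGraph.ncard_edgeSet_le_edgeCountG (G := G) (by lia) hk hn
      fun A p hA => hA.not_free hfree
    refine ⟨h1, h2, ?_⟩
    rintro ⟨H, hH, ⟨φ⟩⟩
    rw [φ.ncard_edgeSet_eq, hH.ncard_edgeSet]
  · rintro ⟨H, hH, ⟨φ⟩⟩
    exact (SimpleGraph.free_congr_right φ).2 (SimpleGraph.IsGraphG.free hk hr hH)
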